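/- Let $1\le m<d$ be integers and let $K\subset\mathbb C^{m+1}$ be a compact set such that $a_m\ne0$ for all $\mathbf a=(a_0,\dots,a_m)\in K$. For $(t,\mathbf a)\in[0,1]\times K$ put $$Q(z,t,\mathbf a)=tz^d+\sum_{j=0}^m a_jz^j .$$ A ray $L=\{re^{i\theta}:r\ge0\}$ is called admissible if there are $\delta>0$ and $R>0$ such that for all $(t,\mathbf a)\in[0,1]\times K$: (a) every zero $z$ of $Q(\cdot,t,\mathbf a)$ with $|z|>R$ satisfies $|\arg z-\theta|\ge\delta$ (modulo $2\pi$); (b) at every point $z\in L$ with $|z|>R$ and $Q(z,t,\mathbf a)\neq 0$, the smallest angle between $L$ and the vertical trajectory of $Q(z,t,\mathbf a)\,dz^2$ through $z$ (the integral curve of the direction field $Q\,dz^2<0$) is at least $\delta$; (c) $\theta$ is not a separating direction of $Q(z,t,\mathbf a)\,dz^2$, that is, if $cz^n$ is the leading term of $Q(\cdot,t,\mathbf a)$, then $ce^{i(n+2)\theta}$ is not a negative real number. The Stokes sectors of $Q(\cdot,t,\mathbf a)$ are the connected components of $\{z\neq0: cz^{n+2}\notin(-\infty,0)\}$. Let $L_1,L_2$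 be two admissible rays, with directions $\theta_1,\theta_2$, and consider the eigenvalue problem $$-y''+Qy=\lambda y,\qquad y(z)\to0\ \text{ as } z\to\infty,\ z\in L_1\cup L_2. \tag{1}$$ Then there is a family of entire functions $D(t,\mathbf a,\cdot)$, $(t,\mathbf a)\in[0,1]\times K$, depending continuously on $(t,\mathbf a)$ (up to and including $t=0$) in the topology of uniform convergence on compact subsets of $\mathbb C$, such that: 1. for every $(t,\mathbf a)\in[0,1]\times K$ the set of eigenvalues $\lambda$ of (1) is the zero set of $D(t,\mathbf a,\cdot)$; 2. $D$ is the Wronskian of Sibuya solutions, up to a factor without zeros. That is: for every $M>0$ there is $T>0$ such that for every $r_0\ge T$ and all $(t,\mathbf a)\in[0,1]\times K$, $|\lambda|\le M$, there are Sibuya solutions $y_1,y_2$ of $-y''+(Q-\lambda)y=0$ on the rays $L_1,L_2$ with base points $r_0e^{i\theta_1},r_0e^{i\theta_2}$, and a number $h(t,\mathbf a,\lambda)\neq0$, continuous in $(t,\mathbf a,\lambda)$ and holomorphic in $\lambda$ for $|\lambda|<M$, such that $D(t,\mathbf a,\lambda)=h\,(y_1'y_2-y_1y_2')$. Here a Sibuya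 solution on $L$ of $-y''+Py=0$ with base point $z_0=r_0e^{i\theta}$ is a solution with $$y(z)\sim P_L^{-1/4}(z)\exp\Bigl(-\int_{z_0}^zP_L^{1/2}(\zeta)\,d\zeta\Bigr),\qquad z\to\infty,\ z\in L,$$ where $P_L^{1/4}$ is a continuous branch of $P^{1/4}$ without zeros on $\{re^{i\theta}:r\ge r_0\}$, $P_L^{1/2}=(P_L^{1/4})^2$, and $\operatorname{Re}\int_{z_0}^zP_L^{1/2}(\zeta)\,d\zeta\to+\infty$ as $z\to\infty$ on $L$; 3. $D(t,\mathbf a,\cdot)\not\equiv0$ for every $(t,\mathbf a)\in[0,1]\times K$ for which $L_1$ and $L_2$ do not lie in the same Stokes sector of $Q(\cdot,t,\mathbf a)$. In particular, if for every $\mathbf a\in K$ the rays $L_1$ and $L_2$ do not lie in the same Stokes sector of $Q(\cdot,0,\mathbf a)$, then the spectrum of (1) depends continuously on $(t,\mathbf a)\in[0,1]\times K$, in the sense that it is the zero set of an entire function $f_{t,\mathbf a}\not\equiv0$ which depends continuously on $(t,\mathbf a)$ in the topology of uniform convergence on compact subsets of $\mathbb C$. -/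

import Mathlib

open Polynomial Topology Filter

noncomputable section

namespace SchroedingerRays

/-- `w` is a negative real number. -/
def IsNegReal (w : ℂ) : Prop := w.re < 0 ∧ w.im = 0

/-- The unit vector `e^{iθ}`. -/
def dir (θ : ℝ) : ℂ := Complex.exp (θ * Complex.I)

/-- The point at distance `r` from the origin on the ray of direction `θ`. -/
def ray (θ r : ℝ) : ℂ := r * dir θ

/-- The potential `Q(z,t,a) = t z^d + ∑_{j=0}^m a_j z^j`, with `p = (t, a)`. -/
def potential (d : ℕ) {m : ℕ} (p : ℝ × (Fin (m + 1) → ℂ)) : ℂ[X] :=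
  C (p.1 : ℂ) * X ^ d + ∑ j : Fin (m + 1), C (p.2 j) * X ^ (j : ℕ)

/-- `θ` is a separating direction of `P(z) dz²`: with `c z^n` the leading term of `P`,
`c z^(n+2)` is negative on the ray of direction `θ`. -/
def IsSeparating (P : ℂ[X]) (θ : ℝ) : Prop :=
  IsNegReal (P.leadingCoeff * dir θ ^ (P.natDegree + 2))

/-- The rays of directions `θ₁` and `θ₂` lie in one and the same (open) Stokes sector of `P`.
The set below is the complement of the separating rays and the origin; the Stokes sectors
are its connected components. -/
def SameStokesSector (P : ℂ[X]) (θ₁ θ₂ : ℝ) : Prop :=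
  dir θ₂ ∈ connectedComponentIn
    {z : ℂ | P.leadingCoeff * z ^ (P.natDegree + 2) ∈ Complex.slitPlane} (dir θ₁)

/-- Admissibility of the ray of direction `θ` for the family `Q(z,t,a)`, `(t,a) ∈ [0,1] × K`.
The constants `δ` and `R` do not depend on `(t,a)`.

* zeros of `Q` of modulus larger than `R` form an angle at least `δ` with the ray;
* at every point of the ray of modulus larger than `R`, the vertical trajectory of `Q dz²`
  through the point (tangent to the vectors `v` with `Q(z) v² < 0`; with `v` also `-v` is one)
  forms an angle at least `δ` with the ray;
* `θ` is not a separating direction of `Q dz²`. -/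
def Admissible (d : ℕ) {m : ℕ} (K : Set (Fin (m + 1) → ℂ)) (θ : ℝ) : Prop :=
  ∃ δ : ℝ, 0 < δ ∧ ∃ R : ℝ, 0 < R ∧ ∀ p ∈ Set.Icc (0 : ℝ) 1 ×ˢ K,
    (∀ z : ℂ, (potential d p).eval z = 0 → R < ‖z‖ →
      δ ≤ InnerProductGeometry.angle z (dir θ)) ∧
    (∀ r : ℝ, R < r → ∀ v : ℂ, IsNegReal ((potential d p).eval (ray θ r) * v ^ 2) →
      δ ≤ InnerProductGeometry.angle v (dir θ)) ∧
    ¬ IsSeparating (potential d p) θ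

/-- `y` is an (entire) solution of `-y'' + P y = lam y`. -/
def IsSolution (P : ℂ[X]) (lam : ℂ) (y : ℂ → ℂ) : Prop :=
  Differentiable ℂ y ∧ ∀ z, -(iteratedDeriv 2 y z) + P.eval z * y z = lam * y z

/-- The set of eigenvalues of `-y'' + P y = lam y`, `y(z) → 0` as `z → ∞` on the two rays of
directions `θ₁` and `θ₂`. -/
def eigenvalues (P : ℂ[X]) (θ₁ θ₂ : ℝ) : Set ℂ :=
  {lam | ∃ y : ℂ → ℂ, y ≠ 0 ∧ IsSolution P lam y ∧
    Tendsto (fun r : ℝ => y (ray θ₁ r)) atTop (𝓝 0) ∧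
    Tendsto (fun r : ℝ => y (ray θ₂ r)) atTop (𝓝 0)}

/-- `y` is a Sibuya solution of `-y'' + P y = 0` on the ray `{r e^{iθ} : r ≥ r₀}`:
for a continuous branch `q` of `P^{1/4}` on this ray, with
`Re ∫_{z₀}^z q(ζ)² dζ → +∞` along the ray, `z₀ = r₀ e^{iθ}`, one has
`y(z) ∼ q(z)⁻¹ exp (-∫_{z₀}^z q(ζ)² dζ)` as `z → ∞` along the ray. -/
def IsSibuyaSolution (P : ℂ[X]) (θ r₀ : ℝ) (y : ℂ → ℂ) : Prop :=
  IsSolution P 0 y ∧ ∃ q : ℝ → ℂ,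
    ContinuousOn q (Set.Ici r₀) ∧
    (∀ r ∈ Set.Ici r₀, q r ≠ 0 ∧ q r ^ 4 = P.eval (ray θ r)) ∧
    Tendsto (fun r : ℝ => (∫ s in r₀..r, q s ^ 2 * dir θ).re) atTop atTop ∧
    Asymptotics.IsEquivalent atTop (fun r : ℝ => y (ray θ r))
      (fun r : ℝ => (q r)⁻¹ * Complex.exp (-∫ s in r₀..r, q s ^ 2 * dir θ))

/-- The family `f x`, `x ∈ S`, consists of entire functions and depends continuously on `x`
in the topology of uniform convergence on compact subsets of the plane. -/
def ContinuousEntireFamily {X : Type*} [TopologicalSpace X] (f : X → ℂ → ℂ) (S : Set X) : Prop :=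
  (∀ x ∈ S, Differentiable ℂ (f x)) ∧ ∀ x ∈ S, TendstoLocallyUniformly f (f x) (𝓝[S] x)

/-- The subset `Z x` of the plane depends continuously on `x ∈ S`: it is the zero set of an
entire function `f x ≢ 0` that depends continuously on `x`. -/
def DependsContinuouslyOn {X : Type*} [TopologicalSpace X] (Z : X → Set ℂ) (S : Set X) : Prop :=
  ∃ f : X → ℂ → ℂ, ContinuousEntireFamily f S ∧
    ∀ x ∈ S, f x ≠ 0 ∧ Z x = {lam | f x lam = 0}

/-- `D` is, locally in `lam`, the Wronskian of Sibuya solutions `y₁`, `y₂` of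
`-y'' + (Q - lam) y = 0` on the two rays, up to a factor `h` without zeros: for every disc
`|lam| ≤ M` this holds with any base points `r₀ e^{iθ₁}`, `r₀ e^{iθ₂}` sufficiently far away.
(The factor accounts for the choice of the base points: for fixed `r₀` and large `lam` the
rays `r ≥ r₀` may contain zeros of `Q - lam`.) -/
def IsSibuyaDeterminant (d : ℕ) {m : ℕ} (S : Set (ℝ × (Fin (m + 1) → ℂ))) (θ₁ θ₂ : ℝ)
    (D : ℝ × (Fin (m + 1) → ℂ) → ℂ → ℂ) : Prop :=
  ∀ M : ℝ, ∃ T : ℝ, 0 < T ∧ ∀ r₀ : ℝ, T ≤ r₀ →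
    ∃ (y₁ y₂ : ℝ × (Fin (m + 1) → ℂ) → ℂ → ℂ → ℂ) (h : ℝ × (Fin (m + 1) → ℂ) → ℂ → ℂ),
      ContinuousOn (Function.uncurry h) (S ×ˢ Metric.closedBall 0 M) ∧
      (∀ p ∈ S, DifferentiableOn ℂ (h p) (Metric.ball 0 M)) ∧
      ∀ p ∈ S, ∀ lam ∈ Metric.closedBall (0 : ℂ) M,
        IsSibuyaSolution (potential d p - C lam) θ₁ r₀ (y₁ p lam) ∧
        IsSibuyaSolution (potential d p - C lam) θ₂ r₀ (y₂ p lam) ∧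
        h p lam ≠ 0 ∧
        ∀ z, D p lam = h p lam *
          (deriv (y₁ p lam) z * y₂ p lam z - y₁ p lam z * deriv (y₂ p lam) z)

end SchroedingerRays

end

open SchroedingerRays

open Polynomial Topology Filter

noncomputable section

namespace SchroedingerRays

/-! ### Entire solutions by power series -/

/-! Along a ray, with W(r) = e^{2iθ} Q(re^{iθ}) and μ = λe^{2iθ}, the equation becomes u'' = (W -
μ)u. The difficulty is that Q degenerates as t → 0: its degree drops from d to m and zeros escape to
infinity. Everything therefore rests on estimates along the ray that are uniform down to t = 0, and
these are collected in `GoodRay`: |W| grows at least linearly, W stays in a closed sector off the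
negative axis, and rW', r²W'' are bounded by multiples of |W|.

Admissibility gives these estimates (`Admissible.exists_goodRay`). Zeros that keep a positive angle
from the ray make |Q(z)| comparable with the sum of the moduli of the terms of Q
(`majorant_le_of_roots`). That sum controls the derivatives, and it contains the term |a_m| r^m,
which does not depend on t. The angle with the vertical trajectories gives the sector
(`sector_of_angle`).

On a good ray the Liouville-Green function `wkbSol`, corrected to first order in λ, solves the
equation up to an error E = O(1/r). The quotient v of a solution by `wkbSol` satisfies v' = w, w' =
-2φw - Ev with Re φ ≤ -κ√r. This system is damped when integrated from infinity towards the origin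
(`damped_backward`). Hence the solutions that match `wkbSol` to first order at distance X form a
uniform Cauchy family as X → ∞ (`exists_wkbApprox_bounds`). Their Cauchy data at 0 converge to
functions continuous in all parameters and entire in λ (`exists_decaying_family`). The limit is, up
to a factor, the only solution that decays on the ray (`GoodRay.eq_const_mul`). The determinant D is
the Wronskian of the two limits, one for each ray; it vanishes exactly when they are proportional,
that is, at eigenvalues (`mem_eigenvalues_iff`). The logarithm of the quotient of the Sibuya
asymptotics by `wkbSol` converges uniformly (`exists_sibuya_factor`), so D is also a Wronskian of
Sibuya solutions up to a nonvanishing factor.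

It remains to see when D vanishes identically. By a Phragmén-Lindelöf argument, decay on a ray is
equivalent to decay on the bisector of its Stokes sector (`decaysOn_centre_iff`). For two different
bisectors, monotonicity of an energy flux along both of them produces a λ that is not an eigenvalue
(`exists_not_eigenvalue`). So D ≡ 0 forces the bisectors to coincide and the rays to share a Stokes
sector. For t > 0 the bisectors do not depend on t; hence D(t,a) ≡ 0 for one t > 0 gives the same
for all t in (0,1], and by continuity at t = 0. This is why a hypothesis at t = 0 alone suffices for
the continuity of the spectrum. -/

/-- Taylor coefficients at `0` of the solution of `y'' = P y` with `y 0 = y0`, `y' 0 = y1`. -/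
def solCoeff (P : ℂ[X]) (y0 y1 : ℂ) : ℕ → ℂ
  | 0 => y0
  | 1 => y1
  | k + 2 => (∑ j : Fin (k + 1), P.coeff j * solCoeff P y0 y1 (k - j)) / ((k + 1) * (k + 2))

/-- The solution of `y'' = P y` with `y 0 = y0`, `y' 0 = y1`. -/
def entireSol (P : ℂ[X]) (y0 y1 z : ℂ) : ℂ := ∑' k, solCoeff P y0 y1 k * z ^ k

/-- The derivative of `entireSol`. -/
def entireSolDeriv (P : ℂ[X]) (y0 y1 z : ℂ) : ℂ :=
  ∑' k : ℕ, (k + 1) * solCoeff P y0 y1 (k + 1) * z ^ k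

lemma sum_inv_sq_le_two (k : ℕ) : ∑ i ∈ Finset.range k, 1 / ((i : ℝ) + 1) ^ 2 ≤ 2 := by
  have h : ∀ k : ℕ, ∑ i ∈ Finset.range (k + 1), 1 / ((i : ℝ) + 1) ^ 2 ≤ 2 - 1 / ((k : ℝ) + 1) := by
    intro k
    induction k with
    | zero => norm_num
    | succ k ih =>
      rw [Finset.sum_range_succ]
      have h1 : (1 : ℝ) / ((k : ℝ) + 1 + 1) ^ 2 ≤ 1 / ((k : ℝ) + 1) - 1 / ((k : ℝ) + 1 + 1) := by
        rw [div_sub_div _ _ (by positivity) (by positivity), div_le_div_iff₀ (by positivity)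
          (by positivity)]
        have : (0 : ℝ) ≤ k := k.cast_nonneg
        nlinarith
      push_cast
      linarith
  rcases k with _ | k
  · simp
  · exact (h k).trans (by have : (0 : ℝ) ≤ 1 / ((k : ℝ) + 1) := by positivity
                          linarith)

/-- The weight exp(L·s_k), with s_k a partial sum of Σ 1/(i+1)², absorbs the recurrence: one
application costs a factor L/(k+1)² ≤ exp(L/(k+1)²), and the exponents have a bounded sum. The bound
sees P only through N and B, which is what makes the later parameter dependence uniform. -/
lemma norm_solCoeff_le {P : ℂ[X]} {N : ℕ} {B ρ : ℝ} (hN : P.natDegree ≤ N)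
    (hB : ∀ j, ‖P.coeff j‖ ≤ B) (hρ : 1 ≤ ρ) (y0 y1 : ℂ) (k : ℕ) :
    ‖solCoeff P y0 y1 k‖ * ρ ^ k ≤
      (‖y0‖ + ‖y1‖ * ρ) * Real.exp (2 * (B * (N + 1) * ρ ^ (N + 2))) := by
  set L := B * (N + 1) * ρ ^ (N + 2) with hL
  have hB0 : 0 ≤ B := (norm_nonneg _).trans (hB 0)
  have hL0 : 0 ≤ L := by positivity
  set G := ‖y0‖ + ‖y1‖ * ρ with hG
  have hG0 : 0 ≤ G := by positivity
  let s : ℕ → ℝ := fun k => ∑ i ∈ Finset.range k, 1 / ((i : ℝ) + 1) ^ 2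
  have hsmono : Monotone s := by
    intro a b hab
    exact Finset.sum_le_sum_of_subset_of_nonneg (Finset.range_mono hab)
      (fun i _ _ => by positivity)
  have hs0 : ∀ k, 0 ≤ s k := fun k => Finset.sum_nonneg (fun i _ => by positivity)
  have key : ∀ k, ‖solCoeff P y0 y1 k‖ * ρ ^ k ≤ G * Real.exp (L * s k) := by
    intro k
    induction k using Nat.strong_induction_on with
    | _ k ih =>
      match k, ih with
      | 0, _ =>
        simp only [solCoeff, pow_zero, mul_one]
        calc ‖y0‖ ≤ G := by rw [hG]; have : 0 ≤ ‖y1‖ * ρ := by positivity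
                            linarith
          _ ≤ G * Real.exp (L * s 0) :=
            le_mul_of_one_le_right hG0 (Real.one_le_exp (mul_nonneg hL0 (hs0 0)))
      | 1, _ =>
        simp only [solCoeff, pow_one]
        calc ‖y1‖ * ρ ≤ G := by rw [hG]; have : 0 ≤ ‖y0‖ := by positivity
                                linarith
          _ ≤ G * Real.exp (L * s 1) :=
            le_mul_of_one_le_right hG0 (Real.one_le_exp (mul_nonneg hL0 (hs0 1)))
      | k + 2, ih =>
        have hterm : ∀ j : Fin (k + 1), ‖P.coeff j * solCoeff P y0 y1 (k - j)‖ * ρ ^ (k + 2) ≤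
            if (j : ℕ) ≤ N then B * ρ ^ (N + 2) * (G * Real.exp (L * s k)) else 0 := by
          intro j
          split_ifs with hj
          · have h1 := ih (k - j) (by omega)
            have h2 : G * Real.exp (L * s (k - j)) ≤ G * Real.exp (L * s k) := by
              gcongr
              exact hsmono (Nat.sub_le _ _)
            have h3 : ρ ^ (k + 2) = ρ ^ ((j : ℕ) + 2) * ρ ^ (k - j) := by
              rw [← pow_add]; congr 1; omega
            have h4 : ρ ^ ((j : ℕ) + 2) ≤ ρ ^ (N + 2) := pow_le_pow_right₀ hρ (by omega)
            calc ‖P.coeff j * solCoeff P y0 y1 (k - j)‖ * ρ ^ (k + 2)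
                = (‖P.coeff j‖ * ρ ^ ((j : ℕ) + 2)) *
                  (‖solCoeff P y0 y1 (k - j)‖ * ρ ^ (k - j)) := by
                  rw [norm_mul, h3]; ring
              _ ≤ (B * ρ ^ (N + 2)) * (G * Real.exp (L * s k)) := by
                  refine mul_le_mul ?_ (h1.trans h2) (by positivity) (by positivity)
                  gcongr
                  exact hB j
          · rw [coeff_eq_zero_of_natDegree_lt (by omega)]
            simp
        -- At most N + 1 of the k + 1 summands are nonzero, so the constant does not grow with k.
        have hcard : ∑ j : Fin (k + 1),
            (if (j : ℕ) ≤ N then B * ρ ^ (N + 2) * (G * Real.exp (L * s k)) else 0) ≤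
            L * (G * Real.exp (L * s k)) := by
          rw [← Finset.sum_filter, Finset.sum_const, nsmul_eq_mul]
          have : ((Finset.univ.filter fun j : Fin (k + 1) => (j : ℕ) ≤ N).card : ℝ) ≤ N + 1 := by
            have : (Finset.univ.filter fun j : Fin (k + 1) => (j : ℕ) ≤ N).card ≤
                (Finset.range (N + 1)).card := by
              apply Finset.card_le_card_of_injOn (fun j : Fin (k + 1) => (j : ℕ))
              · intro j hj
                simp at hj ⊢
                omega
              · intro a _ b _ hab
                exact Fin.ext hab
            rw [Finset.card_range] at this
            exact_mod_cast this
          calc _ ≤ ((N : ℝ) + 1) * (B * ρ ^ (N + 2) * (G * Real.exp (L * s k))) := by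
                gcongr
            _ = _ := by rw [hL]; ring
        have hexp : L / ((k : ℝ) + 1) ^ 2 * Real.exp (L * s k) ≤ Real.exp (L * s (k + 2)) := by
          have h1 : s (k + 1) = s k + 1 / ((k : ℝ) + 1) ^ 2 := Finset.sum_range_succ _ _
          calc L / ((k : ℝ) + 1) ^ 2 * Real.exp (L * s k)
              ≤ Real.exp (L / ((k : ℝ) + 1) ^ 2) * Real.exp (L * s k) := by
                gcongr
                linarith [Real.add_one_le_exp (L / ((k : ℝ) + 1) ^ 2)]
            _ = Real.exp (L * s (k + 1)) := by
                rw [← Real.exp_add, h1]; congr 1; ring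
            _ ≤ _ := by
                gcongr
                exact hsmono (by omega)
        calc ‖solCoeff P y0 y1 (k + 2)‖ * ρ ^ (k + 2)
            = ‖∑ j : Fin (k + 1), P.coeff j * solCoeff P y0 y1 (k - j)‖ * ρ ^ (k + 2) /
              (((k : ℝ) + 1) * (k + 2)) := by
              rw [solCoeff, norm_div]
              have : ‖((k : ℂ) + 1) * (k + 2)‖ = ((k : ℝ) + 1) * (k + 2) := by
                rw [norm_mul]
                congr 1
                · exact_mod_cast Complex.norm_natCast (k + 1)
                · exact_mod_cast Complex.norm_natCast (k + 2)
              rw [this]; ring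
          _ ≤ (∑ j : Fin (k + 1), ‖P.coeff j * solCoeff P y0 y1 (k - j)‖ * ρ ^ (k + 2)) /
              (((k : ℝ) + 1) * (k + 2)) := by
              rw [← Finset.sum_mul]
              gcongr
              exact norm_sum_le _ _
          _ ≤ (L * (G * Real.exp (L * s k))) / (((k : ℝ) + 1) * (k + 2)) := by
              gcongr
              exact (Finset.sum_le_sum fun j _ => hterm j).trans hcard
          _ ≤ (L * (G * Real.exp (L * s k))) / ((k : ℝ) + 1) ^ 2 := by
              apply div_le_div_of_nonneg_left (by positivity) (by positivity)
              nlinarith [(k.cast_nonneg : (0 : ℝ) ≤ k)]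
          _ = G * (L / ((k : ℝ) + 1) ^ 2 * Real.exp (L * s k)) := by ring
          _ ≤ G * Real.exp (L * s (k + 2)) := by gcongr
  refine (key k).trans ?_
  have : L * s k ≤ 2 * L := by
    rw [mul_comm]
    exact mul_le_mul_of_nonneg_right (sum_inv_sq_le_two k) hL0
  gcongr

/-- A geometric majorant of the power series and of its derivative on a disc, uniform for
polynomials of bounded degree and coefficients. -/
lemma exists_solCoeff_bound (N : ℕ) (B ρ : ℝ) (y0 y1 : ℂ) :
    ∃ u u' : ℕ → ℝ, Summable u ∧ Summable u' ∧ ∀ P : ℂ[X], P.natDegree ≤ N →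
      (∀ j, ‖P.coeff j‖ ≤ B) → ∀ z : ℂ, ‖z‖ ≤ ρ → ∀ k,
        ‖solCoeff P y0 y1 k * z ^ k‖ ≤ u k ∧
        ‖(k + 1) * solCoeff P y0 y1 (k + 1) * z ^ k‖ ≤ u' k := by
  -- Twice the radius, so that a bound for |coefficient|·σ^k gives the ratio 1/2 on the disc of
  -- radius ρ; the maximum with 1 meets the hypothesis of `norm_solCoeff_le`.
  set σ := 2 * max ρ 1 with hσ
  have hσ1 : 1 ≤ σ := by have := le_max_right ρ 1; linarith
  set G := (‖y0‖ + ‖y1‖ * σ) * Real.exp (2 * (B * (N + 1) * σ ^ (N + 2))) with hG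
  have hG0 : 0 ≤ G := by positivity
  have hsum : Summable fun k : ℕ => G * (1 / 2 : ℝ) ^ k :=
    (summable_geometric_of_lt_one (by norm_num) (by norm_num)).mul_left G
  have hsum' : Summable fun k : ℕ => G * (((k : ℝ) + 1) * (1 / 2 : ℝ) ^ k) := by
    apply Summable.mul_left
    have h1 := summable_pow_mul_geometric_of_norm_lt_one (R := ℝ) 1 (r := 1 / 2) (by norm_num)
    have h2 := summable_geometric_of_lt_one (r := (1 / 2 : ℝ)) (by norm_num) (by norm_num)
    refine (h1.add h2).congr fun k => ?_
    ring
  refine ⟨_, _, hsum, hsum', fun P hN hB z hz k => ?_⟩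
  have hzσ : ‖z‖ ≤ σ / 2 := by have := le_max_left ρ 1; linarith
  constructor
  · have h := norm_solCoeff_le hN hB hσ1 y0 y1 k
    calc ‖solCoeff P y0 y1 k * z ^ k‖ ≤ ‖solCoeff P y0 y1 k‖ * (σ / 2) ^ k := by
          rw [norm_mul, norm_pow]; gcongr
      _ = (‖solCoeff P y0 y1 k‖ * σ ^ k) * (1 / 2) ^ k := by
          rw [div_pow, one_div, inv_pow]; ring
      _ ≤ _ := by gcongr
  · have h := norm_solCoeff_le hN hB hσ1 y0 y1 (k + 1)
    have hn : ‖(k : ℂ) + 1‖ = (k : ℝ) + 1 := by exact_mod_cast Complex.norm_natCast (k + 1)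
    calc ‖(k + 1) * solCoeff P y0 y1 (k + 1) * z ^ k‖
        ≤ (k + 1) * ‖solCoeff P y0 y1 (k + 1)‖ * (σ / 2) ^ k := by
          rw [norm_mul, norm_mul, norm_pow, hn]; gcongr
      _ = (k + 1) * (‖solCoeff P y0 y1 (k + 1)‖ * σ ^ k) * (1 / 2) ^ k := by
          rw [div_pow, one_div, inv_pow]; ring
      _ ≤ (k + 1) * (‖solCoeff P y0 y1 (k + 1)‖ * σ ^ (k + 1)) * (1 / 2) ^ k := by
          gcongr
          exact k.le_succ
      _ ≤ (k + 1) * G * (1 / 2) ^ k := by gcongr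
      _ = _ := by ring

lemma exists_coeff_bound (P : ℂ[X]) : ∃ B : ℝ, ∀ j, ‖P.coeff j‖ ≤ B := by
  refine ⟨∑ j ∈ P.support, ‖P.coeff j‖, fun j => ?_⟩
  by_cases hj : j ∈ P.support
  · exact Finset.single_le_sum (f := fun j => ‖P.coeff j‖) (fun i _ => norm_nonneg _) hj
  · rw [notMem_support_iff.mp hj, norm_zero]
    exact Finset.sum_nonneg fun i _ => norm_nonneg _

lemma hasDerivAt_entireSol (P : ℂ[X]) (y0 y1 z : ℂ) :
    HasDerivAt (entireSol P y0 y1) (entireSolDeriv P y0 y1 z) z := by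
  obtain ⟨B, hB⟩ := exists_coeff_bound P
  obtain ⟨u, _, hu, _, h⟩ := exists_solCoeff_bound P.natDegree B (‖z‖ + 1) y0 y1
  have hF : ∀ k : ℕ, DifferentiableOn ℂ (fun w : ℂ => solCoeff P y0 y1 k * w ^ k)
      (Metric.ball 0 (‖z‖ + 1)) := fun k => by fun_prop
  have hb : ∀ k : ℕ, ∀ w ∈ Metric.ball (0 : ℂ) (‖z‖ + 1),
      ‖(fun w : ℂ => solCoeff P y0 y1 k * w ^ k) w‖ ≤ u k := fun k w hw =>
    (h P le_rfl hB w (by simpa using (mem_ball_zero_iff.mp hw).le) k).1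
  have hz : z ∈ Metric.ball (0 : ℂ) (‖z‖ + 1) := by simp
  have hd := (Complex.differentiableOn_tsum_of_summable_norm hu hF Metric.isOpen_ball
    hb).differentiableAt (Metric.isOpen_ball.mem_nhds hz)
  have hs := Complex.hasSum_deriv_of_summable_norm hu hF Metric.isOpen_ball hb hz
  have e : deriv (fun w => ∑' k, solCoeff P y0 y1 k * w ^ k) z = entireSolDeriv P y0 y1 z := by
    rw [← hs.tsum_eq, hs.summable.tsum_eq_zero_add]
    simp [entireSolDeriv]
    refine tsum_congr fun k => ?_
    ring
  rw [← e]
  exact hd.hasDerivAt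

lemma hasSum_entireSol (P : ℂ[X]) (y0 y1 z : ℂ) :
    HasSum (fun k => solCoeff P y0 y1 k * z ^ k) (entireSol P y0 y1 z) ∧
      Summable (fun k => ‖solCoeff P y0 y1 k * z ^ k‖) := by
  obtain ⟨B, hB⟩ := exists_coeff_bound P
  obtain ⟨u, _, hu, _, h⟩ := exists_solCoeff_bound P.natDegree B ‖z‖ y0 y1
  have : Summable (fun k => ‖solCoeff P y0 y1 k * z ^ k‖) :=
    Summable.of_nonneg_of_le (fun _ => norm_nonneg _) (fun k => (h P le_rfl hB z le_rfl k).1) hu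
  exact ⟨this.of_norm.hasSum, this⟩

/-- Termwise differentiation; the Cauchy product of P with the series is exactly the numerator in
the recurrence for the coefficients. -/
lemma hasDerivAt_entireSolDeriv (P : ℂ[X]) (y0 y1 z : ℂ) :
    HasDerivAt (entireSolDeriv P y0 y1) (P.eval z * entireSol P y0 y1 z) z := by
  obtain ⟨B, hB⟩ := exists_coeff_bound P
  obtain ⟨_, u, _, hu, h⟩ := exists_solCoeff_bound P.natDegree B (‖z‖ + 1) y0 y1
  have hF : ∀ k : ℕ, DifferentiableOn ℂ
      (fun w : ℂ => ((k : ℂ) + 1) * solCoeff P y0 y1 (k + 1) * w ^ k)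
      (Metric.ball 0 (‖z‖ + 1)) := fun k => by fun_prop
  have hb : ∀ k : ℕ, ∀ w ∈ Metric.ball (0 : ℂ) (‖z‖ + 1),
      ‖(fun w : ℂ => ((k : ℂ) + 1) * solCoeff P y0 y1 (k + 1) * w ^ k) w‖ ≤ u k := fun k w hw =>
    (h P le_rfl hB w (by simpa using (mem_ball_zero_iff.mp hw).le) k).2
  have hz : z ∈ Metric.ball (0 : ℂ) (‖z‖ + 1) := by simp
  have hd := (Complex.differentiableOn_tsum_of_summable_norm hu hF Metric.isOpen_ball
    hb).differentiableAt (Metric.isOpen_ball.mem_nhds hz)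
  have hs := Complex.hasSum_deriv_of_summable_norm hu hF Metric.isOpen_ball hb hz
  have e : deriv (fun w => ∑' k : ℕ, ((k : ℂ) + 1) * solCoeff P y0 y1 (k + 1) * w ^ k) z =
      P.eval z * entireSol P y0 y1 z := by
    have hP : Summable fun j => ‖P.coeff j * z ^ j‖ := by
      apply summable_of_ne_finset_zero (s := Finset.range (P.natDegree + 1))
      intro j hj
      rw [coeff_eq_zero_of_natDegree_lt (by simpa using hj)]
      simp
    have hPe : P.eval z = ∑' j, P.coeff j * z ^ j := by
      rw [eval_eq_sum_range, tsum_eq_sum (s := Finset.range (P.natDegree + 1))]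
      intro j hj
      rw [coeff_eq_zero_of_natDegree_lt (by simpa using hj)]
      simp
    rw [hPe, entireSol, tsum_mul_tsum_eq_tsum_sum_range_of_summable_norm hP
      (hasSum_entireSol P y0 y1 z).2, ← hs.tsum_eq, hs.summable.tsum_eq_zero_add]
    simp only [deriv_const_mul_field', deriv_pow_field, Nat.cast_zero, zero_mul, mul_zero, zero_add]
    refine tsum_congr fun k => ?_
    rw [solCoeff, Finset.sum_range]
    have h1 : ((k : ℂ) + 1) ≠ 0 := by exact_mod_cast k.succ_ne_zero
    have h2 : ((k : ℂ) + 2) ≠ 0 := by exact_mod_cast (k + 1).succ_ne_zero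
    have h3 : ∑ x : Fin (k + 1), P.coeff x * z ^ (x : ℕ) * (solCoeff P y0 y1 (k - x) * z ^ (k - x))
        = (∑ j : Fin (k + 1), P.coeff j * solCoeff P y0 y1 (k - j)) * z ^ k := by
      rw [Finset.sum_mul]
      refine Finset.sum_congr rfl fun x _ => ?_
      have : z ^ k = z ^ (x : ℕ) * z ^ (k - x) := by
        rw [← pow_add]; congr 1; omega
      rw [this]; ring
    rw [h3]
    push_cast
    field_simp
    ring
  rw [← e]
  exact hd.hasDerivAt

lemma entireSol_zero (P : ℂ[X]) (y0 y1 : ℂ) : entireSol P y0 y1 0 = y0 := by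
  rw [entireSol, tsum_eq_single 0]
  · simp [solCoeff]
  · intro k hk; simp [hk]

lemma entireSolDeriv_zero (P : ℂ[X]) (y0 y1 : ℂ) : entireSolDeriv P y0 y1 0 = y1 := by
  rw [entireSolDeriv, tsum_eq_single 0]
  · simp [solCoeff]
  · intro k hk; simp [hk]

lemma deriv_entireSol (P : ℂ[X]) (y0 y1 : ℂ) :
    deriv (entireSol P y0 y1) = entireSolDeriv P y0 y1 :=
  funext fun z => (hasDerivAt_entireSol P y0 y1 z).deriv

/-! ### Dependence of solutions on parameters -/

lemma continuousOn_solCoeff {Y : Type*} [TopologicalSpace Y] {s : Set Y} {P : Y → ℂ[X]}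
    (hP : ∀ j, ContinuousOn (fun x => (P x).coeff j) s) (y0 y1 : ℂ) (k : ℕ) :
    ContinuousOn (fun x => solCoeff (P x) y0 y1 k) s := by
  induction k using Nat.strong_induction_on with
  | _ k ih =>
    match k, ih with
    | 0, _ => simp only [solCoeff]; exact continuousOn_const
    | 1, _ => simp only [solCoeff]; exact continuousOn_const
    | k + 2, ih =>
      simp only [solCoeff]
      refine ContinuousOn.div_const (continuousOn_finsetSum _ fun j _ => ?_) _
      exact (hP j).mul (ih _ (by omega))

lemma differentiableOn_solCoeff {s : Set ℂ} {P : ℂ → ℂ[X]}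
    (hP : ∀ j, DifferentiableOn ℂ (fun x => (P x).coeff j) s) (y0 y1 : ℂ) (k : ℕ) :
    DifferentiableOn ℂ (fun x => solCoeff (P x) y0 y1 k) s := by
  induction k using Nat.strong_induction_on with
  | _ k ih =>
    match k, ih with
    | 0, _ => simp only [solCoeff]; exact differentiableOn_const _
    | 1, _ => simp only [solCoeff]; exact differentiableOn_const _
    | k + 2, ih =>
      simp only [solCoeff]
      refine DifferentiableOn.div_const (DifferentiableOn.fun_sum fun j _ => ?_) _
      exact (hP j).mul (ih _ (by omega))

/-- The majorant of `exists_solCoeff_bound` serves all parameters at once, so the series converge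
uniformly and inherit continuity from their terms. -/
lemma continuousOn_entireSol {Y : Type*} [TopologicalSpace Y] {s : Set Y} {P : Y → ℂ[X]}
    (hP : ∀ j, ContinuousOn (fun x => (P x).coeff j) s) {N : ℕ} {B : ℝ}
    (hN : ∀ x ∈ s, (P x).natDegree ≤ N) (hB : ∀ x ∈ s, ∀ j, ‖(P x).coeff j‖ ≤ B) (y0 y1 z : ℂ) :
    ContinuousOn (fun x => entireSol (P x) y0 y1 z) s ∧
      ContinuousOn (fun x => entireSolDeriv (P x) y0 y1 z) s := by
  obtain ⟨u, u', hu, hu', h⟩ := exists_solCoeff_bound N B ‖z‖ y0 y1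
  constructor
  · exact continuousOn_tsum (fun k => (continuousOn_solCoeff hP y0 y1 k).mul continuousOn_const)
      hu (fun k x hx => (h _ (hN x hx) (hB x hx) z le_rfl k).1)
  · exact continuousOn_tsum (fun k => ((continuousOn_const (c := (k : ℂ) + 1)).mul
      (continuousOn_solCoeff hP y0 y1 (k + 1))).mul continuousOn_const)
      hu' (fun k x hx => (h _ (hN x hx) (hB x hx) z le_rfl k).2)

lemma differentiableOn_entireSol {s : Set ℂ} (hs : IsOpen s) {P : ℂ → ℂ[X]}
    (hP : ∀ j, DifferentiableOn ℂ (fun x => (P x).coeff j) s) {N : ℕ} {B : ℝ}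
    (hN : ∀ x ∈ s, (P x).natDegree ≤ N) (hB : ∀ x ∈ s, ∀ j, ‖(P x).coeff j‖ ≤ B) (y0 y1 z : ℂ) :
    DifferentiableOn ℂ (fun x => entireSol (P x) y0 y1 z) s ∧
      DifferentiableOn ℂ (fun x => entireSolDeriv (P x) y0 y1 z) s := by
  obtain ⟨u, u', hu, hu', h⟩ := exists_solCoeff_bound N B ‖z‖ y0 y1
  constructor
  · exact Complex.differentiableOn_tsum_of_summable_norm hu
      (fun k => (differentiableOn_solCoeff hP y0 y1 k).mul (differentiableOn_const _)) hs
      (fun k x hx => (h _ (hN x hx) (hB x hx) z le_rfl k).1)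
  · exact Complex.differentiableOn_tsum_of_summable_norm hu'
      (fun k => ((differentiableOn_const (c := (k : ℂ) + 1)).mul
        (differentiableOn_solCoeff hP y0 y1 (k + 1))).mul (differentiableOn_const _)) hs
      (fun k x hx => (h _ (hN x hx) (hB x hx) z le_rfl k).2)

/-! ### Rays -/

lemma norm_dir (θ : ℝ) : ‖dir θ‖ = 1 := Complex.norm_exp_ofReal_mul_I θ

lemma dir_ne_zero (θ : ℝ) : dir θ ≠ 0 := Complex.exp_ne_zero _

lemma norm_ray {θ r : ℝ} (hr : 0 ≤ r) : ‖ray θ r‖ = r := by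
  rw [ray, norm_mul, norm_dir, mul_one, Complex.norm_of_nonneg hr]

lemma ray_arg_norm (z : ℂ) : ray z.arg ‖z‖ = z := Complex.norm_mul_exp_arg_mul_I z

lemma hasDerivAt_ray (θ r : ℝ) : HasDerivAt (ray θ) (dir θ) r := by
  exact ((Complex.ofRealCLM.hasDerivAt (x := r)).mul_const (dir θ)).congr_deriv (by simp)

lemma continuous_ray (θ : ℝ) : Continuous (ray θ) := by
  unfold ray; fun_prop

/-- The potential along a ray, in the real variable `r`. -/
def rayPot (Q : ℂ[X]) (θ r : ℝ) : ℂ := dir θ ^ 2 * Q.eval (ray θ r)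

/-! ### Basic properties of solutions -/

lemma IsSolution.hasDerivAt {P : ℂ[X]} {lam : ℂ} {y : ℂ → ℂ} (h : IsSolution P lam y) (z : ℂ) :
    HasDerivAt y (deriv y z) z := (h.1 z).hasDerivAt

lemma IsSolution.hasDerivAt_deriv {P : ℂ[X]} {lam : ℂ} {y : ℂ → ℂ} (h : IsSolution P lam y)
    (z : ℂ) : HasDerivAt (deriv y) ((P.eval z - lam) * y z) z := by
  have h1 : DifferentiableAt ℂ (deriv y) z :=
    (h.1.differentiableOn.deriv isOpen_univ).differentiableAt univ_mem
  have h2 := h.2 z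
  have h3 : (P.eval z - lam) * y z = deriv (deriv y) z := by
    rw [iteratedDeriv_succ, iteratedDeriv_one] at h2
    linear_combination h2
  rw [h3]
  exact h1.hasDerivAt

lemma isSolution_of_hasDerivAt {P : ℂ[X]} {lam : ℂ} {y y' : ℂ → ℂ}
    (h : ∀ z, HasDerivAt y (y' z) z) (h' : ∀ z, HasDerivAt y' ((P.eval z - lam) * y z) z) :
    IsSolution P lam y := by
  have e : deriv y = y' := funext fun z => (h z).deriv
  refine ⟨fun z => (h z).differentiableAt, fun z => ?_⟩
  rw [iteratedDeriv_succ, iteratedDeriv_one, e, (h' z).deriv]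
  ring

lemma isSolution_entireSol (P : ℂ[X]) (lam y0 y1 : ℂ) :
    IsSolution P lam (entireSol (P - C lam) y0 y1) :=
  isSolution_of_hasDerivAt (hasDerivAt_entireSol _ y0 y1) fun z => by
    simpa using hasDerivAt_entireSolDeriv (P - C lam) y0 y1 z

lemma isSolution_sub_C {P : ℂ[X]} {lam : ℂ} {y : ℂ → ℂ} :
    IsSolution (P - C lam) 0 y ↔ IsSolution P lam y := by
  simp only [IsSolution, eval_sub, eval_C]
  refine and_congr_right fun _ => forall_congr' fun z => ?_
  constructor <;> intro h <;> linear_combination h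

lemma IsSolution.combine {P : ℂ[X]} {lam : ℂ} {y₁ y₂ : ℂ → ℂ} (h₁ : IsSolution P lam y₁)
    (h₂ : IsSolution P lam y₂) (a b : ℂ) : IsSolution P lam (fun z => a * y₁ z + b * y₂ z) :=
  isSolution_of_hasDerivAt (y' := fun z => a * deriv y₁ z + b * deriv y₂ z)
    (fun z => ((h₁.hasDerivAt z).const_mul a).add ((h₂.hasDerivAt z).const_mul b))
    (fun z => (((h₁.hasDerivAt_deriv z).const_mul a).add
      ((h₂.hasDerivAt_deriv z).const_mul b)).congr_deriv (by ring))

lemma IsSolution.const_mul {P : ℂ[X]} {lam : ℂ} {y : ℂ → ℂ} (h : IsSolution P lam y) (a : ℂ) :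
    IsSolution P lam (fun z => a * y z) := by
  simpa using h.combine h a 0

lemma IsSolution.hasDerivAt_ray {P : ℂ[X]} {lam : ℂ} {y : ℂ → ℂ} (h : IsSolution P lam y)
    (θ r : ℝ) : HasDerivAt (fun r => y (ray θ r)) (dir θ * deriv y (ray θ r)) r := by
  have := (h.hasDerivAt (ray θ r)).comp_of_eq r (SchroedingerRays.hasDerivAt_ray θ r) rfl
  rw [mul_comm]
  exact this

lemma IsSolution.hasDerivAt_deriv_ray {P : ℂ[X]} {lam : ℂ} {y : ℂ → ℂ} (h : IsSolution P lam y)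
    (θ r : ℝ) : HasDerivAt (fun r => dir θ * deriv y (ray θ r))
      ((rayPot P θ r - lam * dir θ ^ 2) * y (ray θ r)) r := by
  have := ((h.hasDerivAt_deriv (ray θ r)).comp_of_eq r
    (SchroedingerRays.hasDerivAt_ray θ r) rfl).const_mul (dir θ)
  exact this.congr_deriv (by rw [rayPot]; ring)

/-- The Wronskian of two solutions is constant. -/
lemma wronskian_const {P : ℂ[X]} {lam : ℂ} {y₁ y₂ : ℂ → ℂ} (h₁ : IsSolution P lam y₁)
    (h₂ : IsSolution P lam y₂) (z w : ℂ) :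
    deriv y₁ z * y₂ z - y₁ z * deriv y₂ z = deriv y₁ w * y₂ w - y₁ w * deriv y₂ w := by
  have hd : ∀ z, HasDerivAt (fun z => deriv y₁ z * y₂ z - y₁ z * deriv y₂ z) 0 z := fun z => 
    (((h₁.hasDerivAt_deriv z).mul (h₂.hasDerivAt z)).sub
      ((h₁.hasDerivAt z).mul (h₂.hasDerivAt_deriv z))).congr_deriv (by ring)
  exact is_const_of_deriv_eq_zero (fun z => (hd z).differentiableAt) (fun z => (hd z).deriv) z w

/-! ### Growth and uniqueness of solutions -/

lemma exists_eval_bound (P : ℂ[X]) (lam : ℂ) {n : ℕ} (hn : P.natDegree ≤ n) :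
    ∃ B : ℝ, 0 ≤ B ∧ ∀ z, ‖P.eval z - lam‖ ≤ B * (1 + ‖z‖) ^ n := by
  refine ⟨∑ j ∈ Finset.range (n + 1), ‖P.coeff j‖ + ‖lam‖, by positivity, fun z => ?_⟩
  have h1 : 1 ≤ 1 + ‖z‖ := by linarith [norm_nonneg z]
  rw [eval_eq_sum_range' (Nat.lt_succ_of_le hn), add_mul, Finset.sum_mul]
  refine (norm_sub_le _ _).trans (add_le_add ((norm_sum_le _ _).trans ?_) ?_)
  · refine Finset.sum_le_sum fun j hj => ?_
    rw [norm_mul, norm_pow]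
    gcongr
    calc ‖z‖ ^ j ≤ (1 + ‖z‖) ^ j := by gcongr; linarith
      _ ≤ (1 + ‖z‖) ^ n := pow_le_pow_right₀ h1 (by simp at hj; omega)
  · exact le_mul_of_one_le_right (norm_nonneg _) (one_le_pow₀ h1)

lemma hasDerivAt_norm_sq {u : ℝ → ℂ} {u' : ℂ} {r : ℝ} (h : HasDerivAt u u' r) :
    HasDerivAt (fun r => ‖u r‖ ^ 2) (2 * (u' * (starRingEnd ℂ) (u r)).re) r := by
  have h1 := h.norm_sq
  have e : inner ℝ (u r) u' = (u' * (starRingEnd ℂ) (u r)).re := Complex.inner _ _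
  rwa [e] at h1

/-- An energy estimate. The weight (1 + r)^n in N = |u'|² + (1 + r)^n |u|² balances the growth of
the potential, so that N' ≤ G'N with G a multiple of (1 + r)^(n/2 + 1), and N·exp(-G) decreases
along every ray from the origin. -/
lemma norm_sq_solution_le {P : ℂ[X]} {lam : ℂ} {n : ℕ} {B : ℝ} (hB0 : 0 ≤ B)
    (hB : ∀ z, ‖P.eval z - lam‖ ≤ B * (1 + ‖z‖) ^ n) {y : ℂ → ℂ} (h : IsSolution P lam y) (z : ℂ) :
    ‖y z‖ ^ 2 ≤ (‖y 0‖ ^ 2 + ‖deriv y 0‖ ^ 2) *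
      Real.exp ((B + n + 1) * (1 + ‖z‖) ^ ((n : ℝ) / 2 + 1)) := by
  obtain ⟨θ, r, hr, rfl⟩ : ∃ θ r : ℝ, 0 ≤ r ∧ ray θ r = z :=
    ⟨z.arg, ‖z‖, norm_nonneg _, ray_arg_norm z⟩
  rw [norm_ray hr]
  set u := fun r => y (ray θ r) with hu
  set v := fun r => dir θ * deriv y (ray θ r) with hv
  set A : ℝ := B + n + 1
  set ρ : ℝ := (n : ℝ) / 2 + 1 with hρ
  have hρ1 : 1 ≤ ρ := by rw [hρ]; have : (0 : ℝ) ≤ n / 2 := by positivity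
                         linarith
  have hA : 0 ≤ A := by positivity
  set N := fun r : ℝ => ‖v r‖ ^ 2 + (1 + r) ^ n * ‖u r‖ ^ 2 with hN
  set G := fun r : ℝ => A * (1 + r) ^ ρ with hG
  have hdN : ∀ r, HasDerivAt N (2 * (((rayPot P θ r - lam * dir θ ^ 2) * u r) *
      (starRingEnd ℂ) (v r)).re + ((n * (1 + r) ^ (n - 1)) * ‖u r‖ ^ 2 +
        (1 + r) ^ n * (2 * (v r * (starRingEnd ℂ) (u r)).re))) r := by
    intro r
    have h1 : HasDerivAt (fun r : ℝ => (1 + r) ^ n) (n * (1 + r) ^ (n - 1)) r := by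
      exact (((hasDerivAt_id r).const_add 1).fun_pow n).congr_deriv (by simp)
    exact (hasDerivAt_norm_sq (h.hasDerivAt_deriv_ray θ r)).add
      (h1.mul (hasDerivAt_norm_sq (h.hasDerivAt_ray θ r)))
  have hdG : ∀ r, 0 ≤ r → HasDerivAt G (A * (ρ * (1 + r) ^ (ρ - 1))) r := by
    intro r hr
    have := ((hasDerivAt_id r).const_add 1).rpow_const (p := ρ) (Or.inl (by simp; linarith))
    simpa [mul_assoc] using this.const_mul A
  have hanti : AntitoneOn (fun r => N r * Real.exp (-G r)) (Set.Ici 0) := by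
    have hd : ∀ r, 0 ≤ r → HasDerivAt (fun r => N r * Real.exp (-G r)) _ r := fun r hr =>
      (hdN r).mul (hdG r hr).fun_neg.exp
    refine antitoneOn_of_deriv_nonpos (convex_Ici 0)
      (fun r hr => (hd r hr).continuousAt.continuousWithinAt)
      (fun r hr => (hd r (interior_subset hr)).differentiableAt.differentiableWithinAt) ?_
    intro r hr
    have hr0 : 0 ≤ r := interior_subset hr
    rw [(hd r hr0).deriv]
    -- Here s = (1 + r)^(n/2); naming it removes all real powers from the differential inequality.
    have hs : ∃ s : ℝ, 1 ≤ s ∧ (1 + r) ^ (ρ - 1) = s ∧ (1 + r) ^ n = s ^ 2 := by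
      refine ⟨(1 + r) ^ (ρ - 1), Real.one_le_rpow (by linarith) (by linarith), rfl, ?_⟩
      rw [← Real.rpow_natCast, ← Real.rpow_natCast, ← Real.rpow_mul (by linarith)]
      congr 1
      rw [hρ]; push_cast; ring
    obtain ⟨s, hs1, hs2, hs3⟩ := hs
    have hn1 : (n : ℝ) * (1 + r) ^ (n - 1) ≤ n * s ^ 2 := by
      rw [← hs3]
      gcongr
      · linarith
      · omega
    have hW : ‖rayPot P θ r - lam * dir θ ^ 2‖ ≤ B * s ^ 2 := by
      have := hB (ray θ r)
      rw [norm_ray hr0, hs3] at this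
      have e : rayPot P θ r - lam * dir θ ^ 2 = dir θ ^ 2 * (P.eval (ray θ r) - lam) := by
        rw [rayPot]; ring
      rw [e, norm_mul, norm_pow, norm_dir]
      simpa using this
    have e1 : (((rayPot P θ r - lam * dir θ ^ 2) * u r) * (starRingEnd ℂ) (v r)).re ≤
        B * s ^ 2 * ‖u r‖ * ‖v r‖ := by
      refine (Complex.re_le_norm _).trans ?_
      rw [norm_mul, norm_mul, RCLike.norm_conj]
      gcongr
    have e2 : (v r * (starRingEnd ℂ) (u r)).re ≤ ‖v r‖ * ‖u r‖ := by
      refine (Complex.re_le_norm _).trans ?_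
      rw [norm_mul, RCLike.norm_conj]
    rw [hs2, hs3]
    simp only [hN, hs3]
    have hmain : 2 * (((rayPot P θ r - lam * dir θ ^ 2) * u r) * (starRingEnd ℂ) (v r)).re +
        (n * (1 + r) ^ (n - 1) * ‖u r‖ ^ 2 + s ^ 2 * (2 * (v r * (starRingEnd ℂ) (u r)).re)) ≤
        (‖v r‖ ^ 2 + s ^ 2 * ‖u r‖ ^ 2) * (A * (ρ * s)) := by
      have a1 : 2 * (s * ‖u r‖) * ‖v r‖ ≤ ‖v r‖ ^ 2 + s ^ 2 * ‖u r‖ ^ 2 := by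
        nlinarith [sq_nonneg (s * ‖u r‖ - ‖v r‖)]
      have a2 : n * (1 + r) ^ (n - 1) * ‖u r‖ ^ 2 ≤
          n * s * (‖v r‖ ^ 2 + s ^ 2 * ‖u r‖ ^ 2) := by
        calc n * (1 + r) ^ (n - 1) * ‖u r‖ ^ 2 ≤ n * s ^ 2 * ‖u r‖ ^ 2 := by gcongr
          _ = n * 1 * (s ^ 2 * ‖u r‖ ^ 2) := by ring
          _ ≤ n * s * (‖v r‖ ^ 2 + s ^ 2 * ‖u r‖ ^ 2) := by
            gcongr
            linarith [sq_nonneg ‖v r‖]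
      have a3 : (B + 1) * s * (2 * (s * ‖u r‖) * ‖v r‖) ≤
          (B + 1) * s * (‖v r‖ ^ 2 + s ^ 2 * ‖u r‖ ^ 2) := by gcongr
      have a4 : (‖v r‖ ^ 2 + s ^ 2 * ‖u r‖ ^ 2) * (A * (1 * s)) ≤
          (‖v r‖ ^ 2 + s ^ 2 * ‖u r‖ ^ 2) * (A * (ρ * s)) := by gcongr
      have a5 : s ^ 2 * (v r * (starRingEnd ℂ) (u r)).re ≤ s ^ 2 * (‖v r‖ * ‖u r‖) := by gcongr
      have a6 : A = B + n + 1 := rfl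
      rw [a6] at a4 ⊢
      linarith
    have hexp := Real.exp_pos (-G r)
    nlinarith
  have hfin := hanti (Set.mem_Ici.mpr le_rfl) (Set.mem_Ici.mpr hr) hr
  simp only at hfin
  have hray0 : ray θ 0 = 0 := by simp [ray]
  have hN0 : N 0 = ‖y 0‖ ^ 2 + ‖deriv y 0‖ ^ 2 := by
    simp only [hN, hu, hv, hray0, norm_mul, norm_dir]; ring
  have hG0 : 0 ≤ G 0 := by simp only [hG]; positivity
  have h1 : N r ≤ N 0 * Real.exp (G r) := by
    have e0 : Real.exp (-G 0) ≤ 1 := Real.exp_le_one_iff.mpr (by linarith)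
    have : N r = N r * Real.exp (-G r) * Real.exp (G r) := by
      rw [mul_assoc, ← Real.exp_add]; simp
    rw [this]
    gcongr
    refine hfin.trans (mul_le_of_le_one_right ?_ e0)
    rw [hN0]; positivity
  rw [← hN0]
  refine le_trans ?_ h1
  have : 1 * ‖u r‖ ^ 2 ≤ (1 + r) ^ n * ‖u r‖ ^ 2 := by
    gcongr
    exact one_le_pow₀ (by linarith)
  simp only [hN]
  nlinarith [sq_nonneg ‖v r‖]

/-- The growth bound is proportional to the initial energy, so it also serves as the uniqueness
theorem. -/
lemma IsSolution.eq_zero {P : ℂ[X]} {lam : ℂ} {y : ℂ → ℂ} (h : IsSolution P lam y)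
    (h0 : y 0 = 0) (h1 : deriv y 0 = 0) : y = 0 := by
  obtain ⟨B, hB0, hB⟩ := exists_eval_bound P lam le_rfl
  funext z
  have := norm_sq_solution_le hB0 hB h z
  rw [h0, h1] at this
  simp only [norm_zero, ne_eq, OfNat.ofNat_ne_zero, not_false_eq_true, zero_pow, add_zero,
    zero_mul] at this
  have : ‖y z‖ = 0 := by nlinarith [norm_nonneg (y z)]
  simpa using this

/-- Two solutions with vanishing Wronskian are proportional. -/
lemma exists_eq_const_mul_of_wronskian {P : ℂ[X]} {lam : ℂ} {y₁ y₂ : ℂ → ℂ}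
    (h₁ : IsSolution P lam y₁) (h₂ : IsSolution P lam y₂) (hne : y₁ ≠ 0)
    (hw : deriv y₁ 0 * y₂ 0 - y₁ 0 * deriv y₂ 0 = 0) : ∃ k : ℂ, y₂ = fun z => k * y₁ z := by
  have key : ∀ k : ℂ, y₂ 0 = k * y₁ 0 → deriv y₂ 0 = k * deriv y₁ 0 →
      y₂ = fun z => k * y₁ z := by
    intro k hk hk'
    have := (h₂.combine h₁ 1 (-k)).eq_zero (by linear_combination hk) (by
      rw [(((h₂.hasDerivAt 0).const_mul 1).fun_add ((h₁.hasDerivAt 0).const_mul (-k))).deriv]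
      linear_combination hk')
    funext z
    have := congrFun this z
    simp only [Pi.zero_apply] at this
    linear_combination this
  by_cases h0 : y₁ 0 = 0
  · have h0' : deriv y₁ 0 ≠ 0 := fun h => hne (h₁.eq_zero h0 h)
    refine ⟨deriv y₂ 0 / deriv y₁ 0, key _ ?_ (by field_simp)⟩
    have : deriv y₁ 0 * y₂ 0 = 0 := by rw [h0] at hw; linear_combination hw
    rw [h0, mul_zero]
    exact (mul_eq_zero.mp this).resolve_left h0'
  · refine ⟨y₂ 0 / y₁ 0, key _ (by field_simp) ?_⟩
    field_simp
    linear_combination -hw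

/-! ### A bound for the derivative -/

/-- Subtracting the linear function of slope u'(r) from u leaves a function whose derivative is at
most A on an interval of length 1. This recovers bounds for y' from bounds for y alone. -/
lemma norm_deriv_le_of_second_deriv {u u₁ u₂ : ℝ → ℂ} {r A : ℝ}
    (hu : ∀ s ∈ Set.Icc r (r + 1), HasDerivAt u (u₁ s) s)
    (hu₁ : ∀ s ∈ Set.Icc r (r + 1), HasDerivAt u₁ (u₂ s) s)
    (hA : ∀ s ∈ Set.Icc r (r + 1), ‖u₂ s‖ ≤ A) : ‖u₁ r‖ ≤ ‖u (r + 1)‖ + ‖u r‖ + A := by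
  have hr : r ∈ Set.Icc r (r + 1) := ⟨le_rfl, by linarith⟩
  have hr1 : r + 1 ∈ Set.Icc r (r + 1) := ⟨by linarith, le_rfl⟩
  have hA0 : 0 ≤ A := (norm_nonneg _).trans (hA r hr)
  have h1 : ∀ s ∈ Set.Icc r (r + 1), ‖u₁ s - u₁ r‖ ≤ A := by
    intro s hs
    have := (convex_Icc r (r + 1)).norm_image_sub_le_of_norm_hasDerivWithin_le
      (fun s hs => (hu₁ s hs).hasDerivWithinAt) hA hr hs
    refine this.trans (mul_le_of_le_one_right hA0 ?_)
    rw [Real.norm_eq_abs, abs_of_nonneg (by linarith [hs.1])]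
    linarith [hs.2]
  have h2 : ∀ s ∈ Set.Icc r (r + 1),
      HasDerivAt (fun s : ℝ => u s - (s : ℂ) * u₁ r) (u₁ s - 1 * u₁ r) s := fun s hs =>
    (hu s hs).sub ((Complex.ofRealCLM.hasDerivAt (x := s)).mul_const (u₁ r))
  have h3 := (convex_Icc r (r + 1)).norm_image_sub_le_of_norm_hasDerivWithin_le
    (fun s hs => (h2 s hs).hasDerivWithinAt) (fun s hs => by simpa using h1 s hs) hr hr1
  have h4 : u₁ r = u (r + 1) - u r - ((u (r + 1) - ((r + 1 : ℝ) : ℂ) * u₁ r) - (u r - r * u₁ r)) := by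
    push_cast; ring
  have h5 : ‖(u (r + 1) - ((r + 1 : ℝ) : ℂ) * u₁ r) - (u r - r * u₁ r)‖ ≤ A := by
    refine h3.trans_eq ?_
    simp
  calc ‖u₁ r‖ = ‖u (r + 1) - u r -
        ((u (r + 1) - ((r + 1 : ℝ) : ℂ) * u₁ r) - (u r - r * u₁ r))‖ := congrArg norm h4
    _ ≤ ‖u (r + 1) - u r‖ + ‖(u (r + 1) - ((r + 1 : ℝ) : ℂ) * u₁ r) - (u r - r * u₁ r)‖ :=
      norm_sub_le _ _
    _ ≤ _ := add_le_add (norm_sub_le _ _) h5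

/-! ### A damped linear system, integrated from infinity -/

/-- A barrier argument for F = t^{2s}|w|². Wherever t^s|w| exceeds B, the damping term 2κ√t|w| beats
the forcing CV/t, because t^s ≤ t√t; this is the reason for s ≤ 3/2. There F increases with t, so
moving back from X it cannot climb above B². -/
lemma damped_barrier {v w φ E : ℝ → ℂ} {T X κ C V B s : ℝ} (hT : 1 ≤ T) (hκ : 0 < κ)
    (hs0 : 0 < s) (hs : s ≤ 3 / 2)
    (hw : ∀ x ∈ Set.Icc T X, HasDerivAt w (-2 * φ x * w x - E x * v x) x)
    (hφ : ∀ x ∈ Set.Icc T X, (φ x).re ≤ -(κ * √x))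
    (hE : ∀ x ∈ Set.Icc T X, ‖E x‖ ≤ C / x) (hV : ∀ x ∈ Set.Icc T X, ‖v x‖ ≤ V)
    (hBX : X ^ s * ‖w X‖ ≤ B) (hBV : C * V / (2 * κ) ≤ B) {x : ℝ} (hx : x ∈ Set.Icc T X) :
    x ^ s * ‖w x‖ ≤ B := by
  by_contra! hcon
  have hX : X ∈ Set.Icc T X := ⟨hx.1.trans hx.2, le_rfl⟩
  have hX0 : 0 < X := by linarith [hX.1]
  have hCV : 0 ≤ C * V := by
    have h1 := (norm_nonneg _).trans (hE X hX)
    have h2 := (norm_nonneg _).trans (hV X hX)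
    exact mul_nonneg (by have := mul_nonneg h1 hX0.le; rwa [div_mul_cancel₀ _ hX0.ne'] at this) h2
  have hB0 : 0 ≤ B := le_trans (by positivity) hBV
  let F : ℝ → ℝ := fun t => t ^ (2 * s) * ‖w t‖ ^ 2
  have hFsq : ∀ t, 0 ≤ t → F t = (t ^ s * ‖w t‖) ^ 2 := by
    intro t ht
    simp only [F]
    rw [mul_pow, mul_comm 2 s, Real.rpow_mul ht]
    norm_cast
  let F' : ℝ → ℝ := fun t => 2 * s * t ^ (2 * s - 1) * ‖w t‖ ^ 2 +
    t ^ (2 * s) * (2 * ((-2 * φ t * w t - E t * v t) * (starRingEnd ℂ) (w t)).re)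
  have hdF : ∀ t ∈ Set.Icc T X, HasDerivAt F (F' t) t := by
    intro t ht
    have h1 : HasDerivAt (fun t : ℝ => t ^ (2 * s)) (2 * s * t ^ (2 * s - 1)) t :=
      Real.hasDerivAt_rpow_const (Or.inl (by linarith [ht.1]))
    exact h1.mul (hasDerivAt_norm_sq (hw t ht))
  have hsub : ∀ t ∈ Set.Icc x X, t ∈ Set.Icc T X := fun t ht => ⟨hx.1.trans ht.1, ht.2⟩
  -- With a constant fence, positivity of F' is needed only where F takes the value F x, and there
  -- t^s|w t| = x^s|w x| > B by assumption.
  have key := image_le_of_deriv_right_lt_deriv_boundary' (f := fun t => -F t)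
    (f' := fun t => -F' t) (a := x) (b := X) (B := fun _ => -F x) (B' := fun _ => 0)
    (fun t ht => (hdF t (hsub t ht)).neg.continuousAt.continuousWithinAt)
    (fun t ht => (hdF t (hsub t ⟨ht.1, ht.2.le⟩)).neg.hasDerivWithinAt) le_rfl
    continuousOn_const (fun t _ => hasDerivWithinAt_const _ _ _) ?_ ⟨hx.2, le_rfl⟩
  · have h1 : F x ≤ F X := by linarith
    rw [hFsq x (by linarith [hx.1]), hFsq X hX0.le] at h1
    have h2 := abs_le_of_sq_le_sq' h1 (by positivity)
    linarith [h2.2]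
  · intro t ht hFt
    have htI := hsub t ⟨ht.1, ht.2.le⟩
    have ht1 : 1 ≤ t := hT.trans htI.1
    have ht0 : 0 < t := by linarith
    have h1 : t ^ s * ‖w t‖ > B := by
      have h2 : F t = F x := by linarith
      rw [hFsq x (by linarith [hx.1]), hFsq t ht0.le] at h2
      have h3 : t ^ s * ‖w t‖ = x ^ s * ‖w x‖ := by
        have hx0 : 0 ≤ x := by linarith [hx.1]
        exact (pow_left_inj₀ (by positivity) (by positivity) two_ne_zero).mp h2
      linarith
    have hwpos : 0 < ‖w t‖ := by
      rcases (norm_nonneg (w t)).eq_or_lt with h | h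
      · rw [← h] at h1; linarith
      · exact h
    have h2 : C * V / t < 2 * κ * √t * ‖w t‖ := by
      have h3 : t ^ s ≤ t * √t := by
        calc t ^ s ≤ t ^ (3 / 2 : ℝ) := Real.rpow_le_rpow_of_exponent_le ht1 hs
          _ = t * √t := by
            rw [Real.sqrt_eq_rpow, ← Real.rpow_one_add' ht0.le (by norm_num)]
            norm_num
      have h4 : C * V / (2 * κ) < t * √t * ‖w t‖ := by
        have : t ^ s * ‖w t‖ ≤ t * √t * ‖w t‖ := by gcongr
        linarith
      rw [div_lt_iff₀ (by positivity)] at h4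
      rw [div_lt_iff₀ ht0]
      linarith
    have h3 : ((-2 * φ t * w t - E t * v t) * (starRingEnd ℂ) (w t)).re ≥
        2 * κ * √t * ‖w t‖ ^ 2 - C * V / t * ‖w t‖ := by
      have e1 : (-2 * φ t * w t - E t * v t) * (starRingEnd ℂ) (w t) =
          -2 * φ t * ((‖w t‖ ^ 2 : ℝ) : ℂ) - E t * v t * (starRingEnd ℂ) (w t) := by
        rw [← Complex.normSq_eq_norm_sq, ← Complex.mul_conj]; ring
      have e2 : (-2 * φ t * ((‖w t‖ ^ 2 : ℝ) : ℂ)).re = -2 * (φ t).re * ‖w t‖ ^ 2 := by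
        rw [Complex.re_mul_ofReal]; simp
      have e3 : (E t * v t * (starRingEnd ℂ) (w t)).re ≤ C * V / t * ‖w t‖ := by
        refine (Complex.re_le_norm _).trans ?_
        rw [norm_mul, norm_mul, RCLike.norm_conj]
        have hE0 := (norm_nonneg _).trans (hE t htI)
        calc ‖E t‖ * ‖v t‖ * ‖w t‖ ≤ C / t * V * ‖w t‖ := by
              gcongr
              · exact hE t htI
              · exact hV t htI
          _ = _ := by ring
      rw [e1, Complex.sub_re, e2]
      have := hφ t htI
      nlinarith [sq_nonneg ‖w t‖]
    have h4 : 0 < 2 * κ * √t * ‖w t‖ ^ 2 - C * V / t * ‖w t‖ := by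
      have : C * V / t * ‖w t‖ < 2 * κ * √t * ‖w t‖ * ‖w t‖ := by gcongr
      nlinarith
    have h5 : 0 < F' t := by
      have a1 : 0 ≤ 2 * s * t ^ (2 * s - 1) * ‖w t‖ ^ 2 := by positivity
      have a2 : 0 < t ^ (2 * s) * (2 * ((-2 * φ t * w t - E t * v t) *
          (starRingEnd ℂ) (w t)).re) := by
        have : 0 < ((-2 * φ t * w t - E t * v t) * (starRingEnd ℂ) (w t)).re := by linarith
        positivity
      simp only [F']
      linarith
    linarith

/-- The exponent 5/4 lies strictly between 1 and 3/2: it is integrable at infinity, and it leaves a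
margin of 1/4 below the rate that the damping allows. That margin becomes the Cauchy rate X^(-1/4).
-/
lemma norm_sub_le_of_deriv_le {v w : ℝ → ℂ} {x X B : ℝ} (hx : 0 < x) (hxX : x ≤ X) (hB : 0 ≤ B)
    (hv : ∀ t ∈ Set.Icc x X, HasDerivAt v (w t) t)
    (hw : ∀ t ∈ Set.Icc x X, t ^ (5 / 4 : ℝ) * ‖w t‖ ≤ B) :
    ‖v x - v X‖ ≤ 4 * B * x ^ (-(1 / 4) : ℝ) := by
  have hd : ∀ t ∈ Set.Icc x X, HasDerivAt
      (fun t : ℝ => 4 * B * (x ^ (-(1 / 4) : ℝ) - t ^ (-(1 / 4) : ℝ))) (B * t ^ (-(5 / 4) : ℝ)) t := by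
    intro t ht
    have h1 : HasDerivAt (fun t : ℝ => t ^ (-(1 / 4) : ℝ)) (-(1 / 4) * t ^ (-(1 / 4) - 1 : ℝ)) t :=
      Real.hasDerivAt_rpow_const (Or.inl (by linarith [ht.1]))
    refine ((h1.const_sub _).const_mul (4 * B)).congr_deriv ?_
    norm_num
    ring
  have key := image_norm_le_of_norm_deriv_right_le_deriv_boundary' (f := fun t => v t - v x)
    (f' := w) (a := x) (b := X)
    (B := fun t : ℝ => 4 * B * (x ^ (-(1 / 4) : ℝ) - t ^ (-(1 / 4) : ℝ)))
    (B' := fun t => B * t ^ (-(5 / 4) : ℝ))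
    (fun t ht => ((hv t ht).sub_const _).continuousAt.continuousWithinAt)
    (fun t ht => ((hv t ⟨ht.1, ht.2.le⟩).sub_const _).hasDerivWithinAt) (by simp)
    (fun t ht => (hd t ht).continuousAt.continuousWithinAt)
    (fun t ht => (hd t ⟨ht.1, ht.2.le⟩).hasDerivWithinAt) ?_ ⟨hxX, le_rfl⟩
  · rw [norm_sub_rev]
    refine key.trans ?_
    have : 0 ≤ X ^ (-(1 / 4) : ℝ) := Real.rpow_nonneg (by linarith) _
    have : 0 ≤ 4 * B * X ^ (-(1 / 4) : ℝ) := by positivity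
    linarith
  · intro t ht
    have ht0 : 0 < t := lt_of_lt_of_le hx ht.1
    have h := hw t ⟨ht.1, ht.2.le⟩
    rw [Real.rpow_neg ht0.le, ← div_eq_mul_inv, le_div_iff₀ (by positivity), mul_comm]
    exact h

/-- Backward estimates for `v' = w`, `w' = -2 φ w - E v` with `Re φ ≤ -κ √x`, `|E| ≤ C / x`. -/
lemma damped_backward {v w φ E : ℝ → ℂ} {T X κ C : ℝ} (hT : 1 ≤ T) (hκ : 0 < κ) (hC : 0 ≤ C)
    (hTC : 8 * C ≤ κ * T ^ (1 / 4 : ℝ)) (hTX : T ≤ X)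
    (hv : ∀ x ∈ Set.Icc T X, HasDerivAt v (w x) x)
    (hw : ∀ x ∈ Set.Icc T X, HasDerivAt w (-2 * φ x * w x - E x * v x) x)
    (hφ : ∀ x ∈ Set.Icc T X, (φ x).re ≤ -(κ * √x))
    (hE : ∀ x ∈ Set.Icc T X, ‖E x‖ ≤ C / x) {N : ℝ}
    (hN : ‖v X‖ + 4 * (X ^ (5 / 4 : ℝ) * ‖w X‖) ≤ N) {x : ℝ} (hx : x ∈ Set.Icc T X) :
    ‖v x‖ ≤ 2 * N ∧ x ^ (5 / 4 : ℝ) * ‖w x‖ ≤ (1 + 2 * C / κ) * N ∧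
      ‖v x - v X‖ ≤ 4 * (1 + 2 * C / κ) * N * x ^ (-(1 / 4) : ℝ) ∧
      (w X = 0 → x ^ (3 / 2 : ℝ) * ‖w x‖ ≤ (1 + 2 * C / κ) * N) := by
  have hX : X ∈ Set.Icc T X := ⟨hTX, le_rfl⟩
  have hX0 : 0 < X := by linarith
  have hvc : ContinuousOn (fun t => ‖v t‖) (Set.Icc T X) := fun t ht =>
    (hv t ht).continuousAt.norm.continuousWithinAt
  -- The maximum V of |v| appears on both sides of the estimate; the lower bound on T makes its
  -- contribution on the right at most V/2, so it can be absorbed.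
  obtain ⟨x₁, hx₁, hmax⟩ := isCompact_Icc.exists_isMaxOn ⟨X, hX⟩ hvc
  set V := ‖v x₁‖ with hVdef
  have hV : ∀ t ∈ Set.Icc T X, ‖v t‖ ≤ V := fun t ht => hmax ht
  have hV0 : 0 ≤ V := norm_nonneg _
  set W := X ^ (5 / 4 : ℝ) * ‖w X‖ with hW
  have hW0 : 0 ≤ W := by positivity
  have hCVk : C * V / (2 * κ) ≤ C * V / κ := by
    apply div_le_div_of_nonneg_left (by positivity) hκ; linarith
  set B := W + C * V / κ with hBdef
  have hB0 : 0 ≤ B := by positivity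
  have hbar : ∀ t ∈ Set.Icc T X, t ^ (5 / 4 : ℝ) * ‖w t‖ ≤ B := fun t ht =>
    damped_barrier hT hκ (by norm_num) (by norm_num) hw hφ hE hV
      (by have : 0 ≤ C * V / κ := by positivity
          linarith) (by linarith) ht
  have hdiff : ∀ t ∈ Set.Icc T X, ‖v t - v X‖ ≤ 4 * B * t ^ (-(1 / 4) : ℝ) := fun t ht =>
    norm_sub_le_of_deriv_le (by linarith [ht.1]) ht.2 hB0
      (fun τ hτ => hv τ ⟨ht.1.trans hτ.1, hτ.2⟩) (fun τ hτ => hbar τ ⟨ht.1.trans hτ.1, hτ.2⟩)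
  have hV2 : V ≤ 2 * N := by
    have h1 : V ≤ ‖v X‖ + 4 * B * x₁ ^ (-(1 / 4) : ℝ) := by
      have := hdiff x₁ hx₁
      have h2 : ‖v x₁‖ ≤ ‖v X‖ + ‖v x₁ - v X‖ := norm_le_norm_add_norm_sub' _ _
      linarith
    have h2 : x₁ ^ (-(1 / 4) : ℝ) ≤ T ^ (-(1 / 4) : ℝ) :=
      Real.rpow_le_rpow_of_nonpos (by linarith) hx₁.1 (by norm_num)
    have h3 : T ^ (-(1 / 4) : ℝ) ≤ 1 := Real.rpow_le_one_of_one_le_of_nonpos hT (by norm_num)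
    have h4 : C * V / κ * T ^ (-(1 / 4) : ℝ) ≤ V / 8 := by
      have hT4 : 0 < T ^ (1 / 4 : ℝ) := Real.rpow_pos_of_pos (by linarith) _
      rw [Real.rpow_neg (by linarith), ← div_eq_mul_inv, div_div, div_le_iff₀ (by positivity)]
      nlinarith
    have h5 : 4 * B * x₁ ^ (-(1 / 4) : ℝ) ≤ 4 * W + V / 2 := by
      calc 4 * B * x₁ ^ (-(1 / 4) : ℝ) ≤ 4 * B * T ^ (-(1 / 4) : ℝ) := by gcongr
        _ = 4 * (W * T ^ (-(1 / 4) : ℝ)) + 4 * (C * V / κ * T ^ (-(1 / 4) : ℝ)) := by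
          rw [hBdef]; ring
        _ ≤ 4 * (W * 1) + 4 * (V / 8) := by gcongr
        _ = _ := by ring
    linarith
  have hCV : C * V / κ ≤ 2 * C / κ * N := by
    rw [div_mul_eq_mul_div, div_le_div_iff_of_pos_right hκ]
    nlinarith
  have hN0 : 0 ≤ N := by linarith
  have hWN : W ≤ N := by linarith [norm_nonneg (v X)]
  have hBN : B ≤ (1 + 2 * C / κ) * N := by
    rw [hBdef, add_mul, one_mul]
    linarith
  refine ⟨(hV x hx).trans hV2, (hbar x hx).trans hBN, (hdiff x hx).trans ?_, fun hwX => ?_⟩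
  · have : 0 ≤ x ^ (-(1 / 4) : ℝ) := Real.rpow_nonneg (by linarith [hx.1]) _
    nlinarith
  -- When w vanishes at X the boundary condition of the barrier is free, so the extreme exponent 3/2
  -- is available.
  · refine (damped_barrier (B := C * V / κ) hT hκ (by norm_num) le_rfl hw hφ hE hV ?_ hCVk
      hx).trans ?_
    · rw [hwX]; simp; positivity
    · rw [add_mul, one_mul]; linarith

/-! ### Square roots -/

/-- The principal square root. -/
def csqrt (w : ℂ) : ℂ := Complex.exp (Complex.log w / 2)

lemma csqrt_ne_zero (w : ℂ) : csqrt w ≠ 0 := Complex.exp_ne_zero _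

lemma csqrt_sq {w : ℂ} (hw : w ≠ 0) : csqrt w ^ 2 = w := by
  rw [csqrt, ← Complex.exp_nat_mul]
  push_cast
  rw [mul_div_cancel₀ _ two_ne_zero, Complex.exp_log hw]

lemma norm_csqrt {w : ℂ} (hw : w ≠ 0) : ‖csqrt w‖ = √‖w‖ := by
  rw [eq_comm, Real.sqrt_eq_iff_mul_self_eq (norm_nonneg _) (norm_nonneg _), ← sq, ← norm_pow,
    csqrt_sq hw]

lemma csqrt_re_nonneg (w : ℂ) : 0 ≤ (csqrt w).re := by
  rw [csqrt, Complex.exp_re]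
  have h1 : (Complex.log w / 2).im = w.arg / 2 := by
    rw [Complex.div_ofNat_im, Complex.log_im]
  rw [h1]
  refine mul_nonneg (Real.exp_pos _).le (Real.cos_nonneg_of_mem_Icc ⟨?_, ?_⟩)
  · linarith [Complex.neg_pi_lt_arg w]
  · linarith [Complex.arg_le_pi w]

/-- For s = √w one has |w| + Re w = 2(Re s)² and |w| = |s|². The inequality c|w| ≤ |w| + Re w is the
form in which a sector about the positive axis is used throughout. -/
lemma csqrt_re_ge {w : ℂ} {c : ℝ} (hw : w ≠ 0) (hc : 0 ≤ c) (h : c * ‖w‖ ≤ ‖w‖ + w.re) :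
    √(c / 2) * ‖csqrt w‖ ≤ (csqrt w).re := by
  have h1 : ‖w‖ = ‖csqrt w‖ ^ 2 := by rw [← norm_pow, csqrt_sq hw]
  have h2 : w.re = (csqrt w).re ^ 2 - (csqrt w).im ^ 2 := by
    conv_lhs => rw [← csqrt_sq hw]
    rw [sq, Complex.mul_re]; ring
  have h3 : ‖csqrt w‖ ^ 2 = (csqrt w).re ^ 2 + (csqrt w).im ^ 2 := by
    rw [← Complex.normSq_eq_norm_sq, Complex.normSq_apply]; ring
  refine abs_le_of_sq_le_sq' ?_ (csqrt_re_nonneg w) |>.2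
  rw [mul_pow, Real.sq_sqrt (by positivity)]
  nlinarith

lemma mem_slitPlane_of_sector {w : ℂ} {c : ℝ} (hw : w ≠ 0) (hc : 0 < c)
    (h : c * ‖w‖ ≤ ‖w‖ + w.re) : w ∈ Complex.slitPlane := by
  rw [Complex.mem_slitPlane_iff]
  by_contra! hcon
  obtain ⟨h1, h2⟩ := hcon
  have h3 : ‖w‖ = -w.re := by
    have : w = (w.re : ℂ) := Complex.ext rfl (by simp [h2])
    rw [this, Complex.norm_real, Real.norm_eq_abs, abs_of_nonpos h1, Complex.ofReal_re]
  have := norm_pos_iff.mpr hw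
  nlinarith

lemma hasDerivAt_csqrt {w : ℂ} (hw : w ∈ Complex.slitPlane) :
    HasDerivAt csqrt (1 / (2 * csqrt w)) w := by
  have h := ((Complex.hasDerivAt_log hw).div_const 2).cexp
  refine h.congr_deriv ?_
  have h0 : w ≠ 0 := Complex.slitPlane_ne_zero hw
  have e : Complex.exp (Complex.log w / 2) = csqrt w := rfl
  rw [e]
  nth_rewrite 2 [← csqrt_sq h0]
  field_simp [csqrt_ne_zero w]

/-! ### Liouville-Green approximation on a ray -/

/-- The ray of direction `θ` is uniformly transversal to the vertical trajectories of `Q dz²`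
and `Q` varies slowly along it. -/
structure GoodRay (Q : ℂ[X]) (θ c C R : ℝ) : Prop where
  hc : 0 < c
  hC : 0 ≤ C
  hR : 1 ≤ R
  lower : ∀ r, R ≤ r → c * r ≤ ‖rayPot Q θ r‖
  sector : ∀ r, R ≤ r → c * ‖rayPot Q θ r‖ ≤ ‖rayPot Q θ r‖ + (rayPot Q θ r).re
  deriv_le : ∀ r, R ≤ r →
    r * ‖(derivative Q).eval (ray θ r)‖ ≤ C * ‖Q.eval (ray θ r)‖
  deriv_deriv_le : ∀ r, R ≤ r →
    r ^ 2 * ‖(derivative (derivative Q)).eval (ray θ r)‖ ≤ C * ‖Q.eval (ray θ r)‖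

/-- First derivative of the potential along the ray. -/
def rayPotDeriv (Q : ℂ[X]) (θ r : ℝ) : ℂ := dir θ ^ 3 * (derivative Q).eval (ray θ r)

/-- Second derivative of the potential along the ray. -/
def rayPotDeriv2 (Q : ℂ[X]) (θ r : ℝ) : ℂ := dir θ ^ 4 * (derivative (derivative Q)).eval (ray θ r)

lemma hasDerivAt_eval_ray (Q : ℂ[X]) (θ r : ℝ) :
    HasDerivAt (fun r => Q.eval (ray θ r)) (dir θ * (derivative Q).eval (ray θ r)) r := by
  rw [mul_comm]
  exact (Q.hasDerivAt (ray θ r)).comp_of_eq r (hasDerivAt_ray θ r) rfl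

lemma hasDerivAt_rayPot (Q : ℂ[X]) (θ r : ℝ) :
    HasDerivAt (rayPot Q θ) (rayPotDeriv Q θ r) r :=
  ((hasDerivAt_eval_ray Q θ r).const_mul (dir θ ^ 2)).congr_deriv (by rw [rayPotDeriv]; ring)

lemma hasDerivAt_rayPotDeriv (Q : ℂ[X]) (θ r : ℝ) :
    HasDerivAt (rayPotDeriv Q θ) (rayPotDeriv2 Q θ r) r :=
  ((hasDerivAt_eval_ray (derivative Q) θ r).const_mul (dir θ ^ 3)).congr_deriv
    (by rw [rayPotDeriv2]; ring)

lemma continuous_rayPot (Q : ℂ[X]) (θ : ℝ) : Continuous (rayPot Q θ) :=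
  continuous_iff_continuousAt.mpr fun r => (hasDerivAt_rayPot Q θ r).continuousAt

lemma norm_rayPot (Q : ℂ[X]) (θ r : ℝ) : ‖rayPot Q θ r‖ = ‖Q.eval (ray θ r)‖ := by
  rw [rayPot, norm_mul, norm_pow, norm_dir]; simp

/-- Square root of the potential along the ray. -/
def raySqrt (Q : ℂ[X]) (θ r : ℝ) : ℂ := csqrt (rayPot Q θ r)

/-- Logarithmic derivative of the approximate solution. -/
def wkbPhi (Q : ℂ[X]) (θ : ℝ) (lam : ℂ) (r : ℝ) : ℂ :=
  -raySqrt Q θ r + lam * dir θ ^ 2 / (2 * raySqrt Q θ r) -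
    rayPotDeriv Q θ r / (4 * rayPot Q θ r)

/-- Error term of the approximate solution. -/
def wkbErr (Q : ℂ[X]) (θ : ℝ) (lam : ℂ) (r : ℝ) : ℂ :=
  (lam * dir θ ^ 2) ^ 2 / (4 * rayPot Q θ r) -
    lam * dir θ ^ 2 * rayPotDeriv Q θ r / (2 * raySqrt Q θ r * rayPot Q θ r) +
    5 * rayPotDeriv Q θ r ^ 2 / (16 * rayPot Q θ r ^ 2) - rayPotDeriv2 Q θ r / (4 * rayPot Q θ r)

/-- The approximate solution on the ray, decaying at infinity. -/
def wkbSol (Q : ℂ[X]) (θ R : ℝ) (lam : ℂ) (r : ℝ) : ℂ :=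
  Complex.exp (-(Complex.log (rayPot Q θ r) / 4) - (∫ s in R..r, raySqrt Q θ s) +
    lam * dir θ ^ 2 / 2 * ∫ s in R..r, (raySqrt Q θ s)⁻¹)

lemma wkbSol_ne_zero (Q : ℂ[X]) (θ R : ℝ) (lam : ℂ) (r : ℝ) : wkbSol Q θ R lam r ≠ 0 :=
  Complex.exp_ne_zero _

lemma hasDerivAt_integral_ray {P : ℂ[X]} {θ a r : ℝ} {f : ℝ → ℂ}
    (hs : ∀ s, a ≤ s → rayPot P θ s ∈ Complex.slitPlane)
    (hf : ∀ s, rayPot P θ s ∈ Complex.slitPlane → ContinuousAt f s) (hr : a ≤ r) :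
    HasDerivAt (fun r => ∫ s in a..r, f s) (f r) r := by
  have hopen : IsOpen {s : ℝ | rayPot P θ s ∈ Complex.slitPlane} :=
    Complex.isOpen_slitPlane.preimage (continuous_rayPot P θ)
  refine intervalIntegral.integral_hasDerivAt_right ?_ ?_ (hf r (hs r hr))
  · refine ContinuousOn.intervalIntegrable fun s hs' => ?_
    rw [Set.uIcc_of_le hr] at hs'
    exact (hf s (hs s hs'.1)).continuousWithinAt
  · exact ContinuousOn.stronglyMeasurableAtFilter hopen
      (fun s hs => (hf s hs).continuousWithinAt) r (hs r hr)

lemma continuousAt_raySqrt {P : ℂ[X]} {θ s : ℝ} (hs : rayPot P θ s ∈ Complex.slitPlane) :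
    ContinuousAt (raySqrt P θ) s :=
  ((hasDerivAt_csqrt hs).comp_of_eq s (hasDerivAt_rayPot P θ s) rfl).continuousAt

namespace GoodRay

variable {Q : ℂ[X]} {θ c C R r : ℝ}

lemma rayPot_ne_zero (h : GoodRay Q θ c C R) (hr : R ≤ r) : rayPot Q θ r ≠ 0 := by
  have h1 := h.lower r hr
  have h2 : 0 < c * r := mul_pos h.hc (by linarith [h.hR])
  exact norm_pos_iff.mp (by linarith)

lemma mem_slitPlane (h : GoodRay Q θ c C R) (hr : R ≤ r) : rayPot Q θ r ∈ Complex.slitPlane :=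
  mem_slitPlane_of_sector (h.rayPot_ne_zero hr) h.hc (h.sector r hr)

lemma hasDerivAt_raySqrt (h : GoodRay Q θ c C R) (hr : R ≤ r) :
    HasDerivAt (raySqrt Q θ) (rayPotDeriv Q θ r / (2 * raySqrt Q θ r)) r :=
  ((hasDerivAt_csqrt (h.mem_slitPlane hr)).comp_of_eq r (hasDerivAt_rayPot Q θ r) rfl).congr_deriv
    (by rw [raySqrt]; ring)

lemma raySqrt_sq (h : GoodRay Q θ c C R) (hr : R ≤ r) : raySqrt Q θ r ^ 2 = rayPot Q θ r :=
  csqrt_sq (h.rayPot_ne_zero hr)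

lemma hasDerivAt_wkbSol (h : GoodRay Q θ c C R) (lam : ℂ) (hr : R ≤ r) :
    HasDerivAt (wkbSol Q θ R lam) (wkbPhi Q θ lam r * wkbSol Q θ R lam r) r := by
  have h1 : HasDerivAt (fun r => Complex.log (rayPot Q θ r)) (rayPotDeriv Q θ r / rayPot Q θ r) r :=
    (hasDerivAt_rayPot Q θ r).clog_real (h.mem_slitPlane hr)
  have h2 := hasDerivAt_integral_ray (fun s hs => h.mem_slitPlane hs) (fun s hs => continuousAt_raySqrt hs) hr
  have h3 := hasDerivAt_integral_ray (f := fun s => (raySqrt Q θ s)⁻¹)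
    (fun s hs => h.mem_slitPlane hs)
    (fun s hs => (continuousAt_raySqrt hs).inv₀ (csqrt_ne_zero _)) hr
  have h4 := (((h1.div_const 4).fun_neg.fun_sub h2).fun_add
    (h3.const_mul (lam * dir θ ^ 2 / 2))).cexp
  refine h4.congr_deriv ?_
  rw [mul_comm]
  congr 1
  rw [wkbPhi, ← h.raySqrt_sq hr]
  have : raySqrt Q θ r ≠ 0 := csqrt_ne_zero _
  field_simp
  ring

/-- This Riccati equation says that `wkbSol` solves u'' = (W - μ + E)u exactly. The term μ/(2√W) in
φ is there to cancel μ; without it the error would not decay. -/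
lemma hasDerivAt_wkbPhi (h : GoodRay Q θ c C R) (lam : ℂ) (hr : R ≤ r) :
    HasDerivAt (wkbPhi Q θ lam) (rayPot Q θ r - lam * dir θ ^ 2 + wkbErr Q θ lam r -
      wkbPhi Q θ lam r ^ 2) r := by
  have ha : raySqrt Q θ r ≠ 0 := csqrt_ne_zero _
  have hW := h.rayPot_ne_zero hr
  have h1 := h.hasDerivAt_raySqrt hr
  have h2 := (h1.inv ha).const_mul (lam * dir θ ^ 2 / 2)
  have h3 := (hasDerivAt_rayPotDeriv Q θ r).div ((hasDerivAt_rayPot Q θ r).const_mul (4 : ℂ))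
    (mul_ne_zero (by norm_num) hW)
  have h4 := (h1.neg.add h2).sub h3
  refine (h4.congr_of_eventuallyEq (Eventually.of_forall fun s => ?_)).congr_deriv ?_
  · simp only [wkbPhi, Pi.sub_apply, Pi.add_apply, Pi.neg_apply, Pi.inv_apply, Pi.div_apply]
    have : raySqrt Q θ s ≠ 0 := csqrt_ne_zero _
    field_simp
  · simp only [wkbPhi, wkbErr]
    rw [← h.raySqrt_sq hr]
    field_simp
    ring

/-- The ratio of a solution to the approximate solution, and its derivative. -/
lemma hasDerivAt_ratio (h : GoodRay Q θ c C R) {lam : ℂ} {y : ℂ → ℂ} (hy : IsSolution Q lam y)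
    (hr : R ≤ r) :
    HasDerivAt (fun r => y (ray θ r) / wkbSol Q θ R lam r)
      ((dir θ * deriv y (ray θ r) - wkbPhi Q θ lam r * y (ray θ r)) / wkbSol Q θ R lam r) r ∧
    HasDerivAt (fun r => (dir θ * deriv y (ray θ r) - wkbPhi Q θ lam r * y (ray θ r)) /
        wkbSol Q θ R lam r)
      (-2 * wkbPhi Q θ lam r * ((dir θ * deriv y (ray θ r) - wkbPhi Q θ lam r * y (ray θ r)) /
        wkbSol Q θ R lam r) - wkbErr Q θ lam r * (y (ray θ r) / wkbSol Q θ R lam r)) r := by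
  have hu := h.hasDerivAt_wkbSol lam hr
  have hu0 := wkbSol_ne_zero Q θ R lam r
  have hphi := h.hasDerivAt_wkbPhi lam hr
  have h1 := hy.hasDerivAt_ray θ r
  have h2 := hy.hasDerivAt_deriv_ray θ r
  refine ⟨(h1.div hu hu0).congr_deriv ?_, ((h2.sub (hphi.mul h1)).div hu hu0).congr_deriv ?_⟩
  · field_simp
  · simp only [Pi.sub_apply, Pi.mul_apply]
    field_simp
    ring

end GoodRay

lemma norm_raySqrt_ge {Q : ℂ[X]} {θ c C R r : ℝ} (h : GoodRay Q θ c C R) (hr : R ≤ r) :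
    √c * √r ≤ ‖raySqrt Q θ r‖ := by
  rw [raySqrt, norm_csqrt (h.rayPot_ne_zero hr), ← Real.sqrt_mul h.hc.le]
  exact Real.sqrt_le_sqrt (h.lower r hr)

/-- Bounds for the logarithmic derivative and the error term, uniform for `|lam| ≤ M`. -/
lemma exists_wkb_bounds {c C R : ℝ} (hc : 0 < c) (hC : 0 ≤ C) (M : ℝ) :
    ∃ K T : ℝ, 0 ≤ K ∧ 1 ≤ T ∧ R ≤ T ∧ ∀ (Q : ℂ[X]) (θ : ℝ), GoodRay Q θ c C R →
      ∀ lam : ℂ, ‖lam‖ ≤ M → ∀ r, T ≤ r →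
        (wkbPhi Q θ lam r).re ≤ -(√(c / 2) / 2 * ‖raySqrt Q θ r‖) ∧ ‖wkbErr Q θ lam r‖ ≤ K / r := by
  set k := √(c / 2) with hk
  have hk0 : 0 < k := Real.sqrt_pos.mpr (by positivity)
  have hsc : 0 < √c := Real.sqrt_pos.mpr hc
  set M' := max M 0
  have hM' : 0 ≤ M' := le_max_right _ _
  -- With k = √(c/2), the real part of √W is at least k|√W|. The last two entries make each
  -- correction term of φ at most k|√W|/4, which leaves the rate k|√W|/2.
  set T := max (max 1 R) (max (2 * M' / (c * k)) (C / (k * √c))) with hT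
  have hT1 : 1 ≤ T := (le_max_left _ _).trans (le_max_left _ _)
  have hTR : R ≤ T := (le_max_right _ _).trans (le_max_left _ _)
  have hTM : 2 * M' / (c * k) ≤ T := (le_max_left _ _).trans (le_max_right _ _)
  have hTC : C / (k * √c) ≤ T := (le_max_right _ _).trans (le_max_right _ _)
  refine ⟨M' ^ 2 / (4 * c) + M' * C / (2 * √c) + C ^ 2 + C, T, by positivity, hT1, hTR,
    fun Q θ h lam hlam r hr => ?_⟩
  have hlam' : ‖lam‖ ≤ M' := hlam.trans (le_max_left _ _)
  have hr1 : 1 ≤ r := hT1.trans hr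
  have hr0 : 0 < r := by linarith
  have hrR : R ≤ r := hTR.trans hr
  set a := raySqrt Q θ r with ha
  set W := rayPot Q θ r with hW
  set W1 := rayPotDeriv Q θ r with hW1
  set W2 := rayPotDeriv2 Q θ r with hW2
  set μ := lam * dir θ ^ 2 with hμ
  have hμn : ‖μ‖ ≤ M' := by rw [hμ, norm_mul, norm_pow, norm_dir]; simpa using hlam'
  have hWpos : 0 < ‖W‖ := norm_pos_iff.mpr (h.rayPot_ne_zero hrR)
  have haW : ‖a‖ ^ 2 = ‖W‖ := by rw [← norm_pow, h.raySqrt_sq hrR]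
  have hapos : 0 < ‖a‖ := norm_pos_iff.mpr (csqrt_ne_zero _)
  have hage : √c ≤ ‖a‖ := by
    refine le_trans ?_ (norm_raySqrt_ge h hrR)
    exact le_mul_of_one_le_right hsc.le (Real.one_le_sqrt.mpr hr1)
  have hWr : c * r ≤ ‖W‖ := h.lower r hrR
  have hW1r : ‖W1‖ / ‖W‖ ≤ C / r := by
    rw [div_le_div_iff₀ hWpos hr0, hW1, rayPotDeriv, norm_mul, norm_pow, norm_dir, hW, norm_rayPot]
    have := h.deriv_le r hrR
    linarith
  have hW2r : ‖W2‖ / ‖W‖ ≤ C / r ^ 2 := by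
    rw [div_le_div_iff₀ hWpos (by positivity), hW2, rayPotDeriv2, norm_mul, norm_pow, norm_dir, hW,
      norm_rayPot]
    have := h.deriv_deriv_le r hrR
    linarith
  constructor
  · have h1 : k * ‖a‖ ≤ a.re := csqrt_re_ge (h.rayPot_ne_zero hrR) hc.le (h.sector r hrR)
    have h2 : ‖μ / (2 * a)‖ ≤ k / 4 * ‖a‖ := by
      rw [norm_div, norm_mul 2 a, Complex.norm_ofNat, div_le_iff₀ (by positivity)]
      have h3 : 2 * M' ≤ r * (c * k) := by
        have := hTM.trans hr
        rwa [div_le_iff₀ (by positivity)] at this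
      have h4 : k / 4 * ‖a‖ * (2 * ‖a‖) = k / 2 * ‖W‖ := by rw [← haW]; ring
      rw [h4]
      nlinarith
    have h3 : ‖W1 / (4 * W)‖ ≤ k / 4 * ‖a‖ := by
      have e : ‖W1 / (4 * W)‖ = ‖W1‖ / ‖W‖ / 4 := by
        rw [norm_div, norm_mul, Complex.norm_ofNat]; field_simp
      rw [e]
      have h4 : C / r ≤ k * √c := by
        rw [div_le_iff₀ hr0]
        have := hTC.trans hr
        rw [div_le_iff₀ (by positivity)] at this
        linarith
      have h5 : k * √c ≤ k * ‖a‖ := by gcongr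
      linarith
    have h4 := (Complex.re_le_norm (μ / (2 * a)))
    have h5 := (Complex.abs_re_le_norm (W1 / (4 * W)))
    have h6 := neg_le_of_abs_le h5
    have h7 : (wkbPhi Q θ lam r).re = -a.re + (μ / (2 * a)).re - (W1 / (4 * W)).re := by
      rw [wkbPhi, Complex.sub_re, Complex.add_re, Complex.neg_re]
    rw [h7]
    linarith
  · have e1 : ‖μ ^ 2 / (4 * W)‖ ≤ M' ^ 2 / (4 * c) / r := by
      rw [norm_div, norm_mul, norm_pow, Complex.norm_ofNat, div_div]
      have : ‖μ‖ ^ 2 ≤ M' ^ 2 := by gcongr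
      exact div_le_div₀ (by positivity) this (by positivity) (by nlinarith)
    have e2 : ‖μ * W1 / (2 * a * W)‖ ≤ M' * C / (2 * √c) / r := by
      have : ‖μ * W1 / (2 * a * W)‖ = ‖μ‖ / (2 * ‖a‖) * (‖W1‖ / ‖W‖) := by
        rw [norm_div, norm_mul μ, norm_mul (2 * a), norm_mul 2 a, Complex.norm_ofNat]; field_simp
      rw [this]
      calc ‖μ‖ / (2 * ‖a‖) * (‖W1‖ / ‖W‖) ≤ M' / (2 * √c) * (C / r) := by gcongr
        _ = _ := by ring
    have hr2 : 1 / r ^ 2 ≤ 1 / r := by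
      apply one_div_le_one_div_of_le hr0
      nlinarith
    have e3 : ‖5 * W1 ^ 2 / (16 * W ^ 2)‖ ≤ C ^ 2 / r := by
      have : ‖5 * W1 ^ 2 / (16 * W ^ 2)‖ = 5 / 16 * (‖W1‖ / ‖W‖) ^ 2 := by
        rw [norm_div, norm_mul, norm_mul, norm_pow, norm_pow, Complex.norm_ofNat,
          Complex.norm_ofNat]
        field_simp
      rw [this]
      have h1 : (‖W1‖ / ‖W‖) ^ 2 ≤ (C / r) ^ 2 := by gcongr
      have h2 : (C / r) ^ 2 ≤ C ^ 2 / r := by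
        have e : (C / r) ^ 2 = C ^ 2 * (1 / r ^ 2) := by rw [div_pow]; ring
        have e' : C ^ 2 / r = C ^ 2 * (1 / r) := by ring
        rw [e, e']
        gcongr
      nlinarith [sq_nonneg (‖W1‖ / ‖W‖)]
    have e4 : ‖W2 / (4 * W)‖ ≤ C / r := by
      have : ‖W2 / (4 * W)‖ = 1 / 4 * (‖W2‖ / ‖W‖) := by
        rw [norm_div, norm_mul, Complex.norm_ofNat]; field_simp
      rw [this]
      have h2 : C / r ^ 2 ≤ C / r := by
        have e : C / r ^ 2 = C * (1 / r ^ 2) := by ring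
        have e' : C / r = C * (1 / r) := by ring
        rw [e, e']
        gcongr
      have h3 : 0 ≤ ‖W2‖ / ‖W‖ := by positivity
      linarith
    have h1 : ‖wkbErr Q θ lam r‖ ≤ ‖μ ^ 2 / (4 * W)‖ + ‖μ * W1 / (2 * a * W)‖ +
        ‖5 * W1 ^ 2 / (16 * W ^ 2)‖ + ‖W2 / (4 * W)‖ := by
      rw [wkbErr]
      refine (norm_sub_le _ _).trans ?_
      gcongr
      refine (norm_add_le _ _).trans ?_
      gcongr
      exact norm_sub_le _ _
    refine h1.trans ?_
    rw [add_div, add_div, add_div]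
    linarith

/-! ### Solutions with prescribed data far out on the ray -/

lemma entireSol_wronskian (P : ℂ[X]) (z : ℂ) :
    entireSol P 1 0 z * entireSolDeriv P 0 1 z - entireSolDeriv P 1 0 z * entireSol P 0 1 z = 1 := by
  have h := wronskian_const (isSolution_sub_C.mp (by simpa using isSolution_entireSol P 0 0 1) :
      IsSolution P 0 (entireSol P 0 1))
    (isSolution_sub_C.mp (by simpa using isSolution_entireSol P 0 1 0) :
      IsSolution P 0 (entireSol P 1 0)) z 0
  simp only [deriv_entireSol, entireSol_zero, entireSolDeriv_zero] at h
  linear_combination h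

/-- Value at `0` of the solution that agrees to first order with `wkbSol` at distance `X`. -/
def wkbVal (Q : ℂ[X]) (θ R : ℝ) (lam : ℂ) (X : ℝ) : ℂ :=
  wkbSol Q θ R lam X * entireSolDeriv (Q - C lam) 0 1 (ray θ X) -
    wkbPhi Q θ lam X * wkbSol Q θ R lam X / dir θ * entireSol (Q - C lam) 0 1 (ray θ X)

/-- Derivative at `0` of the solution that agrees to first order with `wkbSol` at distance `X`. -/
def wkbSlope (Q : ℂ[X]) (θ R : ℝ) (lam : ℂ) (X : ℝ) : ℂ :=
  wkbPhi Q θ lam X * wkbSol Q θ R lam X / dir θ * entireSol (Q - C lam) 1 0 (ray θ X) -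
    wkbSol Q θ R lam X * entireSolDeriv (Q - C lam) 1 0 (ray θ X)

/-- The solution with given value and derivative at `0`. -/
def solOf (Q : ℂ[X]) (lam α β : ℂ) (z : ℂ) : ℂ :=
  α * entireSol (Q - C lam) 1 0 z + β * entireSol (Q - C lam) 0 1 z

lemma isSolution_solOf (Q : ℂ[X]) (lam α β : ℂ) : IsSolution Q lam (solOf Q lam α β) :=
  (isSolution_entireSol Q lam 1 0).combine (isSolution_entireSol Q lam 0 1) α β

lemma deriv_solOf (Q : ℂ[X]) (lam α β z : ℂ) : deriv (solOf Q lam α β) z =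
    α * entireSolDeriv (Q - C lam) 1 0 z + β * entireSolDeriv (Q - C lam) 0 1 z :=
  (((hasDerivAt_entireSol (Q - C lam) 1 0 z).const_mul α).fun_add
    ((hasDerivAt_entireSol (Q - C lam) 0 1 z).const_mul β)).deriv

lemma solOf_zero (Q : ℂ[X]) (lam α β : ℂ) : solOf Q lam α β 0 = α := by
  simp [solOf, entireSol_zero]

lemma deriv_solOf_zero (Q : ℂ[X]) (lam α β : ℂ) : deriv (solOf Q lam α β) 0 = β := by
  simp [deriv_solOf, entireSolDeriv_zero]

/-- The data at `0` in terms of the data at `z`. -/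
lemma data_of_solOf (Q : ℂ[X]) (lam α β z : ℂ) :
    α = solOf Q lam α β z * entireSolDeriv (Q - C lam) 0 1 z -
        deriv (solOf Q lam α β) z * entireSol (Q - C lam) 0 1 z ∧
    β = deriv (solOf Q lam α β) z * entireSol (Q - C lam) 1 0 z -
        solOf Q lam α β z * entireSolDeriv (Q - C lam) 1 0 z := by
  have h := entireSol_wronskian (Q - C lam) z
  rw [deriv_solOf, solOf]
  constructor
  · linear_combination -α * h
  · linear_combination -β * h

/-- The solution that agrees to first order with `wkbSol` at distance `X`. -/
def wkbApprox (Q : ℂ[X]) (θ R : ℝ) (lam : ℂ) (X : ℝ) : ℂ → ℂ :=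
  solOf Q lam (wkbVal Q θ R lam X) (wkbSlope Q θ R lam X)

lemma wkbApprox_ray (Q : ℂ[X]) (θ R : ℝ) (lam : ℂ) (X : ℝ) :
    wkbApprox Q θ R lam X (ray θ X) = wkbSol Q θ R lam X ∧
      dir θ * deriv (wkbApprox Q θ R lam X) (ray θ X) =
        wkbPhi Q θ lam X * wkbSol Q θ R lam X := by
  have h := entireSol_wronskian (Q - C lam) (ray θ X)
  have hd := dir_ne_zero θ
  rw [wkbApprox, deriv_solOf, solOf, wkbVal, wkbSlope]
  constructor
  · linear_combination wkbSol Q θ R lam X * h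
  · field_simp
    linear_combination wkbPhi Q θ lam X * wkbSol Q θ R lam X * h

/-- Ratio of a solution to the approximate solution. -/
def ratio (Q : ℂ[X]) (θ R : ℝ) (lam : ℂ) (y : ℂ → ℂ) (r : ℝ) : ℂ :=
  y (ray θ r) / wkbSol Q θ R lam r

/-- Derivative of the ratio of a solution to the approximate solution. -/
def ratioDeriv (Q : ℂ[X]) (θ R : ℝ) (lam : ℂ) (y : ℂ → ℂ) (r : ℝ) : ℂ :=
  (dir θ * deriv y (ray θ r) - wkbPhi Q θ lam r * y (ray θ r)) / wkbSol Q θ R lam r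

lemma ratio_wkbApprox (Q : ℂ[X]) (θ R : ℝ) (lam : ℂ) (X : ℝ) :
    ratio Q θ R lam (wkbApprox Q θ R lam X) X = 1 ∧
      ratioDeriv Q θ R lam (wkbApprox Q θ R lam X) X = 0 := by
  obtain ⟨h1, h2⟩ := wkbApprox_ray Q θ R lam X
  rw [ratio, ratioDeriv, h1, h2]
  exact ⟨div_self (wkbSol_ne_zero _ _ _ _ _), by simp⟩

lemma ratio_solOf_sub (Q : ℂ[X]) (θ R : ℝ) (lam α β α' β' : ℂ) (r : ℝ) :
    ratio Q θ R lam (solOf Q lam (α - α') (β - β')) r =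
        ratio Q θ R lam (solOf Q lam α β) r - ratio Q θ R lam (solOf Q lam α' β') r ∧
      ratioDeriv Q θ R lam (solOf Q lam (α - α') (β - β')) r =
        ratioDeriv Q θ R lam (solOf Q lam α β) r - ratioDeriv Q θ R lam (solOf Q lam α' β') r := by
  simp only [ratio, ratioDeriv, deriv_solOf, solOf]
  constructor <;> ring

/-- Uniform backward estimates for the approximating solutions. -/
lemma exists_wkbApprox_bounds {c C R : ℝ} (hc : 0 < c) (hC : 0 ≤ C) (M : ℝ) :
    ∃ K T : ℝ, 0 ≤ K ∧ 1 ≤ T ∧ R ≤ T ∧ ∀ (Q : ℂ[X]) (θ : ℝ), GoodRay Q θ c C R →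
      ∀ lam : ℂ, ‖lam‖ ≤ M → ∀ X, T ≤ X →
        (∀ x ∈ Set.Icc T X,
          ‖ratio Q θ R lam (wkbApprox Q θ R lam X) x - 1‖ ≤ K * x ^ (-(1 / 4) : ℝ)) ∧
        ∀ X', X ≤ X' →
          ‖ratio Q θ R lam (wkbApprox Q θ R lam X') T - ratio Q θ R lam (wkbApprox Q θ R lam X) T‖
            ≤ K * X ^ (-(1 / 4) : ℝ) ∧
          ‖ratioDeriv Q θ R lam (wkbApprox Q θ R lam X') T -
            ratioDeriv Q θ R lam (wkbApprox Q θ R lam X) T‖ ≤ K * X ^ (-(1 / 4) : ℝ) := by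
  obtain ⟨CE, T₀, hCE, hT₀1, hT₀R, hb⟩ := exists_wkb_bounds (R := R) hc hC M
  set κ := √(c / 2) / 2 * √c with hκ
  have hκ0 : 0 < κ := by
    have := Real.sqrt_pos.mpr hc
    have : 0 < √(c / 2) := Real.sqrt_pos.mpr (by positivity)
    positivity
  -- The fourth power is chosen so that T^(1/4) ≥ 8·CE/κ, the condition under which
  -- `damped_backward` closes.
  set T := max T₀ ((8 * CE / κ) ^ 4) with hT
  have hTT₀ : T₀ ≤ T := le_max_left _ _
  have hT1 : 1 ≤ T := hT₀1.trans hTT₀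
  have hTC : 8 * CE ≤ κ * T ^ (1 / 4 : ℝ) := by
    have h1 : 8 * CE / κ ≤ T ^ (1 / 4 : ℝ) := by
      calc 8 * CE / κ = ((8 * CE / κ) ^ 4) ^ (1 / 4 : ℝ) := by
            rw [← Real.rpow_natCast, ← Real.rpow_mul (by positivity)]; norm_num
        _ ≤ T ^ (1 / 4 : ℝ) := by gcongr; exact le_max_right _ _
    rw [div_le_iff₀ hκ0] at h1
    linarith
  set K₁ := 1 + 2 * CE / κ with hK₁
  have hK₁1 : 1 ≤ K₁ := by
    have : 0 ≤ 2 * CE / κ := by positivity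
    linarith
  refine ⟨40 * K₁ ^ 2, T, by positivity, hT1, hT₀R.trans hTT₀, fun Q θ h lam hlam X hX => ?_⟩
  have hφ : ∀ x, T ≤ x → (wkbPhi Q θ lam x).re ≤ -(κ * √x) := by
    intro x hx
    have h1 := (hb Q θ h lam hlam x (hTT₀.trans hx)).1
    have h2 := norm_raySqrt_ge h (hT₀R.trans (hTT₀.trans hx))
    have h3 : κ * √x ≤ √(c / 2) / 2 * ‖raySqrt Q θ x‖ := by
      rw [hκ, mul_assoc]
      gcongr
    linarith
  have hE : ∀ x, T ≤ x → ‖wkbErr Q θ lam x‖ ≤ CE / x := fun x hx =>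
    (hb Q θ h lam hlam x (hTT₀.trans hx)).2
  have hback : ∀ y : ℂ → ℂ, IsSolution Q lam y → ∀ X, T ≤ X → ∀ N : ℝ,
      ‖ratio Q θ R lam y X‖ + 4 * (X ^ (5 / 4 : ℝ) * ‖ratioDeriv Q θ R lam y X‖) ≤ N →
      ∀ x ∈ Set.Icc T X, ‖ratio Q θ R lam y x‖ ≤ 2 * N ∧
        x ^ (5 / 4 : ℝ) * ‖ratioDeriv Q θ R lam y x‖ ≤ K₁ * N ∧
        ‖ratio Q θ R lam y x - ratio Q θ R lam y X‖ ≤ 4 * K₁ * N * x ^ (-(1 / 4) : ℝ) ∧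
        (ratioDeriv Q θ R lam y X = 0 → x ^ (3 / 2 : ℝ) * ‖ratioDeriv Q θ R lam y x‖ ≤ K₁ * N) := by
    intro y hy X hX N hN x hx
    have hRx : ∀ x ∈ Set.Icc T X, R ≤ x := fun x hx => hT₀R.trans (hTT₀.trans hx.1)
    exact damped_backward (φ := wkbPhi Q θ lam) (E := wkbErr Q θ lam) hT1 hκ0 hCE hTC hX
      (fun x hx => (h.hasDerivAt_ratio hy (hRx x hx)).1)
      (fun x hx => (h.hasDerivAt_ratio hy (hRx x hx)).2)
      (fun x hx => hφ x hx.1) (fun x hx => hE x hx.1) hN hx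
  have hone : ∀ X, T ≤ X → ∀ x ∈ Set.Icc T X,
      ‖ratio Q θ R lam (wkbApprox Q θ R lam X) x - 1‖ ≤ 4 * K₁ * x ^ (-(1 / 4) : ℝ) ∧
      x ^ (3 / 2 : ℝ) * ‖ratioDeriv Q θ R lam (wkbApprox Q θ R lam X) x‖ ≤ K₁ := by
    intro X hX x hx
    obtain ⟨e1, e2⟩ := ratio_wkbApprox Q θ R lam X
    have h1 := hback (wkbApprox Q θ R lam X) (isSolution_solOf _ _ _ _) X hX 1
      (by rw [e1, e2]; simp) x hx
    rw [e1] at h1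
    exact ⟨by simpa using h1.2.2.1, by simpa using h1.2.2.2 e2⟩
  constructor
  · intro x hx
    refine (hone X hX x hx).1.trans ?_
    have : 0 ≤ x ^ (-(1 / 4) : ℝ) := Real.rpow_nonneg (by linarith [hx.1]) _
    refine mul_le_mul_of_nonneg_right ?_ this
    nlinarith
  · intro X' hX'
    have hX0 : 0 < X := by linarith
    obtain ⟨e1, e2⟩ := ratio_wkbApprox Q θ R lam X
    have h1 := hone X' (hX.trans hX') X ⟨hX, hX'⟩
    have hsub := fun r => ratio_solOf_sub Q θ R lam (wkbVal Q θ R lam X') (wkbSlope Q θ R lam X')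
      (wkbVal Q θ R lam X) (wkbSlope Q θ R lam X) r
    -- The difference of the two approximants is itself a solution. At X its ratio is at most
    -- 4K₁X^(-1/4), and the rate 3/2 for the derivative, tested against the weight 5/4, gives
    -- K₁X^(-1/4); four times this brings the total to 8K₁X^(-1/4), which is carried back to T.
    have h2 := hback (solOf Q lam (wkbVal Q θ R lam X' - wkbVal Q θ R lam X)
        (wkbSlope Q θ R lam X' - wkbSlope Q θ R lam X)) (isSolution_solOf _ _ _ _) X hX
        (8 * K₁ * X ^ (-(1 / 4) : ℝ)) (by
          rw [(hsub X).1, (hsub X).2]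
          change ‖ratio Q θ R lam (wkbApprox Q θ R lam X') X -
              ratio Q θ R lam (wkbApprox Q θ R lam X) X‖ +
            4 * (X ^ (5 / 4 : ℝ) * ‖ratioDeriv Q θ R lam (wkbApprox Q θ R lam X') X -
              ratioDeriv Q θ R lam (wkbApprox Q θ R lam X) X‖) ≤ _
          rw [e1, e2, sub_zero]
          have h3 : X ^ (5 / 4 : ℝ) * ‖ratioDeriv Q θ R lam (wkbApprox Q θ R lam X') X‖ ≤
              K₁ * X ^ (-(1 / 4) : ℝ) := by
            have e : X ^ (5 / 4 : ℝ) = X ^ (-(1 / 4) : ℝ) * X ^ (3 / 2 : ℝ) := by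
              rw [← Real.rpow_add hX0]; norm_num
            rw [e, mul_assoc, mul_comm K₁]
            gcongr
            exact h1.2
          linarith [h1.1]) T ⟨le_rfl, hX⟩
    rw [(hsub T).1, (hsub T).2] at h2
    have hXp : 0 ≤ X ^ (-(1 / 4) : ℝ) := Real.rpow_nonneg hX0.le _
    constructor
    · refine h2.1.trans ?_
      rw [← mul_assoc]
      refine mul_le_mul_of_nonneg_right ?_ hXp
      nlinarith
    · have h4 : ‖ratioDeriv Q θ R lam (solOf Q lam (wkbVal Q θ R lam X') (wkbSlope Q θ R lam X')) T
          - ratioDeriv Q θ R lam (solOf Q lam (wkbVal Q θ R lam X) (wkbSlope Q θ R lam X)) T‖ ≤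
          T ^ (5 / 4 : ℝ) * ‖ratioDeriv Q θ R lam (solOf Q lam (wkbVal Q θ R lam X')
          (wkbSlope Q θ R lam X')) T - ratioDeriv Q θ R lam (solOf Q lam (wkbVal Q θ R lam X)
          (wkbSlope Q θ R lam X)) T‖ :=
        le_mul_of_one_le_left (norm_nonneg _) (Real.one_le_rpow hT1 (by norm_num))
      refine (h4.trans h2.2.1).trans ?_
      rw [← mul_assoc]
      refine mul_le_mul_of_nonneg_right ?_ hXp
      nlinarith

/-- A common factor in the Cauchy estimates for the data at `0`. -/
def dataFactor (Q : ℂ[X]) (θ R T : ℝ) (lam : ℂ) : ℝ :=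
  ‖wkbSol Q θ R lam T‖ * (1 + ‖wkbPhi Q θ lam T‖) *
    (‖entireSolDeriv (Q - C lam) 0 1 (ray θ T)‖ + ‖entireSol (Q - C lam) 0 1 (ray θ T)‖ +
      ‖entireSolDeriv (Q - C lam) 1 0 (ray θ T)‖ + ‖entireSol (Q - C lam) 1 0 (ray θ T)‖)

/-- Value and slope at distance T are recovered from the ratio and its derivative, and the data at 0
depend on them linearly through `data_of_solOf`. This turns Cauchy estimates at the fixed distance T
into Cauchy estimates for the initial data. -/
lemma norm_data_sub_le (Q : ℂ[X]) (θ R T : ℝ) (lam α β : ℂ) {ε : ℝ}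
    (h1 : ‖ratio Q θ R lam (solOf Q lam α β) T‖ ≤ ε)
    (h2 : ‖ratioDeriv Q θ R lam (solOf Q lam α β) T‖ ≤ ε) :
    ‖α‖ ≤ ε * dataFactor Q θ R T lam ∧ ‖β‖ ≤ ε * dataFactor Q θ R T lam := by
  set u := wkbSol Q θ R lam T with hu
  have hu0 : u ≠ 0 := wkbSol_ne_zero _ _ _ _ _
  set φ := wkbPhi Q θ lam T with hφ
  set y := solOf Q lam α β with hy
  have hε : 0 ≤ ε := (norm_nonneg _).trans h1
  have hd := dir_ne_zero θ
  have e1 : y (ray θ T) = ratio Q θ R lam y T * u := by rw [ratio, ← hu]; field_simp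
  have e2 : dir θ * deriv y (ray θ T) = (ratioDeriv Q θ R lam y T + φ * ratio Q θ R lam y T) * u := by
    rw [ratioDeriv, ratio, ← hu, ← hφ]; field_simp; ring
  have n1 : ‖y (ray θ T)‖ ≤ ε * (‖u‖ * (1 + ‖φ‖)) := by
    rw [e1, norm_mul]
    have : ‖u‖ ≤ ‖u‖ * (1 + ‖φ‖) :=
      le_mul_of_one_le_right (norm_nonneg _) (by linarith [norm_nonneg φ])
    gcongr
  have n2 : ‖deriv y (ray θ T)‖ ≤ ε * (‖u‖ * (1 + ‖φ‖)) := by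
    have : ‖deriv y (ray θ T)‖ = ‖dir θ * deriv y (ray θ T)‖ := by rw [norm_mul, norm_dir, one_mul]
    rw [this, e2, norm_mul]
    have : ‖ratioDeriv Q θ R lam y T + φ * ratio Q θ R lam y T‖ ≤ ε * (1 + ‖φ‖) := by
      refine (norm_add_le _ _).trans ?_
      rw [norm_mul]
      have : ‖φ‖ * ‖ratio Q θ R lam y T‖ ≤ ‖φ‖ * ε := by gcongr
      linarith
    calc _ ≤ ε * (1 + ‖φ‖) * ‖u‖ := by gcongr
      _ = _ := by ring
  obtain ⟨d1, d2⟩ := data_of_solOf Q lam α β (ray θ T)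
  set s := ‖entireSol (Q - C lam) 0 1 (ray θ T)‖ with hs
  set s' := ‖entireSolDeriv (Q - C lam) 0 1 (ray θ T)‖ with hs'
  set k := ‖entireSol (Q - C lam) 1 0 (ray θ T)‖ with hk
  set k' := ‖entireSolDeriv (Q - C lam) 1 0 (ray θ T)‖ with hk'
  set G := ‖u‖ * (1 + ‖φ‖) with hG
  have hG0 : 0 ≤ G := by positivity
  have hf : dataFactor Q θ R T lam = G * (s' + s + k' + k) := rfl
  rw [hf]
  have q1 : 0 ≤ ε * G * s := by positivity
  have q2 : 0 ≤ ε * G * s' := by positivity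
  have q3 : 0 ≤ ε * G * k := by positivity
  have q4 : 0 ≤ ε * G * k' := by positivity
  constructor
  · have : ‖α‖ ≤ ε * G * s' + ε * G * s := by
      conv_lhs => rw [d1]
      refine (norm_sub_le _ _).trans ?_
      rw [norm_mul, norm_mul]
      gcongr
    linarith
  · have : ‖β‖ ≤ ε * G * k + ε * G * k' := by
      conv_lhs => rw [d2]
      refine (norm_sub_le _ _).trans ?_
      rw [norm_mul, norm_mul]
      gcongr
    linarith

/-! ### Parameter dependence -/

/-- Dominated convergence, with the constant bound supplied by compactness of the parameter set
times the interval. -/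
lemma continuousOn_intervalIntegral {Y : Type*} [TopologicalSpace Y] [FirstCountableTopology Y]
    {S : Set Y} (hS : IsCompact S) {a b : ℝ} {f : Y → ℝ → ℂ}
    (hf : ContinuousOn (Function.uncurry f) (S ×ˢ Set.uIcc a b)) :
    ContinuousOn (fun p => ∫ s in a..b, f p s) S := by
  obtain ⟨B, hB⟩ := (hS.prod isCompact_uIcc).exists_bound_of_continuousOn hf
  intro p hp
  refine intervalIntegral.continuousWithinAt_of_dominated_interval (bound := fun _ => B) ?_ ?_
    intervalIntegrable_const ?_
  · filter_upwards [self_mem_nhdsWithin] with x hx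
    have : ContinuousOn (f x) (Set.uIcc a b) :=
      hf.comp (f := fun s => (x, s)) (by fun_prop) (fun s hs => ⟨hx, hs⟩)
    exact (this.mono Set.uIoc_subset_uIcc).aestronglyMeasurable measurableSet_uIoc
  · filter_upwards [self_mem_nhdsWithin] with x hx
    exact Eventually.of_forall fun t ht => hB (x, t) ⟨hx, Set.uIoc_subset_uIcc ht⟩
  · refine Eventually.of_forall fun t ht => ?_
    exact (hf (p, t) ⟨hp, Set.uIoc_subset_uIcc ht⟩).comp (f := fun x => (x, t))
      (t := S ×ˢ Set.uIcc a b) (by fun_prop) (fun x hx => ⟨hx, Set.uIoc_subset_uIcc ht⟩)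

/-- A family of polynomials of bounded degree with continuous coefficients. -/
structure PolyFamily {Y : Type*} [TopologicalSpace Y] (Q : Y → ℂ[X]) (S : Set Y) (N : ℕ) :
    Prop where
  natDegree_le : ∀ p ∈ S, (Q p).natDegree ≤ N
  coeff_cont : ∀ j, ContinuousOn (fun p => (Q p).coeff j) S

section Family

variable {Y : Type*} [TopologicalSpace Y] {Q : Y → ℂ[X]} {S : Set Y} {N : ℕ}

lemma PolyFamily.derivative (h : PolyFamily Q S N) :
    PolyFamily (fun p => Polynomial.derivative (Q p)) S N where
  natDegree_le p hp := (natDegree_derivative_le _).trans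
    ((Nat.sub_le _ _).trans (h.natDegree_le p hp))
  coeff_cont j := by
    simp only [coeff_derivative]
    exact (h.coeff_cont _).mul continuousOn_const

lemma PolyFamily.continuousOn_eval (h : PolyFamily Q S N) :
    ContinuousOn (fun x : Y × ℂ => (Q x.1).eval x.2) (S ×ˢ Set.univ) := by
  have : ContinuousOn (fun x : Y × ℂ => ∑ j ∈ Finset.range (N + 1), (Q x.1).coeff j * x.2 ^ j)
      (S ×ˢ Set.univ) := by
    refine continuousOn_finsetSum _ fun j _ => ?_
    exact ((h.coeff_cont j).comp continuousOn_fst fun x hx => hx.1).mul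
      (continuousOn_snd.pow j)
  refine this.congr fun x hx => ?_
  exact eval_eq_sum_range' (Nat.lt_succ_of_le (h.natDegree_le x.1 hx.1)) _

lemma PolyFamily.continuousOn_eval_ray (h : PolyFamily Q S N) (θ : ℝ) :
    ContinuousOn (fun x : Y × ℝ => (Q x.1).eval (ray θ x.2)) (S ×ˢ Set.univ) :=
  h.continuousOn_eval.comp (f := fun x : Y × ℝ => (x.1, ray θ x.2))
    (continuousOn_fst.prodMk ((continuous_ray θ).comp_continuousOn continuousOn_snd))
    (fun _ hx => ⟨hx.1, trivial⟩)

lemma PolyFamily.continuousOn_rayPot (h : PolyFamily Q S N) (θ : ℝ) :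
    ContinuousOn (fun x : Y × ℝ => rayPot (Q x.1) θ x.2) (S ×ˢ Set.univ) :=
  continuousOn_const.mul (h.continuousOn_eval_ray θ)

lemma continuousOn_csqrt : ContinuousOn csqrt Complex.slitPlane := fun _ hw =>
  (hasDerivAt_csqrt hw).continuousAt.continuousWithinAt

variable {θ c C R : ℝ}

lemma PolyFamily.continuousOn_raySqrt (h : PolyFamily Q S N)
    (hg : ∀ p ∈ S, GoodRay (Q p) θ c C R) :
    ContinuousOn (fun x : Y × ℝ => raySqrt (Q x.1) θ x.2) (S ×ˢ Set.Ici R) :=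
  continuousOn_csqrt.comp ((h.continuousOn_rayPot θ).mono (Set.prod_mono_right (Set.subset_univ _)))
    (fun x hx => (hg x.1 hx.1).mem_slitPlane hx.2)

lemma continuousOn_slice {f : Y × ℝ → ℂ} {t : Set ℝ} (hf : ContinuousOn f (S ×ˢ t)) {r : ℝ}
    (hr : r ∈ t) : ContinuousOn (fun p => f (p, r)) S :=
  hf.comp (f := fun p => (p, r)) (by fun_prop) (fun p hp => ⟨hp, hr⟩)

lemma PolyFamily.continuousOn_wkbPhi (h : PolyFamily Q S N)
    (hg : ∀ p ∈ S, GoodRay (Q p) θ c C R) {X : ℝ} (hX : R ≤ X) :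
    ContinuousOn (fun x : Y × ℂ => wkbPhi (Q x.1) θ x.2 X) (S ×ˢ Set.univ) := by
  have hfst : Set.MapsTo (Prod.fst : Y × ℂ → Y) (S ×ˢ Set.univ) S := fun x hx => hx.1
  have h1 := (continuousOn_slice (h.continuousOn_raySqrt hg) hX).comp continuousOn_fst hfst
  have h2 := (continuousOn_slice (h.continuousOn_rayPot θ) (Set.mem_univ X)).comp
    continuousOn_fst hfst
  have h3 := (continuousOn_slice (h.derivative.continuousOn_eval_ray θ) (Set.mem_univ X)).comp
    continuousOn_fst hfst
  refine (h1.neg.add ((continuousOn_snd.mul continuousOn_const).div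
    (continuousOn_const.mul h1) fun x hx => ?_)).sub ((continuousOn_const.mul h3).div
    (continuousOn_const.mul h2) fun x hx => ?_)
  · exact mul_ne_zero two_ne_zero (csqrt_ne_zero _)
  · exact mul_ne_zero (by norm_num) ((hg x.1 hx.1).rayPot_ne_zero hX)

lemma PolyFamily.continuousOn_wkbSol [FirstCountableTopology Y] (hS : IsCompact S)
    (h : PolyFamily Q S N) (hg : ∀ p ∈ S, GoodRay (Q p) θ c C R) {X : ℝ} (hX : R ≤ X) :
    ContinuousOn (fun x : Y × ℂ => wkbSol (Q x.1) θ R x.2 X) (S ×ˢ Set.univ) := by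
  have hfst : Set.MapsTo (Prod.fst : Y × ℂ → Y) (S ×ˢ Set.univ) S := fun x hx => hx.1
  have hsub : S ×ˢ Set.uIcc R X ⊆ S ×ˢ Set.Ici R := by
    rw [Set.uIcc_of_le hX]
    exact Set.prod_mono_right Set.Icc_subset_Ici_self
  have h1 := (continuousOn_intervalIntegral hS (f := fun p s => raySqrt (Q p) θ s)
    ((h.continuousOn_raySqrt hg).mono hsub)).comp continuousOn_fst hfst
  have h2 := (continuousOn_intervalIntegral hS (f := fun p s => (raySqrt (Q p) θ s)⁻¹)
    (((h.continuousOn_raySqrt hg).inv₀ fun x _ => csqrt_ne_zero _).mono hsub)).comp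
      continuousOn_fst hfst
  have h3 := ((continuousOn_slice (h.continuousOn_rayPot θ) (Set.mem_univ X)).clog
    fun p hp => (hg p hp).mem_slitPlane hX).comp continuousOn_fst hfst
  exact (((h3.div_const 4).neg.sub h1).add
    (((continuousOn_snd.mul continuousOn_const).div_const 2).mul h2)).cexp

lemma coeff_sub_C (P : ℂ[X]) (lam : ℂ) (j : ℕ) :
    (P - Polynomial.C lam).coeff j = P.coeff j - if j = 0 then lam else 0 := by
  rw [coeff_sub, coeff_C]

lemma PolyFamily.exists_coeff_bound (hS : IsCompact S) (h : PolyFamily Q S N) :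
    ∃ B : ℝ, ∀ p ∈ S, ∀ j, ‖(Q p).coeff j‖ ≤ B := by
  choose B hB using fun j => hS.exists_bound_of_continuousOn (h.coeff_cont j)
  refine ⟨∑ j ∈ Finset.range (N + 1), |B j|, fun p hp j => ?_⟩
  by_cases hj : j < N + 1
  · exact ((hB j p hp).trans (le_abs_self _)).trans
      (Finset.single_le_sum (f := fun j => |B j|) (fun i _ => abs_nonneg _) (by simpa using hj))
  · rw [coeff_eq_zero_of_natDegree_lt (by have := h.natDegree_le p hp; omega), norm_zero]
    exact Finset.sum_nonneg fun i _ => abs_nonneg _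

lemma norm_coeff_sub_C_le {P : ℂ[X]} {B M : ℝ} (hB : ∀ j, ‖P.coeff j‖ ≤ B) {lam : ℂ}
    (hlam : ‖lam‖ ≤ M) (j : ℕ) : ‖(P - Polynomial.C lam).coeff j‖ ≤ B + M := by
  rw [coeff_sub_C]
  refine (norm_sub_le _ _).trans (add_le_add (hB j) ?_)
  split_ifs
  · exact hlam
  · simpa using (norm_nonneg _).trans hlam

lemma PolyFamily.continuousOn_entireSol (hS : IsCompact S) (h : PolyFamily Q S N) (M : ℝ)
    (y0 y1 z : ℂ) :
    ContinuousOn (fun x : Y × ℂ => entireSol (Q x.1 - Polynomial.C x.2) y0 y1 z)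
        (S ×ˢ Metric.closedBall 0 M) ∧
      ContinuousOn (fun x : Y × ℂ => entireSolDeriv (Q x.1 - Polynomial.C x.2) y0 y1 z)
        (S ×ˢ Metric.closedBall 0 M) := by
  obtain ⟨B, hB⟩ := h.exists_coeff_bound hS
  refine SchroedingerRays.continuousOn_entireSol (N := N) (B := B + M) (fun j => ?_)
    (fun x hx => ?_) (fun x hx => ?_) y0 y1 z
  · simp only [coeff_sub_C]
    refine ((h.coeff_cont j).comp continuousOn_fst fun x hx => hx.1).sub ?_
    split_ifs
    · exact continuousOn_snd
    · exact continuousOn_const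
  · rw [natDegree_sub_C]; exact h.natDegree_le x.1 hx.1
  · exact norm_coeff_sub_C_le (hB x.1 hx.1) (by simpa using hx.2)

lemma differentiable_entireSol_param (P : ℂ[X]) (y0 y1 z : ℂ) :
    Differentiable ℂ (fun lam => entireSol (P - Polynomial.C lam) y0 y1 z) ∧
      Differentiable ℂ (fun lam => entireSolDeriv (P - Polynomial.C lam) y0 y1 z) := by
  obtain ⟨B, hB⟩ := SchroedingerRays.exists_coeff_bound P
  have key : ∀ M : ℝ, DifferentiableOn ℂ (fun lam => entireSol (P - Polynomial.C lam) y0 y1 z)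
      (Metric.ball 0 M) ∧ DifferentiableOn ℂ
        (fun lam => entireSolDeriv (P - Polynomial.C lam) y0 y1 z) (Metric.ball 0 M) := fun M => by
    refine differentiableOn_entireSol Metric.isOpen_ball (N := P.natDegree) (B := B + M)
      (fun j => ?_) (fun x _ => (natDegree_sub_C).le) (fun x hx j => ?_) y0 y1 z
    · simp only [coeff_sub_C]
      split_ifs <;> fun_prop
    · exact norm_coeff_sub_C_le hB (mem_ball_zero_iff.mp hx).le j
  have hmem : ∀ w : ℂ, Metric.ball (0 : ℂ) (‖w‖ + 1) ∈ 𝓝 w := fun w =>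
    Metric.isOpen_ball.mem_nhds (by simp)
  exact ⟨fun w => (key (‖w‖ + 1)).1.differentiableAt (hmem w),
    fun w => (key (‖w‖ + 1)).2.differentiableAt (hmem w)⟩

lemma PolyFamily.continuousOn_data [FirstCountableTopology Y] (hS : IsCompact S)
    (h : PolyFamily Q S N) (hg : ∀ p ∈ S, GoodRay (Q p) θ c C R) {X : ℝ} (hX : R ≤ X) (M : ℝ) :
    ContinuousOn (fun x : Y × ℂ => wkbVal (Q x.1) θ R x.2 X) (S ×ˢ Metric.closedBall 0 M) ∧
    ContinuousOn (fun x : Y × ℂ => wkbSlope (Q x.1) θ R x.2 X) (S ×ˢ Metric.closedBall 0 M) ∧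
    ContinuousOn (fun x : Y × ℂ => dataFactor (Q x.1) θ R X x.2)
      (S ×ˢ Metric.closedBall 0 M) := by
  have hsub : S ×ˢ Metric.closedBall (0 : ℂ) M ⊆ S ×ˢ Set.univ :=
    Set.prod_mono_right (Set.subset_univ _)
  have h1 := (h.continuousOn_wkbSol hS hg hX).mono hsub
  have h2 := (h.continuousOn_wkbPhi hg hX).mono hsub
  obtain ⟨h3, h4⟩ := h.continuousOn_entireSol hS M 0 1 (ray θ X)
  obtain ⟨h5, h6⟩ := h.continuousOn_entireSol hS M 1 0 (ray θ X)
  exact ⟨(h1.mul h4).sub (((h2.mul h1).div_const _).mul h3),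
    (((h2.mul h1).div_const _).mul h5).sub (h1.mul h6),
    (h1.norm.mul (continuousOn_const.add h2.norm)).mul
      (((h4.norm.add h3.norm).add h6.norm).add h5.norm)⟩

lemma differentiable_data (P : ℂ[X]) (θ R X : ℝ) :
    Differentiable ℂ (fun lam => wkbVal P θ R lam X) ∧
      Differentiable ℂ (fun lam => wkbSlope P θ R lam X) := by
  obtain ⟨h3, h4⟩ := differentiable_entireSol_param P 0 1 (ray θ X)
  obtain ⟨h5, h6⟩ := differentiable_entireSol_param P 1 0 (ray θ X)
  have h1 : Differentiable ℂ (fun lam => wkbSol P θ R lam X) := by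
    unfold wkbSol; fun_prop
  have h2 : Differentiable ℂ (fun lam => wkbPhi P θ lam X) := by
    unfold wkbPhi; fun_prop
  unfold wkbVal wkbSlope
  exact ⟨(h1.mul h4).sub (((h2.mul h1).div_const _).mul h3),
    (((h2.mul h1).div_const _).mul h5).sub (h1.mul h6)⟩

/-! ### Passage to the limit -/

/-- Limits of uniform Cauchy sequences of functions continuous in `(p, lam)` and holomorphic in
`lam`. -/
lemma continuousOn_differentiableOn_of_cauchy {F : ℕ → Y → ℂ → ℂ} {f : Y → ℂ → ℂ} {M : ℝ}
    (hcont : ∀ᶠ n in atTop, ContinuousOn (Function.uncurry (F n)) (S ×ˢ Metric.closedBall 0 M))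
    (hdiff : ∀ᶠ n in atTop, ∀ p ∈ S, DifferentiableOn ℂ (F n p) (Metric.ball 0 M)) {ε : ℕ → ℝ}
    (hε : Tendsto ε atTop (𝓝 0))
    (hcauchy : ∀ᶠ n in atTop, ∀ k ≥ n, ∀ p ∈ S, ∀ lam ∈ Metric.closedBall (0 : ℂ) M,
      ‖F k p lam - F n p lam‖ ≤ ε n)
    (hf : ∀ p ∈ S, ∀ lam ∈ Metric.closedBall (0 : ℂ) M,
      Tendsto (fun n => F n p lam) atTop (𝓝 (f p lam))) :
    ContinuousOn (Function.uncurry f) (S ×ˢ Metric.closedBall 0 M) ∧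
      ∀ p ∈ S, DifferentiableOn ℂ (f p) (Metric.ball 0 M) := by
  have hunif : TendstoUniformlyOn (fun n => Function.uncurry (F n)) (Function.uncurry f)
      atTop (S ×ˢ Metric.closedBall 0 M) := by
    rw [Metric.tendstoUniformlyOn_iff]
    intro δ hδ
    filter_upwards [hcauchy, hε.eventually (gt_mem_nhds hδ)] with n hn hn' x hx
    have h1 : Tendsto (fun k => ‖F k x.1 x.2 - F n x.1 x.2‖) atTop
        (𝓝 ‖f x.1 x.2 - F n x.1 x.2‖) := ((hf x.1 hx.1 x.2 hx.2).sub_const _).norm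
    rw [dist_eq_norm]
    refine lt_of_le_of_lt (le_of_tendsto h1 ?_) hn'
    filter_upwards [eventually_ge_atTop n] with k hk
    exact hn k hk x.1 hx.1 x.2 hx.2
  refine ⟨hunif.continuousOn hcont.frequently, fun p hp => ?_⟩
  have h1 : TendstoUniformlyOn (fun n => F n p) (f p) atTop (Metric.ball 0 M) :=
    (hunif.comp (fun l : ℂ => (p, l))).mono fun l hl => ⟨hp, Metric.ball_subset_closedBall hl⟩
  exact h1.tendstoLocallyUniformlyOn.differentiableOn (hdiff.mono fun n hn => hn p hp)
    Metric.isOpen_ball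

lemma exists_tendsto_of_cauchy {x : ℕ → ℂ} {ε : ℕ → ℝ} (hε : Tendsto ε atTop (𝓝 0))
    (h : ∀ᶠ n in atTop, ∀ k ≥ n, ‖x k - x n‖ ≤ ε n) : ∃ l, Tendsto x atTop (𝓝 l) := by
  obtain ⟨n₀, hn₀⟩ := eventually_atTop.mp h
  refine cauchySeq_tendsto_of_complete (Metric.cauchySeq_iff'.mpr fun δ hδ => ?_)
  obtain ⟨n₁, hn₁⟩ := eventually_atTop.mp (hε.eventually (gt_mem_nhds hδ))
  refine ⟨max n₀ n₁, fun k hk => ?_⟩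
  rw [dist_eq_norm]
  exact (hn₀ _ (le_max_left _ _) k hk).trans_lt (hn₁ _ (le_max_right _ _))

/-- Functions that are continuous on all `S × {|lam| ≤ M}` and holomorphic in the discs. -/
lemma continuousOn_differentiable_of_closedBall {f : Y → ℂ → ℂ}
    (h : ∀ M : ℝ, ContinuousOn (Function.uncurry f) (S ×ˢ Metric.closedBall 0 M) ∧
      ∀ p ∈ S, DifferentiableOn ℂ (f p) (Metric.ball 0 M)) :
    ContinuousOn (Function.uncurry f) (S ×ˢ Set.univ) ∧ ∀ p ∈ S, Differentiable ℂ (f p) := by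
  constructor
  · intro x hx
    have hx' : x ∈ S ×ˢ Metric.closedBall (0 : ℂ) (‖x.2‖ + 1) := ⟨hx.1, by simp⟩
    refine ((h (‖x.2‖ + 1)).1 x hx').mono_of_mem_nhdsWithin ?_
    have h2 : Prod.snd ⁻¹' Metric.closedBall (0 : ℂ) (‖x.2‖ + 1) ∈ 𝓝 x :=
      continuousAt_snd.preimage_mem_nhds (mem_of_superset
        (Metric.isOpen_ball.mem_nhds (by simp : x.2 ∈ Metric.ball (0 : ℂ) (‖x.2‖ + 1)))
        Metric.ball_subset_closedBall)
    filter_upwards [self_mem_nhdsWithin, nhdsWithin_le_nhds h2] with y hy hy'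
    exact ⟨hy.1, hy'⟩
  · intro p hp lam
    exact ((h (‖lam‖ + 1)).2 p hp).differentiableAt (Metric.isOpen_ball.mem_nhds (by simp))

lemma exists_entire_limit {F : ℕ → Y → ℂ → ℂ}
    (hcont : ∀ M : ℝ, ∀ᶠ n in atTop, ContinuousOn (Function.uncurry (F n))
      (S ×ˢ Metric.closedBall 0 M))
    (hdiff : ∀ M : ℝ, ∀ᶠ n in atTop, ∀ p ∈ S, DifferentiableOn ℂ (F n p) (Metric.ball 0 M))
    (hcauchy : ∀ M : ℝ, ∃ ε : ℕ → ℝ, Tendsto ε atTop (𝓝 0) ∧ ∀ᶠ n in atTop, ∀ k ≥ n,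
      ∀ p ∈ S, ∀ lam ∈ Metric.closedBall (0 : ℂ) M, ‖F k p lam - F n p lam‖ ≤ ε n) :
    ∃ f : Y → ℂ → ℂ, ContinuousOn (Function.uncurry f) (S ×ˢ Set.univ) ∧
      (∀ p ∈ S, Differentiable ℂ (f p)) ∧
      ∀ p ∈ S, ∀ lam, Tendsto (fun n => F n p lam) atTop (𝓝 (f p lam)) := by
  have hlim : ∀ p ∈ S, ∀ lam, ∃ l, Tendsto (fun n => F n p lam) atTop (𝓝 l) := by
    intro p hp lam
    obtain ⟨ε, hε, h⟩ := hcauchy ‖lam‖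
    exact exists_tendsto_of_cauchy hε (h.mono fun n hn k hk => hn k hk p hp lam (by simp))
  choose! f hf using hlim
  obtain ⟨h1, h2⟩ := continuousOn_differentiable_of_closedBall (f := f) (S := S) fun M => by
    obtain ⟨ε, hε, h⟩ := hcauchy M
    exact continuousOn_differentiableOn_of_cauchy (hcont M) (hdiff M) hε h
      fun p hp lam _ => hf p hp lam
  exact ⟨f, h1, h2, hf⟩

/-- The family of solutions decaying on the ray, normalized by `wkbSol`. -/
theorem exists_decaying_family [FirstCountableTopology Y] (hS : IsCompact S)
    (h : PolyFamily Q S N) (hc : 0 < c) (hC : 0 ≤ C) (hg : ∀ p ∈ S, GoodRay (Q p) θ c C R) :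
    ∃ A B : Y → ℂ → ℂ, ContinuousOn (Function.uncurry A) (S ×ˢ Set.univ) ∧
      ContinuousOn (Function.uncurry B) (S ×ˢ Set.univ) ∧
      (∀ p ∈ S, Differentiable ℂ (A p)) ∧ (∀ p ∈ S, Differentiable ℂ (B p)) ∧
      ∀ M : ℝ, ∃ K T : ℝ, 1 ≤ T ∧ R ≤ T ∧ ∀ p ∈ S, ∀ lam : ℂ, ‖lam‖ ≤ M → ∀ r, T ≤ r →
        ‖ratio (Q p) θ R lam (solOf (Q p) lam (A p lam) (B p lam)) r - 1‖ ≤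
          K * r ^ (-(1 / 4) : ℝ) := by
  have hcauchy : ∀ M : ℝ, ∃ ε : ℕ → ℝ, Tendsto ε atTop (𝓝 0) ∧ ∀ᶠ n : ℕ in atTop, ∀ k : ℕ, k ≥ n →
      ∀ p ∈ S, ∀ lam ∈ Metric.closedBall (0 : ℂ) M,
        ‖wkbVal (Q p) θ R lam k - wkbVal (Q p) θ R lam n‖ ≤ ε n ∧
        ‖wkbSlope (Q p) θ R lam k - wkbSlope (Q p) θ R lam n‖ ≤ ε n := by
    intro M
    obtain ⟨K, T, hK, hT1, hTR, hb⟩ := exists_wkbApprox_bounds (R := R) hc hC M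
    -- The transfer factor from distance T to the origin is continuous, hence bounded on the compact
    -- set of parameters; this makes the Cauchy estimate uniform.
    obtain ⟨G, hG⟩ := (hS.prod (isCompact_closedBall (0 : ℂ) M)).exists_bound_of_continuousOn
      (h.continuousOn_data hS hg hTR M).2.2
    refine ⟨fun n => K * (n : ℝ) ^ (-(1 / 4) : ℝ) * G, ?_, ?_⟩
    · have := (tendsto_rpow_neg_atTop (by norm_num : (0 : ℝ) < 1 / 4)).comp
        (tendsto_natCast_atTop_atTop (R := ℝ))
      simpa using (this.const_mul K).mul_const G
    · filter_upwards [tendsto_natCast_atTop_atTop.eventually_ge_atTop T] with n hn k hk p hp lam hlam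
      have hb' := (hb (Q p) θ (hg p hp) lam (by simpa using hlam) n hn).2 k (by exact_mod_cast hk)
      have e := ratio_solOf_sub (Q p) θ R lam (wkbVal (Q p) θ R lam k) (wkbSlope (Q p) θ R lam k)
        (wkbVal (Q p) θ R lam n) (wkbSlope (Q p) θ R lam n) T
      have hd := norm_data_sub_le (ε := K * (n : ℝ) ^ (-(1 / 4) : ℝ)) (Q p) θ R T lam (wkbVal (Q p) θ R lam k - wkbVal (Q p) θ R lam n)
        (wkbSlope (Q p) θ R lam k - wkbSlope (Q p) θ R lam n)
        (by rw [e.1]; exact hb'.1) (by rw [e.2]; exact hb'.2)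
      have hGx := (Real.le_norm_self _).trans (hG (p, lam) ⟨hp, hlam⟩)
      have hn0 : 0 ≤ K * (n : ℝ) ^ (-(1 / 4) : ℝ) := by positivity
      exact ⟨hd.1.trans (mul_le_mul_of_nonneg_left hGx hn0),
        hd.2.trans (mul_le_mul_of_nonneg_left hGx hn0)⟩
  have hev : ∀ᶠ n : ℕ in atTop, R ≤ (n : ℝ) := tendsto_natCast_atTop_atTop.eventually_ge_atTop R
  obtain ⟨A, hA1, hA2, hA3⟩ := exists_entire_limit (S := S)
    (F := fun (n : ℕ) p lam => wkbVal (Q p) θ R lam n)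
    (fun M => hev.mono fun n hn => (h.continuousOn_data hS hg hn M).1)
    (fun M => Eventually.of_forall fun n p _ => (differentiable_data (Q p) θ R n).1.differentiableOn)
    (fun M => by
      obtain ⟨ε, hε, he⟩ := hcauchy M
      exact ⟨ε, hε, he.mono fun n hn k hk p hp lam hl => (hn k hk p hp lam hl).1⟩)
  obtain ⟨B, hB1, hB2, hB3⟩ := exists_entire_limit (S := S)
    (F := fun (n : ℕ) p lam => wkbSlope (Q p) θ R lam n)
    (fun M => hev.mono fun n hn => (h.continuousOn_data hS hg hn M).2.1)
    (fun M => Eventually.of_forall fun n p _ => (differentiable_data (Q p) θ R n).2.differentiableOn)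
    (fun M => by
      obtain ⟨ε, hε, he⟩ := hcauchy M
      exact ⟨ε, hε, he.mono fun n hn k hk p hp lam hl => (hn k hk p hp lam hl).2⟩)
  refine ⟨A, B, hA1, hB1, hA2, hB2, fun M => ?_⟩
  obtain ⟨K, T, hK, hT1, hTR, hb⟩ := exists_wkbApprox_bounds (R := R) hc hC M
  refine ⟨K, T, hT1, hTR, fun p hp lam hlam r hr => ?_⟩
  -- At fixed r the ratio depends linearly on the data, so the bound for the approximants from
  -- distance n ≥ r passes to the limit.
  have hlim : Tendsto (fun n : ℕ => ‖ratio (Q p) θ R lam (wkbApprox (Q p) θ R lam n) r - 1‖) atTop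
      (𝓝 ‖ratio (Q p) θ R lam (solOf (Q p) lam (A p lam) (B p lam)) r - 1‖) := by
    refine (Tendsto.sub_const (Tendsto.div_const ?_ _) _).norm
    exact ((hA3 p hp lam).mul_const _).add ((hB3 p hp lam).mul_const _)
  refine le_of_tendsto hlim ?_
  filter_upwards [tendsto_natCast_atTop_atTop.eventually_ge_atTop r] with n hn
  exact (hb (Q p) θ (hg p hp) lam hlam n (hr.trans hn)).1 r ⟨hr, hn⟩

end Family

/-! ### Decaying solutions on a good ray -/

/-- `y` tends to zero along the ray of direction `θ`. -/
def DecaysOn (θ : ℝ) (y : ℂ → ℂ) : Prop := Tendsto (fun r : ℝ => y (ray θ r)) atTop (𝓝 0)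

lemma DecaysOn.const_mul {θ : ℝ} {y : ℂ → ℂ} (h : DecaysOn θ y) (k : ℂ) :
    DecaysOn θ (fun z => k * y z) := by
  simpa [DecaysOn] using Tendsto.const_mul k h

lemma decaysOn_congr {θ θ' : ℝ} (h : dir θ = dir θ') {y : ℂ → ℂ} : DecaysOn θ y ↔ DecaysOn θ' y := by
  simp only [DecaysOn, ray, h]

/-- Since (|u|²)' = 2 Re φ·|u|², the product |u|²·exp(2G) decreases whenever G' ≤ -Re φ. The
function G is left free: a linear one suffices for uniqueness, while the sharp power is needed for
rotating rays. -/
lemma norm_wkbSol_le {Q : ℂ[X]} {θ c C R : ℝ} (h : GoodRay Q θ c C R) {lam : ℂ} {T : ℝ} (hT : R ≤ T)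
    {G g : ℝ → ℝ} (hG : ∀ r, T ≤ r → HasDerivAt G (g r) r)
    (hg : ∀ r, T ≤ r → (wkbPhi Q θ lam r).re ≤ -g r) {r : ℝ} (hr : T ≤ r) :
    ‖wkbSol Q θ R lam r‖ ≤ ‖wkbSol Q θ R lam T‖ * Real.exp (G T) * Real.exp (-G r) := by
  set u := wkbSol Q θ R lam
  have hd : ∀ r, T ≤ r → HasDerivAt (fun r => ‖u r‖ ^ 2 * Real.exp (2 * G r)) _ r := fun r hr =>
    (hasDerivAt_norm_sq (h.hasDerivAt_wkbSol lam (hT.trans hr))).mul ((hG r hr).const_mul 2).exp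
  have hanti : AntitoneOn (fun r => ‖u r‖ ^ 2 * Real.exp (2 * G r)) (Set.Ici T) := by
    refine antitoneOn_of_deriv_nonpos (convex_Ici T)
      (fun r hr => (hd r hr).continuousAt.continuousWithinAt)
      (fun r hr => (hd r (interior_subset hr)).differentiableAt.differentiableWithinAt) ?_
    intro r hr
    have hr' : T ≤ r := interior_subset hr
    rw [(hd r hr').deriv]
    have e : (wkbPhi Q θ lam r * u r * (starRingEnd ℂ) (u r)).re =
        (wkbPhi Q θ lam r).re * ‖u r‖ ^ 2 := by
      rw [mul_assoc, Complex.mul_conj, Complex.normSq_eq_norm_sq, Complex.re_mul_ofReal]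
    change 2 * (wkbPhi Q θ lam r * u r * (starRingEnd ℂ) (u r)).re * Real.exp (2 * G r) +
      ‖u r‖ ^ 2 * (Real.exp (2 * G r) * (2 * g r)) ≤ 0
    rw [e]
    have h1 : 0 ≤ ‖u r‖ ^ 2 * Real.exp (2 * G r) := by positivity
    have h2 := hg r hr'
    nlinarith
  have h1 := hanti (Set.mem_Ici.mpr le_rfl) (Set.mem_Ici.mpr hr) hr
  have h2 : (‖u r‖ * Real.exp (G r)) ^ 2 ≤ (‖u T‖ * Real.exp (G T)) ^ 2 := by
    have e : ∀ x, (‖u x‖ * Real.exp (G x)) ^ 2 = ‖u x‖ ^ 2 * Real.exp (2 * G x) := fun x => by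
      rw [mul_pow, ← Real.exp_nat_mul]; norm_cast
    rw [e, e]; exact h1
  have h3 := (abs_le_of_sq_le_sq' h2 (by positivity)).2
  rw [Real.exp_neg, ← div_eq_mul_inv, le_div_iff₀ (Real.exp_pos _)]
  exact h3

namespace GoodRay

variable {Q : ℂ[X]} {θ c C R : ℝ}

/-- The family theorem over a one-point parameter space. -/
lemma exists_ratio_tendsto_one (h : GoodRay Q θ c C R) (lam : ℂ) :
    ∃ y, IsSolution Q lam y ∧ Tendsto (ratio Q θ R lam y) atTop (𝓝 1) := by
  obtain ⟨A, B, -, -, -, -, hAB⟩ := exists_decaying_family (Y := Unit) (S := Set.univ)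
    (Q := fun _ => Q) (N := Q.natDegree) isCompact_univ
    ⟨fun _ _ => le_rfl, fun _ => continuousOn_const⟩ h.hc h.hC (fun _ _ => h)
  obtain ⟨K, T, -, -, hT⟩ := hAB ‖lam‖
  refine ⟨solOf Q lam (A () lam) (B () lam), isSolution_solOf _ _ _ _, ?_⟩
  rw [tendsto_iff_norm_sub_tendsto_zero]
  have h0 : Tendsto (fun r : ℝ => K * r ^ (-(1 / 4) : ℝ)) atTop (𝓝 0) := by
    simpa using (tendsto_rpow_neg_atTop (by norm_num : (0 : ℝ) < 1 / 4)).const_mul K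
  refine squeeze_zero' (Eventually.of_forall fun _ => norm_nonneg _) ?_ h0
  filter_upwards [eventually_ge_atTop T] with r hr
  exact hT () trivial lam le_rfl r hr

/-- Bound by an exponential for the normalized decaying solution. -/
lemma exists_norm_le (h : GoodRay Q θ c C R) {lam : ℂ} {y : ℂ → ℂ}
    (hlim : Tendsto (ratio Q θ R lam y) atTop (𝓝 1)) {G g : ℝ → ℝ} {T₀ : ℝ}
    (hG : ∀ r, T₀ ≤ r → HasDerivAt G (g r) r)
    (hg : ∀ r, T₀ ≤ r → g r ≤ √(c / 2) / 2 * ‖raySqrt Q θ r‖) :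
    ∃ K T, 0 ≤ K ∧ ∀ r, T ≤ r → ‖y (ray θ r)‖ ≤ K * Real.exp (-G r) := by
  obtain ⟨_, T₁, _, _, hT₁R, hb⟩ := exists_wkb_bounds (R := R) h.hc h.hC ‖lam‖
  have hev : ∀ᶠ r in atTop, ‖ratio Q θ R lam y r‖ ≤ 2 := by
    have := hlim.norm
    rw [norm_one] at this
    exact (this.eventually (gt_mem_nhds one_lt_two)).mono fun _ => le_of_lt
  obtain ⟨T₂, hT₂⟩ := eventually_atTop.mp hev
  set T := max (max T₀ T₁) T₂
  have hT0 : T₀ ≤ T := (le_max_left _ _).trans (le_max_left _ _)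
  have hT1 : T₁ ≤ T := (le_max_right _ _).trans (le_max_left _ _)
  refine ⟨2 * (‖wkbSol Q θ R lam T‖ * Real.exp (G T)), T, by positivity, fun r hr => ?_⟩
  have h1 := norm_wkbSol_le (lam := lam) h (hT₁R.trans hT1) (fun r hr => hG r (hT0.trans hr))
    (fun r hr => (hb Q θ h lam le_rfl r (hT1.trans hr)).1.trans
      (neg_le_neg (hg r (hT0.trans hr)))) hr
  have e : y (ray θ r) = ratio Q θ R lam y r * wkbSol Q θ R lam r := by
    rw [ratio, div_mul_cancel₀ _ (wkbSol_ne_zero _ _ _ _ _)]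
  rw [e, norm_mul]
  calc _ ≤ 2 * (‖wkbSol Q θ R lam T‖ * Real.exp (G T) * Real.exp (-G r)) := by
        gcongr
        exact hT₂ r ((le_max_right _ _).trans hr)
    _ = _ := by ring

lemma exists_norm_le_exp (h : GoodRay Q θ c C R) {lam : ℂ} {y : ℂ → ℂ}
    (hlim : Tendsto (ratio Q θ R lam y) atTop (𝓝 1)) :
    ∃ κ K T, 0 < κ ∧ 0 ≤ K ∧ ∀ r, T ≤ r → ‖y (ray θ r)‖ ≤ K * Real.exp (-(κ * r)) := by
  have hk : 0 < √(c / 2) := Real.sqrt_pos.mpr (by have := h.hc; positivity)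
  have hk' : 0 < √c := Real.sqrt_pos.mpr h.hc
  obtain ⟨K, T, hK, hT⟩ := h.exists_norm_le hlim (G := fun r => √(c / 2) / 2 * √c * r)
    (g := fun _ => √(c / 2) / 2 * √c) (T₀ := R)
    (fun r _ => by simpa using (hasDerivAt_id r).const_mul (√(c / 2) / 2 * √c)) (fun r hr => by
      gcongr
      refine le_trans ?_ (norm_raySqrt_ge h hr)
      exact le_mul_of_one_le_right hk'.le (Real.one_le_sqrt.mpr (h.hR.trans hr)))
  exact ⟨_, K, T, by positivity, hK, hT⟩

lemma decaysOn_of_ratio (h : GoodRay Q θ c C R) {lam : ℂ} {y : ℂ → ℂ}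
    (hlim : Tendsto (ratio Q θ R lam y) atTop (𝓝 1)) : DecaysOn θ y := by
  obtain ⟨κ, K, T, hκ, -, hT⟩ := h.exists_norm_le_exp hlim
  rw [DecaysOn, tendsto_zero_iff_norm_tendsto_zero]
  have h0 : Tendsto (fun r : ℝ => K * Real.exp (-(κ * r))) atTop (𝓝 0) := by
    have := (Real.tendsto_exp_neg_atTop_nhds_zero.comp
      (tendsto_id.const_mul_atTop hκ)).const_mul K
    simpa using this
  refine squeeze_zero' (Eventually.of_forall fun _ => norm_nonneg _) ?_ h0
  filter_upwards [eventually_ge_atTop T] with r hr using hT r hr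

end GoodRay

lemma ne_zero_of_ratio {Q : ℂ[X]} {θ R : ℝ} {lam : ℂ} {y : ℂ → ℂ}
    (hlim : Tendsto (ratio Q θ R lam y) atTop (𝓝 1)) : y ≠ 0 := by
  rintro rfl
  have : Tendsto (fun _ : ℝ => (0 : ℂ)) atTop (𝓝 1) := by
    refine hlim.congr fun r => ?_
    simp [ratio]
  exact zero_ne_one (tendsto_nhds_unique tendsto_const_nhds this)

/-- A bound for a solution on a ray that decreases with `r` gives one for the derivative, with
loss of a power of `r`. -/
lemma norm_deriv_ray_le {Q : ℂ[X]} {lam : ℂ} {n : ℕ} {B : ℝ} (hB0 : 0 ≤ B)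
    (hB : ∀ z, ‖Q.eval z - lam‖ ≤ B * (1 + ‖z‖) ^ n) {y : ℂ → ℂ} (hy : IsSolution Q lam y)
    {θ T : ℝ} (hT : 0 ≤ T) {b : ℝ → ℝ} (hb : AntitoneOn b (Set.Ici T))
    (hyb : ∀ r, T ≤ r → ‖y (ray θ r)‖ ≤ b r) {r : ℝ} (hr : T ≤ r) :
    ‖deriv y (ray θ r)‖ ≤ (2 + B) * (2 + r) ^ n * b r := by
  have hr0 : 0 ≤ r := hT.trans hr
  have hbr : 0 ≤ b r := (norm_nonneg _).trans (hyb r hr)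
  have hpow : 1 ≤ (2 + r) ^ n := one_le_pow₀ (by linarith)
  have hle : ∀ s ∈ Set.Icc r (r + 1), ‖y (ray θ s)‖ ≤ b r := fun s hs =>
    (hyb s (hr.trans hs.1)).trans (hb hr (hr.trans hs.1) hs.1)
  have key := norm_deriv_le_of_second_deriv (r := r) (A := B * (2 + r) ^ n * b r)
    (fun s _ => hy.hasDerivAt_ray θ s) (fun s _ => hy.hasDerivAt_deriv_ray θ s) (fun s hs => by
      have hs0 : 0 ≤ s := hr0.trans hs.1
      have e : rayPot Q θ s - lam * dir θ ^ 2 = dir θ ^ 2 * (Q.eval (ray θ s) - lam) := by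
        rw [rayPot]; ring
      rw [norm_mul, e, norm_mul, norm_pow, norm_dir, one_pow, one_mul]
      have h1 := hB (ray θ s)
      rw [norm_ray hs0] at h1
      have h2 : B * (1 + s) ^ n ≤ B * (2 + r) ^ n :=
        mul_le_mul_of_nonneg_left (pow_le_pow_left₀ (by linarith) (by linarith [hs.2]) n) hB0
      exact mul_le_mul (h1.trans h2) (hle s hs) (norm_nonneg _) (by positivity))
  rw [norm_mul, norm_dir, one_mul] at key
  have h1 := hle r ⟨le_rfl, by linarith⟩
  have h2 := hle (r + 1) ⟨by linarith, le_rfl⟩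
  nlinarith

lemma tendsto_pow_mul_exp_neg (A : ℝ) (n : ℕ) {κ : ℝ} (hκ : 0 < κ) :
    Tendsto (fun r : ℝ => A * (2 + r) ^ n * Real.exp (-(κ * r))) atTop (𝓝 0) := by
  have h1 := (tendsto_rpow_mul_exp_neg_mul_atTop_nhds_zero n κ hκ).comp
    (tendsto_atTop_add_const_left atTop (2 : ℝ) tendsto_id)
  have h2 := h1.const_mul (A * Real.exp (2 * κ))
  rw [mul_zero] at h2
  refine h2.congr fun r => ?_
  simp only [Function.comp_apply, id_eq, Real.rpow_natCast]
  have : Real.exp (-(κ * r)) = Real.exp (2 * κ) * Real.exp (-κ * (2 + r)) := by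
    rw [← Real.exp_add]; congr 1; ring
  rw [this]; ring

lemma antitone_exp_neg {K κ : ℝ} (hK : 0 ≤ K) (hκ : 0 < κ) (s : Set ℝ) :
    AntitoneOn (fun r : ℝ => K * Real.exp (-(κ * r))) s := by
  intro a _ b _ hab
  simp only
  gcongr

namespace GoodRay

variable {Q : ℂ[X]} {θ c C R : ℝ}

/-- The decaying solution is unique up to a constant factor. -/
lemma eq_const_mul (h : GoodRay Q θ c C R) {lam : ℂ} {y Y : ℂ → ℂ} (hY : IsSolution Q lam Y)
    (hlim : Tendsto (ratio Q θ R lam Y) atTop (𝓝 1)) (hy : IsSolution Q lam y)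
    (hdec : DecaysOn θ y) : ∃ k : ℂ, y = fun z => k * Y z := by
  refine exists_eq_const_mul_of_wronskian hY hy (ne_zero_of_ratio hlim) ?_
  obtain ⟨B, hB0, hB⟩ := exists_eval_bound Q lam le_rfl
  obtain ⟨κ, K, T, hκ, hK, hT⟩ := h.exists_norm_le_exp hlim
  have hev : ∀ᶠ r in atTop, ‖y (ray θ r)‖ ≤ 1 := by
    have := (tendsto_zero_iff_norm_tendsto_zero.mp hdec).eventually (gt_mem_nhds one_pos)
    exact this.mono fun _ => le_of_lt
  obtain ⟨T', hT'⟩ := eventually_atTop.mp hev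
  set n := Q.natDegree
  set T₁ := max 0 (max T T')
  have hT₁0 : 0 ≤ T₁ := le_max_left _ _
  have hT₁T : T ≤ T₁ := (le_max_left _ _).trans (le_max_right _ _)
  have hT₁T' : T' ≤ T₁ := (le_max_right _ _).trans (le_max_right _ _)
  -- Decay of y enters only as boundedness: then y' grows at most polynomially, and the exponential
  -- decay of Y forces the constant Wronskian to be zero.
  have hbd : ∀ r, T₁ ≤ r → ‖deriv Y 0 * y 0 - Y 0 * deriv y 0‖ ≤
      2 * ((2 + B) * K) * (2 + r) ^ n * Real.exp (-(κ * r)) := by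
    intro r hr
    rw [wronskian_const hY hy 0 (ray θ r)]
    have a1 := norm_deriv_ray_le hB0 hB hY hT₁0 (antitone_exp_neg hK hκ _)
      (fun r hr => hT r (hT₁T.trans hr)) hr
    have a2 := norm_deriv_ray_le hB0 hB hy hT₁0 (b := fun _ => 1) (fun _ _ _ _ _ => le_rfl)
      (fun r hr => hT' r (hT₁T'.trans hr)) hr
    have a3 := hT r (hT₁T.trans hr)
    have a4 := hT' r (hT₁T'.trans hr)
    refine (norm_sub_le _ _).trans ?_
    rw [norm_mul, norm_mul]
    have hr0 : 0 ≤ r := hT₁0.trans hr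
    have b1 : ‖deriv Y (ray θ r)‖ * ‖y (ray θ r)‖ ≤
        (2 + B) * (2 + r) ^ n * (K * Real.exp (-(κ * r))) * 1 := by gcongr
    have b2 : ‖Y (ray θ r)‖ * ‖deriv y (ray θ r)‖ ≤
        K * Real.exp (-(κ * r)) * ((2 + B) * (2 + r) ^ n * 1) := by gcongr
    linarith
  have hle : ‖deriv Y 0 * y 0 - Y 0 * deriv y 0‖ ≤ 0 :=
    ge_of_tendsto (tendsto_pow_mul_exp_neg _ n hκ)
      ((eventually_ge_atTop T₁).mono fun r hr => hbd r hr)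
  simpa using hle

/-- Decay with derivative of a decaying solution. -/
lemma tendsto_mul_deriv (h : GoodRay Q θ c C R) {lam : ℂ} {y : ℂ → ℂ} (hy : IsSolution Q lam y)
    (hdec : DecaysOn θ y) :
    Tendsto (fun r => deriv y (ray θ r) * (starRingEnd ℂ) (y (ray θ r))) atTop (𝓝 0) := by
  obtain ⟨Y, hY, hlim⟩ := h.exists_ratio_tendsto_one lam
  obtain ⟨k, rfl⟩ := h.eq_const_mul hY hlim hy hdec
  obtain ⟨B, hB0, hB⟩ := exists_eval_bound Q lam le_rfl
  obtain ⟨κ, K, T, hκ, hK, hT⟩ := h.exists_norm_le_exp hlim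
  have hbd : ∀ r, max 0 T ≤ r → ‖k * Y (ray θ r)‖ ≤ ‖k‖ * K * Real.exp (-(κ * r)) := fun r hr => by
    rw [norm_mul, mul_assoc]
    gcongr
    exact hT r ((le_max_right _ _).trans hr)
  have hK' : 0 ≤ ‖k‖ * K := by positivity
  have h1 : ∀ r, max 0 T ≤ r → _ := fun r hr => norm_deriv_ray_le hB0 hB hy (le_max_left 0 T)
    (antitone_exp_neg hK' hκ _) hbd hr
  rw [tendsto_zero_iff_norm_tendsto_zero]
  refine squeeze_zero' (Eventually.of_forall fun _ => norm_nonneg _) ?_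
    (tendsto_pow_mul_exp_neg ((2 + B) * (‖k‖ * K) * (‖k‖ * K)) Q.natDegree hκ)
  filter_upwards [eventually_ge_atTop (max 0 T)] with r hr
  rw [norm_mul, RCLike.norm_conj]
  have hr0 : 0 ≤ r := (le_max_left _ _).trans hr
  have e1 : Real.exp (-(κ * r)) ≤ 1 := Real.exp_le_one_iff.mpr (by
    have : 0 ≤ κ * r := by positivity
    linarith)
  calc _ ≤ ((2 + B) * (2 + r) ^ Q.natDegree * (‖k‖ * K * Real.exp (-(κ * r)))) *
        (‖k‖ * K * Real.exp (-(κ * r))) := mul_le_mul (h1 r hr) (hbd r hr) (norm_nonneg _)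
        (by positivity)
    _ ≤ ((2 + B) * (2 + r) ^ Q.natDegree * (‖k‖ * K * Real.exp (-(κ * r)))) *
        (‖k‖ * K * 1) := by gcongr
    _ = _ := by ring

/-- Rate of decay when the potential grows like `r ^ n`. -/
lemma exists_rate (h : GoodRay Q θ c C R) {lam : ℂ} {y : ℂ → ℂ} (hy : IsSolution Q lam y)
    (hdec : DecaysOn θ y) {n : ℕ} {k : ℝ} (hk : 0 ≤ k)
    (hlow : ∀ r, R ≤ r → k * r ^ n ≤ ‖rayPot Q θ r‖) :
    ∃ K, 0 ≤ K ∧ ∀ r, 0 ≤ r → ‖y (ray θ r)‖ ≤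
      K * Real.exp (-(√(c / 2) / 2 * √k / ((n : ℝ) / 2 + 1) * r ^ ((n : ℝ) / 2 + 1))) := by
  set ρ : ℝ := (n : ℝ) / 2 + 1 with hρ
  have hρ0 : 0 < ρ := by positivity
  set c₁ := √(c / 2) / 2 * √k / ρ with hc₁
  obtain ⟨Y, hY, hlim⟩ := h.exists_ratio_tendsto_one lam
  obtain ⟨κ, rfl⟩ := h.eq_const_mul hY hlim hy hdec
  obtain ⟨K, T, hK, hT⟩ := h.exists_norm_le hlim (G := fun r => c₁ * r ^ ρ)
    (g := fun r => √(c / 2) / 2 * (√k * r ^ (ρ - 1))) (T₀ := R) (fun r hr => by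
      have hr0 : r ≠ 0 := by have := h.hR; linarith
      refine ((Real.hasDerivAt_rpow_const (Or.inl hr0)).const_mul c₁).congr_deriv ?_
      rw [hc₁]; field_simp) (fun r hr => by
      have hr0 : 0 ≤ r := by have := h.hR; linarith
      gcongr
      rw [raySqrt, norm_csqrt (h.rayPot_ne_zero hr)]
      refine le_trans (le_of_eq ?_) (Real.sqrt_le_sqrt (hlow r hr))
      rw [Real.sqrt_mul hk]
      congr 1
      rw [Real.sqrt_eq_rpow, ← Real.rpow_natCast, ← Real.rpow_mul hr0, hρ]
      congr 1; ring)
  -- The rate holds from T on; compactness of [0, T] extends it to all r ≥ 0 by enlarging the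
  -- constant, since the Phragmén-Lindelöf argument needs the whole ray.
  have hcont : ContinuousOn (fun r : ℝ => κ * Y (ray θ r) * Real.exp (c₁ * r ^ ρ))
      (Set.Icc 0 T) := by
    have h1 : Continuous fun r : ℝ => κ * Y (ray θ r) :=
      hy.1.continuous.comp (continuous_ray θ)
    have h2 : Continuous fun r : ℝ => r ^ ρ := Real.continuous_rpow_const hρ0.le
    exact (h1.mul (by fun_prop)).continuousOn
  obtain ⟨K', hK'⟩ := isCompact_Icc.exists_bound_of_continuousOn hcont
  refine ⟨max (‖κ‖ * K) |K'|, (abs_nonneg _).trans (le_max_right _ _), fun r hr => ?_⟩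
  rcases le_total T r with hTr | hTr
  · rw [norm_mul]
    calc ‖κ‖ * ‖Y (ray θ r)‖ ≤ ‖κ‖ * (K * Real.exp (-(c₁ * r ^ ρ))) := by
          gcongr
          exact hT r hTr
      _ = ‖κ‖ * K * Real.exp (-(c₁ * r ^ ρ)) := by ring
      _ ≤ _ := by
          gcongr
          exact le_max_left _ _
  · have h1 := hK' r ⟨hr, hTr⟩
    rw [norm_mul, Complex.norm_real, Real.norm_of_nonneg (Real.exp_pos _).le] at h1
    rw [Real.exp_neg, ← div_eq_mul_inv, le_div_iff₀ (Real.exp_pos _)]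
    exact (h1.trans (le_abs_self _)).trans (le_max_right _ _)

end GoodRay

/-! ### Sibuya solutions -/

lemma rayPot_sub_C (Q : ℂ[X]) (lam : ℂ) (θ r : ℝ) :
    rayPot (Q - C lam) θ r = rayPot Q θ r - lam * dir θ ^ 2 := by
  rw [rayPot, rayPot, eval_sub, eval_C]; ring

lemma GoodRay.c_le_two {Q : ℂ[X]} {θ c C R : ℝ} (h : GoodRay Q θ c C R) : c ≤ 2 := by
  have h1 := h.sector R le_rfl
  have h2 := Complex.re_le_norm (rayPot Q θ R)
  have h3 := norm_pos_iff.mpr (h.rayPot_ne_zero le_rfl)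
  nlinarith

/-- The potential shifted by `lam` stays in a sector far out on the ray. -/
lemma GoodRay.sub_C {Q : ℂ[X]} {θ c C R : ℝ} (h : GoodRay Q θ c C R) {M : ℝ} {lam : ℂ}
    (hlam : ‖lam‖ ≤ M) {r : ℝ} (hr : R ≤ r) (hr' : 8 * M / c ^ 2 ≤ r) :
    ‖rayPot Q θ r‖ / 2 ≤ ‖rayPot (Q - Polynomial.C lam) θ r‖ ∧
      c / 2 * ‖rayPot (Q - Polynomial.C lam) θ r‖ ≤
        ‖rayPot (Q - Polynomial.C lam) θ r‖ + (rayPot (Q - Polynomial.C lam) θ r).re := by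
  have hc := h.hc
  have hc2 := h.c_le_two
  rw [rayPot_sub_C]
  set W := rayPot Q θ r with hW
  set μ := lam * dir θ ^ 2 with hμ
  have hμn : ‖μ‖ ≤ M := by rw [hμ, norm_mul, norm_pow, norm_dir]; simpa using hlam
  -- From |W| ≥ cr and r ≥ 8M/c²: the shift is too small a fraction of |W| to leave the sector with
  -- c replaced by c/2.
  have hsmall : ‖μ‖ ≤ c / 8 * ‖W‖ := by
    have h1 := h.lower r hr
    rw [div_le_iff₀ (by positivity)] at hr'
    nlinarith
  have h1 : ‖W‖ - ‖μ‖ ≤ ‖W - μ‖ := norm_sub_norm_le _ _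
  have h2 : ‖W - μ‖ ≤ ‖W‖ + ‖μ‖ := norm_sub_le _ _
  have h3 := h.sector r hr
  have h4 := Complex.re_le_norm μ
  have hW0 := norm_nonneg W
  rw [← hW] at h3
  refine ⟨by nlinarith, ?_⟩
  rw [Complex.sub_re]
  nlinarith

/-- Logarithm of the ratio of the Sibuya asymptotics to `wkbSol`. -/
def sibExp (Q : ℂ[X]) (θ R r₀ : ℝ) (lam : ℂ) (X : ℝ) : ℂ :=
  Complex.log (rayPot Q θ X) / 4 - Complex.log (rayPot (Q - C lam) θ X) / 4 +
    ((∫ s in R..X, raySqrt Q θ s) - lam * dir θ ^ 2 / 2 * (∫ s in R..X, (raySqrt Q θ s)⁻¹)) -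
    ∫ s in r₀..X, raySqrt (Q - C lam) θ s

lemma rayPotDeriv_sub_C (Q : ℂ[X]) (lam : ℂ) (θ r : ℝ) :
    rayPotDeriv (Q - C lam) θ r = rayPotDeriv Q θ r := by
  simp [rayPotDeriv]

section

variable {Q : ℂ[X]} {θ c C R : ℝ}

lemma GoodRay.sub_C_ne_zero (h : GoodRay Q θ c C R) {M : ℝ} {lam : ℂ}
    (hlam : ‖lam‖ ≤ M) {r : ℝ} (hr : R ≤ r) (hr' : 8 * M / c ^ 2 ≤ r) :
    rayPot (Q - Polynomial.C lam) θ r ≠ 0 := by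
  have h1 := (h.sub_C hlam hr hr').1
  have h2 := norm_pos_iff.mpr (h.rayPot_ne_zero hr)
  exact norm_pos_iff.mp (by linarith)

lemma GoodRay.sub_C_mem_slitPlane (h : GoodRay Q θ c C R) {M : ℝ} {lam : ℂ}
    (hlam : ‖lam‖ ≤ M) {r : ℝ} (hr : R ≤ r) (hr' : 8 * M / c ^ 2 ≤ r) :
    rayPot (Q - Polynomial.C lam) θ r ∈ Complex.slitPlane :=
  mem_slitPlane_of_sector (h.sub_C_ne_zero hlam hr hr') (half_pos h.hc) (h.sub_C hlam hr hr').2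

/-- The derivative of `sibExp` has two parts. The difference of the logarithmic derivatives of W and
W - μ is O(t⁻²). The remainder √W - μ/(2√W) - √(W - μ) is of second order in μ and O(t^(-3/2)). Both
decay faster than t^(-5/4). -/
lemma GoodRay.sibExp_sub_le (h : GoodRay Q θ c C R) {M r₀ : ℝ} (hr₀ : R ≤ r₀)
    (hr₀' : 8 * M / c ^ 2 ≤ r₀) {lam : ℂ} (hlam : ‖lam‖ ≤ M) {X X' : ℝ} (hX : r₀ ≤ X)
    (hXX' : X ≤ X') :
    ‖sibExp Q θ R r₀ lam X - sibExp Q θ R r₀ lam X'‖ ≤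
      4 * (M * C / (2 * c) + M ^ 2 / (c * √c ^ 3)) * X ^ (-(1 / 4) : ℝ) := by
  have hc := h.hc
  have hC := h.hC
  have hM : 0 ≤ M := (norm_nonneg _).trans hlam
  have hsc : 0 < √c := Real.sqrt_pos.mpr hc
  have hslit : ∀ s, r₀ ≤ s → rayPot (Q - Polynomial.C lam) θ s ∈ Complex.slitPlane := fun s hs =>
    h.sub_C_mem_slitPlane hlam (hr₀.trans hs) (hr₀'.trans hs)
  refine norm_sub_le_of_deriv_le (w := fun t => rayPotDeriv Q θ t / rayPot Q θ t / 4 -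
    rayPotDeriv (Q - Polynomial.C lam) θ t / rayPot (Q - Polynomial.C lam) θ t / 4 +
    (raySqrt Q θ t - lam * dir θ ^ 2 / 2 * (raySqrt Q θ t)⁻¹) -
    raySqrt (Q - Polynomial.C lam) θ t) (by have := h.hR; linarith) hXX' (by positivity)
    (fun t ht => ?_) (fun t ht => ?_)
  · have hRt : R ≤ t := hr₀.trans (hX.trans ht.1)
    have hr₀t : r₀ ≤ t := hX.trans ht.1
    have h1 := (hasDerivAt_rayPot Q θ t).clog_real (h.mem_slitPlane hRt)
    have h2 := (hasDerivAt_rayPot (Q - Polynomial.C lam) θ t).clog_real (hslit t hr₀t)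
    have h3 := hasDerivAt_integral_ray (fun s hs => h.mem_slitPlane hs)
      (fun s hs => continuousAt_raySqrt hs) hRt
    have h4 := hasDerivAt_integral_ray (f := fun s => (raySqrt Q θ s)⁻¹)
      (fun s hs => h.mem_slitPlane hs)
      (fun s hs => (continuousAt_raySqrt hs).inv₀ (csqrt_ne_zero _)) hRt
    have h5 := hasDerivAt_integral_ray hslit (fun s hs => continuousAt_raySqrt hs) hr₀t
    exact (((h1.div_const 4).sub (h2.div_const 4)).add
      (h3.sub (h4.const_mul (lam * dir θ ^ 2 / 2)))).sub h5
  · have hRt : R ≤ t := hr₀.trans (hX.trans ht.1)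
    have hr₀t : r₀ ≤ t := hX.trans ht.1
    have ht1 : 1 ≤ t := h.hR.trans hRt
    have ht0 : 0 < t := by linarith
    have hW0 := h.rayPot_ne_zero hRt
    have hV0 := h.sub_C_ne_zero hlam hRt (hr₀'.trans hr₀t)
    have hsub := h.sub_C hlam hRt (hr₀'.trans hr₀t)
    have hVW := rayPot_sub_C Q lam θ t
    rw [rayPotDeriv_sub_C]
    set W := rayPot Q θ t with hW
    set V := rayPot (Q - Polynomial.C lam) θ t with hV
    set W1 := rayPotDeriv Q θ t with hW1
    set μ := lam * dir θ ^ 2 with hμ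
    have hμn : ‖μ‖ ≤ M := by rw [hμ, norm_mul, norm_pow, norm_dir]; simpa using hlam
    set a := raySqrt Q θ t with ha
    set b := raySqrt (Q - Polynomial.C lam) θ t with hb
    have ha2 : a ^ 2 = W := csqrt_sq hW0
    have hb2 : b ^ 2 = V := csqrt_sq hV0
    have ha0 : a ≠ 0 := csqrt_ne_zero _
    have hare : √(c / 2) * ‖a‖ ≤ a.re := csqrt_re_ge hW0 hc.le (h.sector t hRt)
    have hbre : 0 ≤ b.re := csqrt_re_nonneg _
    have hage : √c * √t ≤ ‖a‖ := norm_raySqrt_ge h hRt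
    have hapos : 0 < ‖a‖ := norm_pos_iff.mpr ha0
    have hk : 0 < √(c / 2) := Real.sqrt_pos.mpr (by positivity)
    have hk2 : √(c / 2) ^ 2 = c / 2 := Real.sq_sqrt (by positivity)
    -- No cancellation in a + b: both principal roots have nonnegative real part, and that of a is
    -- comparable with |a|. This controls the denominator of the exact formula μ²/(2a(a + b)²) for
    -- the remainder.
    have hab : √(c / 2) * ‖a‖ ≤ ‖a + b‖ := by
      refine le_trans ?_ (Complex.re_le_norm _)
      rw [Complex.add_re]; linarith
    have habpos : 0 < ‖a + b‖ := lt_of_lt_of_le (by positivity) hab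
    have hab0 : a + b ≠ 0 := norm_pos_iff.mp habpos
    have hμab : μ = (a - b) * (a + b) := by
      have : μ = W - V := by rw [hVW]; ring
      rw [this, ← ha2, ← hb2]; ring
    have e1 : a - μ / 2 * a⁻¹ - b = μ ^ 2 / (2 * a * (a + b) ^ 2) := by
      rw [hμab]; field_simp; ring
    have e2 : W1 / W / 4 - W1 / V / 4 = -(W1 / W * (μ / (4 * V))) := by
      have : μ = W - V := by rw [hVW]; ring
      rw [this]; field_simp; ring
    have n1 : ‖a - μ / 2 * a⁻¹ - b‖ ≤ M ^ 2 / (c * √c ^ 3 * √t ^ 3) := by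
      rw [e1, norm_div, norm_mul, norm_mul 2 a, norm_pow, norm_pow, Complex.norm_ofNat]
      apply div_le_div₀ (by positivity) (by gcongr) (by positivity)
      calc c * √c ^ 3 * √t ^ 3 = c * (√c * √t) ^ 3 := by ring
        _ ≤ c * ‖a‖ ^ 3 := by gcongr
        _ = 2 * ‖a‖ * (√(c / 2) * ‖a‖) ^ 2 := by rw [mul_pow, hk2]; ring
        _ ≤ 2 * ‖a‖ * ‖a + b‖ ^ 2 := by gcongr
    have n2 : ‖W1 / W / 4 - W1 / V / 4‖ ≤ M * C / (2 * c) / t ^ 2 := by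
      have hWpos := norm_pos_iff.mpr hW0
      have hVge : c * t / 2 ≤ ‖V‖ := by
        have := h.lower t hRt
        linarith [hsub.1]
      have hW1r : ‖W1‖ / ‖W‖ ≤ C / t := by
        rw [div_le_div_iff₀ hWpos ht0, hW1, rayPotDeriv, norm_mul, norm_pow, norm_dir, hW,
          norm_rayPot]
        have := h.deriv_le t hRt
        linarith
      rw [e2, norm_neg, norm_mul, norm_div, norm_div, norm_mul 4 V, Complex.norm_ofNat]
      calc ‖W1‖ / ‖W‖ * (‖μ‖ / (4 * ‖V‖)) ≤ C / t * (M / (4 * (c * t / 2))) := by gcongr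
        _ = M * C / (2 * c) / t ^ 2 := by field_simp; ring
    have hsplit : W1 / W / 4 - W1 / V / 4 + (a - μ / 2 * a⁻¹) - b =
        (W1 / W / 4 - W1 / V / 4) + (a - μ / 2 * a⁻¹ - b) := by ring
    rw [hsplit]
    have p1 : t ^ (5 / 4 : ℝ) ≤ t ^ 2 := by
      rw [← Real.rpow_natCast t 2]
      exact Real.rpow_le_rpow_of_exponent_le ht1 (by norm_num)
    have p2 : t ^ (5 / 4 : ℝ) ≤ √t ^ 3 := by
      rw [Real.sqrt_eq_rpow, ← Real.rpow_natCast, ← Real.rpow_mul ht0.le]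
      exact Real.rpow_le_rpow_of_exponent_le ht1 (by norm_num)
    have hst : 0 < √t := Real.sqrt_pos.mpr ht0
    calc t ^ (5 / 4 : ℝ) * ‖(W1 / W / 4 - W1 / V / 4) + (a - μ / 2 * a⁻¹ - b)‖
        ≤ t ^ (5 / 4 : ℝ) * (M * C / (2 * c) / t ^ 2 + M ^ 2 / (c * √c ^ 3 * √t ^ 3)) := by
          gcongr
          exact (norm_add_le _ _).trans (add_le_add n2 n1)
      _ = t ^ (5 / 4 : ℝ) * (M * C / (2 * c) / t ^ 2) +
          t ^ (5 / 4 : ℝ) * (M ^ 2 / (c * √c ^ 3 * √t ^ 3)) := mul_add _ _ _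
      _ ≤ t ^ 2 * (M * C / (2 * c) / t ^ 2) + √t ^ 3 * (M ^ 2 / (c * √c ^ 3 * √t ^ 3)) := by
          gcongr
      _ = _ := by field_simp

lemma dir_half_sq (θ : ℝ) : dir (θ / 2) ^ 2 = dir θ := by
  rw [dir, dir, ← Complex.exp_nat_mul]
  congr 1
  push_cast; ring

/-- A suitable multiple of the normalized decaying solution is a Sibuya solution. -/
lemma GoodRay.isSibuyaSolution (h : GoodRay Q θ c C R) {M r₀ : ℝ} (hr₀ : R ≤ r₀)
    (hr₀' : 8 * M / c ^ 2 ≤ r₀) {lam L : ℂ} (hlam : ‖lam‖ ≤ M)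
    (hL : Tendsto (sibExp Q θ R r₀ lam) atTop (𝓝 L)) {y : ℂ → ℂ} (hy : IsSolution Q lam y)
    (hlim : Tendsto (ratio Q θ R lam y) atTop (𝓝 1)) :
    IsSibuyaSolution (Q - Polynomial.C lam) θ r₀
      (fun z => dir (θ / 2) * Complex.exp L * y z) := by
  have hd0 : dir (θ / 2) ≠ 0 := dir_ne_zero _
  have hd2 := dir_half_sq θ
  set P := Q - Polynomial.C lam with hP
  have hne : ∀ s, r₀ ≤ s → rayPot P θ s ≠ 0 := fun s hs =>
    h.sub_C_ne_zero hlam (hr₀.trans hs) (hr₀'.trans hs)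
  have hslit : ∀ s, r₀ ≤ s → rayPot P θ s ∈ Complex.slitPlane := fun s hs =>
    h.sub_C_mem_slitPlane hlam (hr₀.trans hs) (hr₀'.trans hs)
  have hlog : ContinuousOn (fun r => Complex.log (rayPot P θ r)) (Set.Ici r₀) :=
    (continuous_rayPot P θ).continuousOn.clog fun r hr => hslit r hr
  -- The potential along the ray carries the factor `dir θ ^ 2`, so q² must be √(W - μ) divided by
  -- `dir θ`; hence the division by the square root `dir (θ / 2)`.
  set q : ℝ → ℂ := fun r => Complex.exp (Complex.log (rayPot P θ r) / 4) / dir (θ / 2) with hq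
  have hq2 : ∀ r, q r ^ 2 * dir θ = raySqrt P θ r := by
    intro r
    rw [hq, raySqrt, csqrt, div_pow, hd2, div_mul_cancel₀ _ (dir_ne_zero θ), ← Complex.exp_nat_mul]
    congr 1; push_cast; ring
  have hsqrt : ContinuousOn (raySqrt P θ) (Set.Ici r₀) := fun s hs =>
    (continuousAt_raySqrt (hslit s hs)).continuousWithinAt
  refine ⟨isSolution_sub_C.mpr (hy.const_mul _), q, ?_, fun r hr => ⟨?_, ?_⟩, ?_, ?_⟩
  · exact ((hlog.div_const 4).cexp).div_const _
  · exact div_ne_zero (Complex.exp_ne_zero _) hd0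
  · have h1 : q r ^ 4 * dir θ ^ 2 = rayPot P θ r := by
      have : q r ^ 4 * dir θ ^ 2 = (q r ^ 2 * dir θ) ^ 2 := by ring
      rw [this, hq2, raySqrt, csqrt_sq (hne r hr)]
    rw [rayPot, mul_comm] at h1
    exact mul_left_cancel₀ (pow_ne_zero 2 (dir_ne_zero θ)) h1
  · simp only [hq2]
    have hc := h.hc
    have hk : 0 < √(c / 2 / 2) := Real.sqrt_pos.mpr (by positivity)
    set m := √(c / 2 / 2) * √(c / 2) with hm
    have hm0 : 0 < m := mul_pos hk (Real.sqrt_pos.mpr (by positivity))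
    have hre : ∀ s, r₀ ≤ s → m ≤ (raySqrt P θ s).re := by
      intro s hs
      have hRs := hr₀.trans hs
      have h1 := h.sub_C hlam hRs (hr₀'.trans hs)
      refine le_trans ?_ (csqrt_re_ge (c := c / 2) (hne s hs) (by positivity) h1.2)
      rw [norm_csqrt (hne s hs)]
      refine mul_le_mul_of_nonneg_left (Real.sqrt_le_sqrt ?_) hk.le
      have h2 := h.lower s hRs
      have h3 : 1 ≤ s := h.hR.trans hRs
      nlinarith [h1.1]
    have hbound : ∀ r, r₀ ≤ r → m * (r - r₀) ≤ (∫ s in r₀..r, raySqrt P θ s).re := by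
      intro r hr
      have hsqrtInt : IntervalIntegrable (raySqrt P θ) MeasureTheory.volume r₀ r :=
        (hsqrt.mono (by rw [Set.uIcc_of_le hr]; exact Set.Icc_subset_Ici_self)).intervalIntegrable
      have e : (∫ s in r₀..r, raySqrt P θ s).re = ∫ s in r₀..r, (raySqrt P θ s).re :=
        (Complex.reCLM.intervalIntegral_comp_comm hsqrtInt).symm
      rw [e]
      have e2 : m * (r - r₀) = ∫ _ in r₀..r, m := by simp [mul_comm]
      rw [e2]
      refine intervalIntegral.integral_mono_on hr intervalIntegrable_const ?_ fun s hs => hre s hs.1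
      exact ((Complex.continuous_re.comp_continuousOn hsqrt).mono
        (by rw [Set.uIcc_of_le hr]; exact Set.Icc_subset_Ici_self)).intervalIntegrable
    refine tendsto_atTop_mono' atTop ((eventually_ge_atTop r₀).mono hbound) ?_
    exact (tendsto_atTop_add_const_right atTop (-r₀) tendsto_id).const_mul_atTop hm0
  · simp only [hq2]
    refine Asymptotics.isEquivalent_of_tendsto_one ?_
    have h1 : Tendsto (fun r => ratio Q θ R lam y r * Complex.exp (L - sibExp Q θ R r₀ lam r))
        atTop (𝓝 (1 * Complex.exp (L - L))) :=
      hlim.mul ((tendsto_const_nhds.sub hL).cexp)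
    rw [sub_self, Complex.exp_zero, mul_one] at h1
    refine h1.congr fun r => ?_
    have key : ∀ A D E F : ℂ, -A + (L - D) = L + E - F →
        y (ray θ r) / Complex.exp A * Complex.exp (L - D) =
          dir (θ / 2) * Complex.exp L * y (ray θ r) /
            ((Complex.exp E / dir (θ / 2))⁻¹ * Complex.exp F) := by
      intro A D E F hB
      rw [inv_div, div_eq_mul_inv, ← Complex.exp_neg, mul_assoc, ← Complex.exp_add, hB,
        Complex.exp_sub, Complex.exp_add]
      have := Complex.exp_ne_zero E
      have := Complex.exp_ne_zero F
      field_simp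
    exact key _ _ _ _ (by rw [sibExp]; ring)

end

/-! ### Parameter dependence of the Sibuya normalization -/

/-- Differentiation under the integral sign; the lower bound m for the root bounds the derivative of
the integrand uniformly in λ. -/
lemma differentiableOn_integral_csqrt {f : ℝ → ℂ} {a b m : ℝ} (hab : a ≤ b) (hm : 0 < m)
    (hf : ContinuousOn f (Set.Icc a b)) (k : ℂ) {U : Set ℂ} (hU : IsOpen U)
    (hslit : ∀ s ∈ Set.Icc a b, ∀ lam ∈ U, f s - lam * k ∈ Complex.slitPlane)
    (hlow : ∀ s ∈ Set.Icc a b, ∀ lam ∈ U, m ≤ ‖csqrt (f s - lam * k)‖) :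
    DifferentiableOn ℂ (fun lam => ∫ s in a..b, csqrt (f s - lam * k)) U := by
  intro lam hlam
  have hcont : ∀ l ∈ U, ContinuousOn (fun s => csqrt (f s - l * k)) (Set.Icc a b) := fun l hl =>
    continuousOn_csqrt.comp (hf.sub continuousOn_const) fun s hs => hslit s hs l hl
  have hmem : ∀ s, s ∈ Set.uIoc a b → s ∈ Set.Icc a b := fun s hs => by
    rw [Set.uIoc_of_le hab] at hs
    exact ⟨hs.1.le, hs.2⟩
  have hmeas : ∀ g : ℝ → ℂ, ContinuousOn g (Set.Icc a b) →
      MeasureTheory.AEStronglyMeasurable g (MeasureTheory.volume.restrict (Set.uIoc a b)) :=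
    fun g hg => (hg.mono hmem).aestronglyMeasurable measurableSet_uIoc
  have hcont' : ContinuousOn (fun s => 1 / (2 * csqrt (f s - lam * k)) * -k) (Set.Icc a b) :=
    (continuousOn_const.div (continuousOn_const.mul (hcont lam hlam)) fun s _ =>
      mul_ne_zero two_ne_zero (csqrt_ne_zero _)).mul continuousOn_const
  have key := intervalIntegral.hasDerivAt_integral_of_dominated_loc_of_deriv_le
    (μ := MeasureTheory.volume) (a := a) (b := b)
    (F := fun lam s => csqrt (f s - lam * k))
    (F' := fun lam s => 1 / (2 * csqrt (f s - lam * k)) * -k) (x₀ := lam) (s := U)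
    (bound := fun _ => 1 / (2 * m) * ‖k‖) (hU.mem_nhds hlam)
    (by filter_upwards [hU.mem_nhds hlam] with l hl using hmeas _ (hcont l hl))
    (ContinuousOn.intervalIntegrable (by rw [Set.uIcc_of_le hab]; exact hcont lam hlam))
    (hmeas _ hcont')
    (Eventually.of_forall fun t ht l hl => by
      rw [norm_mul, norm_neg, norm_div, norm_mul, norm_one, Complex.norm_ofNat]
      have := hlow t (hmem t ht) l hl
      gcongr)
    intervalIntegrable_const
    (Eventually.of_forall fun t ht l hl => by
      have h1 : HasDerivAt (fun l : ℂ => f t - l * k) (-k) l := by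
        simpa using ((hasDerivAt_id l).mul_const k).const_sub (f t)
      exact HasDerivAt.comp (h₂ := csqrt) l (hasDerivAt_csqrt (hslit t (hmem t ht) l hl)) h1)
  exact key.2.differentiableAt.differentiableWithinAt

section Family

variable {Y : Type*} [TopologicalSpace Y] {Q : Y → ℂ[X]} {S : Set Y} {N : ℕ} {θ c C R : ℝ}

/-- The Sibuya normalization depends continuously on the parameters and holomorphically
on `lam`. -/
theorem exists_sibuya_factor [FirstCountableTopology Y] (hS : IsCompact S)
    (h : PolyFamily Q S N) (hg : ∀ p ∈ S, GoodRay (Q p) θ c C R) {M r₀ : ℝ} (hr₀ : R ≤ r₀)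
    (hr₀' : 8 * M / c ^ 2 ≤ r₀) :
    ∃ L : Y → ℂ → ℂ, ContinuousOn (Function.uncurry L) (S ×ˢ Metric.closedBall 0 M) ∧
      (∀ p ∈ S, DifferentiableOn ℂ (L p) (Metric.ball 0 M)) ∧
      ∀ p ∈ S, ∀ lam ∈ Metric.closedBall (0 : ℂ) M,
        Tendsto (sibExp (Q p) θ R r₀ lam) atTop (𝓝 (L p lam)) := by
  set K := 4 * (M * C / (2 * c) + M ^ 2 / (c * √c ^ 3)) with hK
  have hsub : ∀ p ∈ S, ∀ lam ∈ Metric.closedBall (0 : ℂ) M, ∀ X X', r₀ ≤ X → X ≤ X' →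
      ‖sibExp (Q p) θ R r₀ lam X - sibExp (Q p) θ R r₀ lam X'‖ ≤ K * X ^ (-(1 / 4) : ℝ) :=
    fun p hp lam hlam X X' hX hXX' =>
      (hg p hp).sibExp_sub_le hr₀ hr₀' (by simpa using hlam) hX hXX'
  have hε' : Tendsto (fun r : ℝ => K * r ^ (-(1 / 4) : ℝ)) atTop (𝓝 0) := by
    simpa using (tendsto_rpow_neg_atTop (by norm_num : (0 : ℝ) < 1 / 4)).const_mul K
  have hε := hε'.comp (tendsto_natCast_atTop_atTop (R := ℝ))
  have hev : ∀ᶠ n : ℕ in atTop, r₀ ≤ (n : ℝ) := tendsto_natCast_atTop_atTop.eventually_ge_atTop r₀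
  have hcauchy : ∀ᶠ n : ℕ in atTop, ∀ k : ℕ, k ≥ n → ∀ p ∈ S, ∀ lam ∈ Metric.closedBall (0 : ℂ) M,
      ‖sibExp (Q p) θ R r₀ lam k - sibExp (Q p) θ R r₀ lam n‖ ≤
        ((fun r : ℝ => K * r ^ (-(1 / 4) : ℝ)) ∘ Nat.cast) n := by
    filter_upwards [hev] with n hn k hk p hp lam hlam
    rw [norm_sub_rev]
    exact hsub p hp lam hlam n k hn (by exact_mod_cast hk)
  have hlim : ∀ p ∈ S, ∀ lam ∈ Metric.closedBall (0 : ℂ) M,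
      ∃ l, Tendsto (fun n : ℕ => sibExp (Q p) θ R r₀ lam n) atTop (𝓝 l) := fun p hp lam hlam =>
    exists_tendsto_of_cauchy hε (hcauchy.mono fun n hn k hk => hn k hk p hp lam hlam)
  choose! L hL using hlim
  have hslit : ∀ p ∈ S, ∀ lam ∈ Metric.closedBall (0 : ℂ) M, ∀ s, r₀ ≤ s →
      rayPot (Q p - Polynomial.C lam) θ s ∈ Complex.slitPlane := fun p hp lam hlam s hs =>
    (hg p hp).sub_C_mem_slitPlane (by simpa using hlam) (hr₀.trans hs) (hr₀'.trans hs)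
  have hP : PolyFamily (fun x : Y × ℂ => Q x.1 - Polynomial.C x.2) (S ×ˢ Metric.closedBall 0 M) N :=
    { natDegree_le := fun x hx => by rw [natDegree_sub_C]; exact h.natDegree_le x.1 hx.1
      coeff_cont := fun j => by
        simp only [coeff_sub_C]
        refine ((h.coeff_cont j).comp continuousOn_fst fun x hx => hx.1).sub ?_
        split_ifs
        · exact continuousOn_snd
        · exact continuousOn_const }
  have hSM : IsCompact (S ×ˢ Metric.closedBall (0 : ℂ) M) := hS.prod (isCompact_closedBall _ _)
  have hmain := continuousOn_differentiableOn_of_cauchy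
    (F := fun (n : ℕ) p lam => sibExp (Q p) θ R r₀ lam n) (f := L) (S := S) (M := M) ?_ ?_ hε
    hcauchy hL
  · refine ⟨L, hmain.1, hmain.2, fun p hp lam hlam => ?_⟩
    rw [tendsto_iff_norm_sub_tendsto_zero]
    refine squeeze_zero' (Eventually.of_forall fun _ => norm_nonneg _) ?_ hε'
    filter_upwards [eventually_ge_atTop r₀] with r hr
    -- The limit was taken along integers; letting n → ∞ in the estimate between r and n gives
    -- convergence along real r.
    refine le_of_tendsto ((tendsto_const_nhds.sub (hL p hp lam hlam)).norm) ?_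
    filter_upwards [tendsto_natCast_atTop_atTop.eventually_ge_atTop r] with n hn
    exact hsub p hp lam hlam r n hr hn
  · filter_upwards [hev] with n hn
    have hRn := hr₀.trans hn
    have hfst : Set.MapsTo (Prod.fst : Y × ℂ → Y) (S ×ˢ Metric.closedBall (0 : ℂ) M) S :=
      fun x hx => hx.1
    have hs1 : S ×ˢ Set.uIcc R (n : ℝ) ⊆ S ×ˢ Set.Ici R := by
      rw [Set.uIcc_of_le hRn]
      exact Set.prod_mono_right Set.Icc_subset_Ici_self
    have h1 := (continuousOn_intervalIntegral hS (f := fun p s => raySqrt (Q p) θ s)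
      ((h.continuousOn_raySqrt hg).mono hs1)).comp continuousOn_fst hfst
    have h2 := (continuousOn_intervalIntegral hS (f := fun p s => (raySqrt (Q p) θ s)⁻¹)
      (((h.continuousOn_raySqrt hg).inv₀ fun x _ => csqrt_ne_zero _).mono hs1)).comp
        continuousOn_fst hfst
    have h3 := ((continuousOn_slice (h.continuousOn_rayPot θ) (Set.mem_univ (n : ℝ))).clog
      fun p hp => (hg p hp).mem_slitPlane hRn).comp continuousOn_fst hfst
    have h4 := (continuousOn_slice (hP.continuousOn_rayPot θ) (Set.mem_univ (n : ℝ))).clog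
      fun x hx => hslit x.1 hx.1 x.2 hx.2 n hn
    have h5 : ContinuousOn (fun x : (Y × ℂ) × ℝ => raySqrt (Q x.1.1 - Polynomial.C x.1.2) θ x.2)
        ((S ×ˢ Metric.closedBall (0 : ℂ) M) ×ˢ Set.uIcc r₀ (n : ℝ)) := by
      refine continuousOn_csqrt.comp ((hP.continuousOn_rayPot θ).mono
        (Set.prod_mono_right (Set.subset_univ _))) fun x hx => ?_
      have hx2 := hx.2
      rw [Set.uIcc_of_le hn] at hx2
      exact hslit x.1.1 hx.1.1 x.1.2 hx.1.2 x.2 hx2.1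
    have h6 := continuousOn_intervalIntegral hSM
      (f := fun x s => raySqrt (Q x.1 - Polynomial.C x.2) θ s) h5
    exact (((h3.div_const 4).sub (h4.div_const 4)).add (h1.sub
      (((continuousOn_snd.mul continuousOn_const).div_const 2).mul h2))).sub h6
  · filter_upwards [hev] with n hn p hp
    have hc := (hg p hp).hc
    have h1 : DifferentiableOn ℂ (fun lam => Complex.log (rayPot (Q p - Polynomial.C lam) θ n))
        (Metric.ball 0 M) := by
      refine DifferentiableOn.clog (f := fun lam => rayPot (Q p - Polynomial.C lam) θ n) ?_
        fun lam hlam => hslit p hp lam (Metric.ball_subset_closedBall hlam) n hn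
      simp only [rayPot_sub_C]
      fun_prop
    have h2 : DifferentiableOn ℂ (fun lam => ∫ s in r₀..(n : ℝ),
        raySqrt (Q p - Polynomial.C lam) θ s) (Metric.ball 0 M) := by
      simp only [raySqrt, rayPot_sub_C]
      refine differentiableOn_integral_csqrt (m := √(c / 2)) hn
        (Real.sqrt_pos.mpr (by positivity)) (continuous_rayPot _ _).continuousOn _
        Metric.isOpen_ball (fun s hs lam hlam => ?_) (fun s hs lam hlam => ?_)
      · rw [← rayPot_sub_C]
        exact hslit p hp lam (Metric.ball_subset_closedBall hlam) s hs.1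
      · have hlam' : ‖lam‖ ≤ M := (mem_ball_zero_iff.mp hlam).le
        have hRs := hr₀.trans hs.1
        rw [← rayPot_sub_C, norm_csqrt ((hg p hp).sub_C_ne_zero hlam' hRs (hr₀'.trans hs.1))]
        refine Real.sqrt_le_sqrt ?_
        have a1 := ((hg p hp).sub_C hlam' hRs (hr₀'.trans hs.1)).1
        have a2 := (hg p hp).lower s hRs
        have a3 : 1 ≤ s := (hg p hp).hR.trans hRs
        nlinarith
    exact (((differentiableOn_const _).sub (h1.div_const 4)).add
      ((differentiableOn_const _).sub (by fun_prop))).sub h2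

end Family

/-! ### Coefficient majorants -/

/-- The sum of the absolute values of the terms of `P` of degree `≤ N` on the circle of
radius `r`. -/
def majorant (N : ℕ) (P : ℂ[X]) (r : ℝ) : ℝ := ∑ j ∈ Finset.range (N + 1), ‖P.coeff j‖ * r ^ j

lemma norm_eval_le_majorant {P : ℂ[X]} {N : ℕ} (hN : P.natDegree ≤ N) (z : ℂ) :
    ‖P.eval z‖ ≤ majorant N P ‖z‖ := by
  rw [eval_eq_sum_range' (Nat.lt_succ_of_le hN)]
  refine (norm_sum_le _ _).trans (le_of_eq ?_)
  exact Finset.sum_congr rfl fun j _ => by rw [norm_mul, norm_pow]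

lemma term_le_majorant (P : ℂ[X]) {N j : ℕ} (hj : j ≤ N) {r : ℝ} (hr : 0 ≤ r) :
    ‖P.coeff j‖ * r ^ j ≤ majorant N P r :=
  Finset.single_le_sum (f := fun j => ‖P.coeff j‖ * r ^ j) (fun _ _ => by positivity)
    (Finset.mem_range.mpr (Nat.lt_succ_of_le hj))

lemma majorant_derivative_le {P : ℂ[X]} {N : ℕ} (hN : P.natDegree ≤ N) {r : ℝ} (hr : 0 ≤ r) :
    r * majorant N (derivative P) r ≤ N * majorant N P r := by
  have hlast : (derivative P).coeff N = 0 :=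
    by rw [coeff_derivative, coeff_eq_zero_of_natDegree_lt (by omega), zero_mul]
  rw [majorant, Finset.sum_range_succ, hlast, norm_zero, zero_mul, add_zero, majorant,
    Finset.sum_range_succ', mul_add, Finset.mul_sum, Finset.mul_sum]
  have h0 : 0 ≤ (N : ℝ) * (‖P.coeff 0‖ * r ^ 0) := by positivity
  refine le_trans (Finset.sum_le_sum fun j hj => ?_) (le_add_of_nonneg_right h0)
  have hj' : ((j : ℝ) + 1) ≤ N := by exact_mod_cast Finset.mem_range.mp hj
  have hn : ‖(j : ℂ) + 1‖ = (j : ℝ) + 1 := by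
    rw [← Nat.cast_succ, Complex.norm_natCast]; push_cast; ring
  rw [coeff_derivative, norm_mul, hn]
  calc r * (‖P.coeff (j + 1)‖ * (j + 1) * r ^ j)
      = (j + 1) * (‖P.coeff (j + 1)‖ * r ^ (j + 1)) := by ring
    _ ≤ N * (‖P.coeff (j + 1)‖ * r ^ (j + 1)) := by gcongr

/-- A lower bound for `|P|` by the majorant implies bounds for the derivatives of `P`. -/
lemma derivative_bounds_of_majorant {P : ℂ[X]} {N : ℕ} (hN : P.natDegree ≤ N) {k : ℝ}
    {z : ℂ} (hk : 0 ≤ k) (h : majorant N P ‖z‖ ≤ k * ‖P.eval z‖) :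
    ‖z‖ * ‖(derivative P).eval z‖ ≤ N ^ 2 * k * ‖P.eval z‖ ∧
      ‖z‖ ^ 2 * ‖(derivative (derivative P)).eval z‖ ≤ N ^ 2 * k * ‖P.eval z‖ := by
  have hz := norm_nonneg z
  have hN1 : (derivative P).natDegree ≤ N := (natDegree_derivative_le P).trans (by omega)
  have hN2 : (derivative (derivative P)).natDegree ≤ N :=
    (natDegree_derivative_le _).trans (by omega)
  have h1 := majorant_derivative_le hN hz
  have h2 := majorant_derivative_le hN1 hz
  have e1 := norm_eval_le_majorant hN1 z
  have e2 := norm_eval_le_majorant hN2 z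
  have hNN : (N : ℝ) ≤ N ^ 2 := by exact_mod_cast Nat.le_self_pow two_ne_zero N
  constructor
  · calc ‖z‖ * ‖(derivative P).eval z‖ ≤ ‖z‖ * majorant N (derivative P) ‖z‖ := by gcongr
      _ ≤ N * majorant N P ‖z‖ := h1
      _ ≤ N * (k * ‖P.eval z‖) := by gcongr
      _ ≤ N ^ 2 * (k * ‖P.eval z‖) := by gcongr
      _ = _ := by ring
  · calc ‖z‖ ^ 2 * ‖(derivative (derivative P)).eval z‖
        ≤ ‖z‖ ^ 2 * majorant N (derivative (derivative P)) ‖z‖ := by gcongr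
      _ = ‖z‖ * (‖z‖ * majorant N (derivative (derivative P)) ‖z‖) := by ring
      _ ≤ ‖z‖ * (N * majorant N (derivative P) ‖z‖) := by gcongr
      _ = N * (‖z‖ * majorant N (derivative P) ‖z‖) := by ring
      _ ≤ N * (N * majorant N P ‖z‖) := by gcongr
      _ ≤ N * (N * (k * ‖P.eval z‖)) := by gcongr
      _ = _ := by ring

/-- The coefficients of ∏(X - w) are dominated in modulus by those of ∏(X + |w|), whose value at r
is the right-hand side. The truncation length varies in the induction because a new factor shifts
coefficients by one. -/
lemma majorant_prod_le (s : Multiset ℂ) {r : ℝ} (hr : 0 ≤ r) (N : ℕ) :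
    ∑ j ∈ Finset.range N, ‖((s.map fun w => X - C w).prod).coeff j‖ * r ^ j ≤
      (s.map fun w => r + ‖w‖).prod := by
  induction s using Multiset.induction_on generalizing N with
  | empty =>
    rw [Multiset.map_zero, Multiset.map_zero, Multiset.prod_zero, Multiset.prod_zero]
    rcases N with _ | N
    · simp
    · rw [Finset.sum_range_succ']
      simp [coeff_one]
  | cons w s ih =>
    have hprod : 0 ≤ (s.map fun w => r + ‖w‖).prod := by
      refine Multiset.prod_nonneg fun a ha => ?_
      obtain ⟨v, -, rfl⟩ := Multiset.mem_map.mp ha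
      positivity
    rw [Multiset.map_cons, Multiset.map_cons, Multiset.prod_cons, Multiset.prod_cons]
    set p := (s.map fun w => X - C w).prod with hp
    rcases N with _ | N
    · rw [Finset.sum_range_zero]; positivity
    · have h1 := ih N
      have h2 := ih (N + 1)
      rw [Finset.sum_range_succ'] at h2 ⊢
      have h3 : ∑ j ∈ Finset.range N, ‖((X - C w) * p).coeff (j + 1)‖ * r ^ (j + 1) ≤
          r * (∑ j ∈ Finset.range N, ‖p.coeff j‖ * r ^ j) +
            ‖w‖ * ∑ j ∈ Finset.range N, ‖p.coeff (j + 1)‖ * r ^ (j + 1) := by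
        rw [Finset.mul_sum, Finset.mul_sum, ← Finset.sum_add_distrib]
        refine Finset.sum_le_sum fun j _ => ?_
        rw [coeff_X_sub_C_mul]
        have := norm_sub_le (p.coeff j) (w * p.coeff (j + 1))
        rw [norm_mul] at this
        calc _ ≤ (‖p.coeff j‖ + ‖w‖ * ‖p.coeff (j + 1)‖) * r ^ (j + 1) := by gcongr
          _ = _ := by ring
      have h4 : ‖((X - C w) * p).coeff 0‖ = ‖w‖ * ‖p.coeff 0‖ := by
        rw [mul_coeff_zero]; simp
      rw [h4]
      have h5 := mul_le_mul_of_nonneg_left h1 hr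
      have h6 := mul_le_mul_of_nonneg_left h2 (norm_nonneg w)
      nlinarith

/-- If all zeros of `P` are well separated from `z`, then `|P z|` is bounded from below by
the majorant. -/
lemma majorant_le_of_roots {P : ℂ[X]} {N : ℕ} (hN : P.natDegree ≤ N) {k r : ℝ} (hk : 0 < k)
    (hk1 : k ≤ 1) (hr : 0 ≤ r) {z : ℂ} (h : ∀ w, P.eval w = 0 → k * (r + ‖w‖) ≤ ‖z - w‖) :
    majorant N P r ≤ (k ^ N)⁻¹ * ‖P.eval z‖ := by
  rcases eq_or_ne P 0 with rfl | hP
  · simp [majorant]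
  have hs := IsAlgClosed.splits P
  have hfac := hs.eq_prod_roots
  have hcard := hs.natDegree_eq_card_roots
  have hlow : ∀ s : Multiset ℂ, (∀ w ∈ s, k * (r + ‖w‖) ≤ ‖z - w‖) →
      k ^ s.card * (s.map fun w => r + ‖w‖).prod ≤ ‖((s.map fun w => X - C w).prod).eval z‖ := by
    intro s
    induction s using Multiset.induction_on with
    | empty => simp
    | cons w s ih =>
      intro hs
      have h1 := ih fun v hv => hs v (Multiset.mem_cons_of_mem hv)
      have h2 := hs w (Multiset.mem_cons_self w s)
      have hprod : 0 ≤ (s.map fun w => r + ‖w‖).prod := by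
        refine Multiset.prod_nonneg fun a ha => ?_
        obtain ⟨v, -, rfl⟩ := Multiset.mem_map.mp ha
        positivity
      rw [Multiset.map_cons, Multiset.map_cons, Multiset.prod_cons, Multiset.prod_cons,
        Multiset.card_cons, eval_mul, eval_sub, eval_X, eval_C, norm_mul]
      calc _ = (k * (r + ‖w‖)) * (k ^ s.card * (s.map fun w => r + ‖w‖).prod) := by ring
        _ ≤ _ := by gcongr
  have h1 := hlow P.roots fun w hw => h w ((mem_roots hP).mp hw)
  have h2 := majorant_prod_le P.roots hr (N + 1)
  have h3 : majorant N P r = ‖P.leadingCoeff‖ * ∑ j ∈ Finset.range (N + 1),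
      ‖((P.roots.map fun w => X - C w).prod).coeff j‖ * r ^ j := by
    rw [majorant, Finset.mul_sum]
    refine Finset.sum_congr rfl fun j _ => ?_
    conv_lhs => rw [hfac, coeff_C_mul, norm_mul]
    ring
  have h4 : ‖P.eval z‖ = ‖P.leadingCoeff‖ * ‖((P.roots.map fun w => X - C w).prod).eval z‖ := by
    conv_lhs => rw [hfac, eval_mul, eval_C, norm_mul]
  have hprod : 0 ≤ (P.roots.map fun w => r + ‖w‖).prod := by
    refine Multiset.prod_nonneg fun a ha => ?_
    obtain ⟨v, -, rfl⟩ := Multiset.mem_map.mp ha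
    positivity
  rw [← hcard] at h1
  -- The degree may be smaller than N, as happens at t = 0; since k ≤ 1, the power k^N serves all
  -- degrees.
  have h5 : k ^ N ≤ k ^ P.natDegree := pow_le_pow_of_le_one hk.le hk1 hN
  rw [inv_mul_eq_div, le_div_iff₀ (by positivity), h3, h4, mul_assoc]
  refine mul_le_mul_of_nonneg_left ?_ (norm_nonneg _)
  calc _ ≤ (P.roots.map fun w => r + ‖w‖).prod * k ^ N := by gcongr
    _ ≤ (P.roots.map fun w => r + ‖w‖).prod * k ^ P.natDegree := by gcongr
    _ ≤ _ := by rw [mul_comm]; exact h1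

/-! ### Admissible rays -/

lemma cos_angle_le {δ : ℝ} (hδ : 0 ≤ δ) {v : ℂ} (hv : v ≠ 0) {θ : ℝ}
    (h : δ ≤ InnerProductGeometry.angle v (dir θ)) :
    (dir θ * (starRingEnd ℂ) v).re ≤ Real.cos δ * ‖v‖ := by
  have h1 := Real.cos_le_cos_of_nonneg_of_le_pi hδ (InnerProductGeometry.angle_le_pi _ _) h
  rw [InnerProductGeometry.cos_angle, norm_dir, mul_one,
    div_le_iff₀ (norm_pos_iff.mpr hv), Complex.inner] at h1
  exact h1

/-- If |w| ≤ R ≤ r/3, then r - |w| ≥ (r + |w|)/2. Otherwise the law of cosines gives |z - w|² ≥ (1 -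
cos δ)/2·(r + |w|)² + (1 + cos δ)/2·(r - |w|)², and the last term is dropped. -/
lemma norm_ray_sub_ge {δ k r R θ : ℝ} {w : ℂ} (hk : 0 ≤ k) (hk1 : k ≤ 1 / 2)
    (hk2 : k ^ 2 ≤ (1 - Real.cos δ) / 2) (hδ : 0 ≤ δ) (hR : 0 < R) (hr : 3 * R ≤ r)
    (hw : R < ‖w‖ → δ ≤ InnerProductGeometry.angle w (dir θ)) :
    k * (r + ‖w‖) ≤ ‖ray θ r - w‖ := by
  have hr0 : 0 ≤ r := by linarith
  have hw0 := norm_nonneg w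
  rcases le_or_gt ‖w‖ R with h | h
  · have h1 := norm_sub_norm_le (ray θ r) w
    rw [norm_ray hr0] at h1
    nlinarith
  · have hwne : w ≠ 0 := norm_pos_iff.mp (hR.trans h)
    have h1 := cos_angle_le hδ hwne (hw h)
    have h2 : ‖ray θ r - w‖ ^ 2 = r ^ 2 - 2 * (r * (dir θ * (starRingEnd ℂ) w).re) + ‖w‖ ^ 2 := by
      rw [norm_sub_sq_real, norm_ray hr0, real_inner_comm, Complex.inner, ray, mul_assoc,
        Complex.re_ofReal_mul]
    refine le_of_sq_le_sq ?_ (norm_nonneg _)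
    rw [h2, mul_pow]
    have h3 := mul_le_mul_of_nonneg_left h1 hr0
    have h4 := mul_le_mul_of_nonneg_right hk2 (sq_nonneg (r + ‖w‖))
    have h5 : 0 ≤ (1 + Real.cos δ) / 2 * (r - ‖w‖) ^ 2 :=
      mul_nonneg (by linarith [Real.neg_one_le_cos δ]) (sq_nonneg _)
    nlinarith

/-- The angle condition keeps the potential along the ray away from the negative axis. -/
lemma sector_of_angle {Q : ℂ[X]} {θ r δ : ℝ} (hδ : 0 < δ)
    (hQ : rayPot Q θ r ≠ 0)
    (h : ∀ v : ℂ, IsNegReal (Q.eval (ray θ r) * v ^ 2) →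
      δ ≤ InnerProductGeometry.angle v (dir θ)) :
    2 * Real.sin δ ^ 2 * ‖rayPot Q θ r‖ ≤ ‖rayPot Q θ r‖ + (rayPot Q θ r).re := by
  set W := rayPot Q θ r with hW
  set s := csqrt W with hs
  have hs2 : s ^ 2 = W := csqrt_sq hQ
  have hs0 : s ≠ 0 := csqrt_ne_zero _
  have hd1 : dir θ * (starRingEnd ℂ) (dir θ) = 1 := by
    rw [Complex.mul_conj, Complex.normSq_eq_norm_sq, norm_dir]; simp
  have hspos : 0 < ‖s‖ := norm_pos_iff.mpr hs0
  -- With s² = W, this is a vertical direction: Q v² = -|s|⁴. The angle conditions for v and for -v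
  -- together give |Im s| ≤ cos δ·|s|, hence |W| + Re W = 2(Re s)² ≥ 2 sin²δ·|W|.
  set v := Complex.I * dir θ * (starRingEnd ℂ) s with hv
  have hv0 : v ≠ 0 := mul_ne_zero (mul_ne_zero Complex.I_ne_zero (dir_ne_zero θ))
    ((_root_.map_ne_zero _).mpr hs0)
  have hvn : ‖v‖ = ‖s‖ := by rw [hv, norm_mul, norm_mul, Complex.norm_I, norm_dir]; simp
  have hneg : Q.eval (ray θ r) * v ^ 2 = ((-‖s‖ ^ 4 : ℝ) : ℂ) := by
    have h1 : Q.eval (ray θ r) * v ^ 2 = -(W * (starRingEnd ℂ) s ^ 2) := by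
      rw [hv, hW, rayPot]; linear_combination
        (dir θ ^ 2 * (starRingEnd ℂ) s ^ 2 * Q.eval (ray θ r)) * Complex.I_sq
    have h2 : s * (starRingEnd ℂ) s = ((‖s‖ ^ 2 : ℝ) : ℂ) := by
      rw [Complex.mul_conj, Complex.normSq_eq_norm_sq]
    rw [h1, ← hs2, ← mul_pow, h2]; push_cast; ring
  have hnr : IsNegReal (((-‖s‖ ^ 4 : ℝ) : ℂ)) :=
    ⟨by rw [Complex.ofReal_re]; linarith [pow_pos hspos 4], Complex.ofReal_im _⟩
  have a1 := cos_angle_le hδ.le hv0 (h v (by rw [hneg]; exact hnr))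
  have a2 := cos_angle_le hδ.le (neg_ne_zero.mpr hv0) (h (-v) (by rw [neg_sq, hneg]; exact hnr))
  have e1 : dir θ * (starRingEnd ℂ) v = -(Complex.I * s) := by
    rw [hv, map_mul, map_mul, Complex.conj_I, Complex.conj_conj]
    linear_combination (-Complex.I * s) * hd1
  have e2 : (-(Complex.I * s)).re = s.im := by simp
  rw [map_neg, mul_neg, Complex.neg_re, norm_neg] at a2
  rw [e1, e2, hvn] at a1 a2
  have hn : ‖W‖ = s.re ^ 2 + s.im ^ 2 := by
    rw [← hs2, norm_pow, ← Complex.normSq_eq_norm_sq, Complex.normSq_apply]; ring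
  have hsn : ‖s‖ ^ 2 = s.re ^ 2 + s.im ^ 2 := by
    rw [← Complex.normSq_eq_norm_sq, Complex.normSq_apply]; ring
  have hre : W.re = s.re ^ 2 - s.im ^ 2 := by rw [← hs2, sq, Complex.mul_re]; ring
  have him : s.im ^ 2 ≤ Real.cos δ ^ 2 * ‖s‖ ^ 2 := by
    rw [← mul_pow]
    exact sq_le_sq' (by linarith) a1
  rw [hn, hre]
  have := Real.sin_sq_add_cos_sq δ
  rw [hsn] at him
  nlinarith

lemma coeff_potential (d : ℕ) {m : ℕ} (p : ℝ × (Fin (m + 1) → ℂ)) (j : ℕ) :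
    (potential d p).coeff j = (if j = d then (p.1 : ℂ) else 0) +
      ∑ i : Fin (m + 1), if j = (i : ℕ) then p.2 i else 0 := by
  rw [potential, coeff_add, coeff_C_mul_X_pow, finsetSum_coeff]
  simp only [coeff_C_mul_X_pow]

lemma coeff_potential_of_lt {d m : ℕ} (hmd : m < d) (p : ℝ × (Fin (m + 1) → ℂ)) :
    (potential d p).coeff m = p.2 (Fin.last m) := by
  rw [coeff_potential, if_neg hmd.ne, zero_add, Finset.sum_eq_single (Fin.last m)]
  · simp
  · intro i _ hi
    rw [if_neg]
    intro h
    exact hi (Fin.ext (by simpa using h.symm))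
  · simp

lemma coeff_potential_degree {d m : ℕ} (hmd : m < d) (p : ℝ × (Fin (m + 1) → ℂ)) :
    (potential d p).coeff d = p.1 := by
  rw [coeff_potential, if_pos rfl, Finset.sum_eq_zero, add_zero]
  intro i _
  rw [if_neg]
  have := i.isLt
  omega

lemma natDegree_potential_le {d m : ℕ} (hmd : m < d) (p : ℝ × (Fin (m + 1) → ℂ)) :
    (potential d p).natDegree ≤ d := by
  refine natDegree_le_iff_coeff_eq_zero.mpr fun j hj => ?_
  rw [coeff_potential, if_neg (by omega), zero_add, Finset.sum_eq_zero]
  intro i _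
  rw [if_neg]
  have := i.isLt
  omega

lemma polyFamily_potential {d m : ℕ} (hmd : m < d) (S : Set (ℝ × (Fin (m + 1) → ℂ))) :
    PolyFamily (potential d) S d where
  natDegree_le p _ := natDegree_potential_le hmd p
  coeff_cont j := by
    simp only [coeff_potential]
    refine Continuous.continuousOn (Continuous.add ?_ (continuous_finsetSum _ fun i _ => ?_))
    · split_ifs
      · exact Complex.continuous_ofReal.comp continuous_fst
      · exact continuous_const
    · split_ifs
      · exact (continuous_apply i).comp continuous_snd
      · exact continuous_const

/-- An admissible ray is good, uniformly with respect to the parameters. -/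
theorem Admissible.exists_goodRay {d m : ℕ} (hm : 1 ≤ m) (hmd : m < d)
    {K : Set (Fin (m + 1) → ℂ)} (hK : IsCompact K) (ham : ∀ a ∈ K, a (Fin.last m) ≠ 0)
    {θ : ℝ} (h : Admissible d K θ) :
    ∃ c C R, 0 < c ∧ 0 ≤ C ∧ ∀ p ∈ Set.Icc (0 : ℝ) 1 ×ˢ K, GoodRay (potential d p) θ c C R := by
  obtain ⟨δ₀, hδ₀, R, hR, hadm⟩ := h
  obtain ⟨a₀, ha₀, hlow⟩ : ∃ a₀ : ℝ, 0 < a₀ ∧ ∀ a ∈ K, a₀ ≤ ‖a (Fin.last m)‖ := by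
    rcases K.eq_empty_or_nonempty with rfl | hne
    · exact ⟨1, one_pos, by simp⟩
    · obtain ⟨b, hb, hmin⟩ := hK.exists_isMinOn hne
        ((continuous_apply (Fin.last m)).norm.continuousOn)
      exact ⟨_, norm_pos_iff.mpr (ham b hb), fun a ha => hmin ha⟩
  -- Shrinking the angle below π keeps sin δ > 0 and cos δ < 1.
  set δ := min δ₀ 1 with hδ
  have hδpos : 0 < δ := lt_min hδ₀ one_pos
  have hδ1 : δ ≤ 1 := min_le_right _ _
  have hδle : δ ≤ δ₀ := min_le_left _ _
  have hpi := Real.pi_gt_three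
  have hsin : 0 < Real.sin δ := Real.sin_pos_of_pos_of_lt_pi hδpos (by linarith)
  have hcos : Real.cos δ < 1 := by
    have := Real.sin_sq_add_cos_sq δ
    nlinarith [Real.cos_le_one δ]
  have hkk : 0 < (1 - Real.cos δ) / 2 := by linarith
  set k := min (√((1 - Real.cos δ) / 2)) (1 / 2) with hk
  have hkpos : 0 < k := lt_min (Real.sqrt_pos.mpr hkk) (by norm_num)
  have hk1 : k ≤ 1 / 2 := min_le_right _ _
  have hk2 : k ^ 2 ≤ (1 - Real.cos δ) / 2 := by
    calc k ^ 2 ≤ √((1 - Real.cos δ) / 2) ^ 2 := by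
          gcongr; exact min_le_left _ _
      _ = _ := Real.sq_sqrt hkk.le
  set c := min (k ^ d * a₀) (2 * Real.sin δ ^ 2) with hc
  have hcpos : 0 < c := lt_min (by positivity) (by positivity)
  refine ⟨c, d ^ 2 * (k ^ d)⁻¹, max (3 * R) 1, hcpos, by positivity, fun p hp => ?_⟩
  obtain ⟨hroot, hang, -⟩ := hadm p hp
  have hdeg := natDegree_potential_le hmd p
  have hmaj : ∀ r, max (3 * R) 1 ≤ r → majorant d (potential d p) r ≤
      (k ^ d)⁻¹ * ‖(potential d p).eval (ray θ r)‖ := by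
    intro r hr
    have hr3 : 3 * R ≤ r := (le_max_left _ _).trans hr
    exact majorant_le_of_roots hdeg hkpos (by linarith) (by linarith) fun w hw =>
      norm_ray_sub_ge hkpos.le hk1 hk2 hδpos.le hR hr3 fun hRw => hδle.trans (hroot w hw hRw)
  -- The coefficient of z^m does not involve t and is bounded away from zero on K, so this lower
  -- bound persists as t → 0; m ≥ 1 makes it at least linear in r.
  have hlower : ∀ r, max (3 * R) 1 ≤ r → k ^ d * a₀ * r ≤ ‖rayPot (potential d p) θ r‖ := by
    intro r hr
    have hr1 : 1 ≤ r := (le_max_right _ _).trans hr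
    have h1 := term_le_majorant (potential d p) hmd.le (by linarith : (0 : ℝ) ≤ r)
    rw [coeff_potential_of_lt hmd] at h1
    have h2 := hlow p.2 hp.2
    have h3 : r ≤ r ^ m := le_self_pow₀ hr1 (by omega)
    have h4 : a₀ * r ≤ (k ^ d)⁻¹ * ‖(potential d p).eval (ray θ r)‖ := by
      refine le_trans ?_ (h1.trans (hmaj r hr))
      gcongr
    rw [inv_mul_eq_div, le_div_iff₀ (by positivity)] at h4
    rw [norm_rayPot]
    linarith
  have hbounds : ∀ r, max (3 * R) 1 ≤ r → _ := fun r hr =>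
    derivative_bounds_of_majorant (z := ray θ r) (k := (k ^ d)⁻¹) hdeg (by positivity)
      (by rw [norm_ray (by linarith [le_max_right (3 * R) 1])]; exact hmaj r hr)
  have hnr : ∀ r, max (3 * R) 1 ≤ r → ‖ray θ r‖ = r := fun r hr =>
    norm_ray (by linarith [le_max_right (3 * R) 1])
  refine ⟨hcpos, by positivity, le_max_right _ _, fun r hr => ?_, fun r hr => ?_,
    fun r hr => ?_, fun r hr => ?_⟩
  · have hr1 : 1 ≤ r := (le_max_right _ _).trans hr
    refine le_trans ?_ (hlower r hr)
    gcongr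
    exact min_le_left _ _
  · have hr1 : 1 ≤ r := (le_max_right _ _).trans hr
    have hr3 : 3 * R ≤ r := (le_max_left _ _).trans hr
    have hne : rayPot (potential d p) θ r ≠ 0 :=
      norm_pos_iff.mp (lt_of_lt_of_le (by positivity) (hlower r hr))
    refine le_trans ?_ (sector_of_angle hδpos hne
      fun v hv => hδle.trans (hang r (by linarith) v hv))
    gcongr
    exact min_le_right _ _
  · have := (hbounds r hr).1
    rwa [hnr r hr] at this
  · have := (hbounds r hr).2
    rwa [hnr r hr] at this

/-! ### Rays that are not separating -/

/-- Far out, the lower order terms are small compared with the leading term. -/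
lemma exists_lower_terms_le {P : ℂ[X]} (hn : 1 ≤ P.natDegree) {ε : ℝ} (hε : 0 < ε) :
    ∃ R, 1 ≤ R ∧ ∀ r, R ≤ r → ∑ j ∈ Finset.range P.natDegree, ‖P.coeff j‖ * r ^ j ≤
      ε * ‖P.leadingCoeff‖ * r ^ P.natDegree := by
  have hP : P ≠ 0 := by rintro rfl; simp at hn
  set n := P.natDegree with hndef
  set l := P.leadingCoeff with hl
  have hlpos : 0 < ‖l‖ := norm_pos_iff.mpr (leadingCoeff_ne_zero.mpr hP)
  set s := ∑ j ∈ Finset.range n, ‖P.coeff j‖ with hs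
  refine ⟨max 1 (s / (ε * ‖l‖)), le_max_left _ _, fun r hr => ?_⟩
  have hr1 : 1 ≤ r := (le_max_left _ _).trans hr
  have hr2 : s / (ε * ‖l‖) ≤ r := (le_max_right _ _).trans hr
  rw [div_le_iff₀ (by positivity)] at hr2
  calc ∑ j ∈ Finset.range n, ‖P.coeff j‖ * r ^ j
      ≤ ∑ j ∈ Finset.range n, ‖P.coeff j‖ * r ^ (n - 1) := by
        refine Finset.sum_le_sum fun j hj => ?_
        have := Finset.mem_range.mp hj
        exact mul_le_mul_of_nonneg_left (pow_le_pow_right₀ hr1 (by omega)) (norm_nonneg _)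
    _ = s * r ^ (n - 1) := by rw [← Finset.sum_mul]
    _ ≤ r * (ε * ‖l‖) * r ^ (n - 1) := by gcongr
    _ = ε * ‖l‖ * r ^ (n - 1 + 1) := by ring
    _ = ε * ‖l‖ * r ^ n := by rw [Nat.sub_add_cancel hn]

lemma norm_rayPot_sub_leading_le (P : ℂ[X]) (θ : ℝ) {r : ℝ} (hr : 0 ≤ r) :
    ‖rayPot P θ r - P.leadingCoeff * dir θ ^ (P.natDegree + 2) * (r ^ P.natDegree : ℝ)‖ ≤
      ∑ j ∈ Finset.range P.natDegree, ‖P.coeff j‖ * r ^ j := by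
  have e : rayPot P θ r - P.leadingCoeff * dir θ ^ (P.natDegree + 2) * (r ^ P.natDegree : ℝ) =
      dir θ ^ 2 * ∑ j ∈ Finset.range P.natDegree, P.coeff j * ray θ r ^ j := by
    rw [rayPot, eval_eq_sum_range, Finset.sum_range_succ, coeff_natDegree, ray]
    push_cast; ring
  rw [e, norm_mul, norm_pow, norm_dir, one_pow, one_mul]
  refine (norm_sum_le _ _).trans (le_of_eq (Finset.sum_congr rfl fun j _ => ?_))
  rw [norm_mul, norm_pow, norm_ray hr]

/-- For a fixed polynomial, rays on which the leading term stays away from the negative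
axis are uniformly good. -/
lemma exists_goodRay_of_leading {P : ℂ[X]} (hn : 1 ≤ P.natDegree) {c₀ : ℝ} (hc₀ : 0 < c₀) :
    ∃ c C R, ∀ θ : ℝ, 2 * c₀ * ‖P.leadingCoeff‖ ≤
      ‖P.leadingCoeff‖ + (P.leadingCoeff * dir θ ^ (P.natDegree + 2)).re →
      GoodRay P θ c C R ∧
        ∀ r, R ≤ r → ‖P.leadingCoeff‖ / 2 * r ^ P.natDegree ≤ ‖rayPot P θ r‖ := by
  have hP : P ≠ 0 := by rintro rfl; simp at hn
  set n := P.natDegree with hndef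
  set l := P.leadingCoeff with hl
  have hlpos : 0 < ‖l‖ := norm_pos_iff.mpr (leadingCoeff_ne_zero.mpr hP)
  -- The bound 1/2 keeps at least half of the leading term in |W|; the bound c₀/2 loses at most half
  -- of the margin 2c₀ in the sector condition, because the error enters both |W| and Re W.
  set ε := min (c₀ / 2) (1 / 2) with hε
  have hεpos : 0 < ε := lt_min (by positivity) (by norm_num)
  have hε1 : ε ≤ 1 / 2 := min_le_right _ _
  have hε2 : ε ≤ c₀ / 2 := min_le_left _ _
  obtain ⟨R, hR, hlow⟩ := exists_lower_terms_le hn hεpos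
  refine ⟨min (c₀ / 2) (‖l‖ / 2), n ^ 2 * 3, R, fun θ hθ => ?_⟩
  have hpot : ∀ r, R ≤ r →
      ‖rayPot P θ r - l * dir θ ^ (n + 2) * (r ^ n : ℝ)‖ ≤ ε * ‖l‖ * r ^ n := by
    intro r hr
    have hr1 : 1 ≤ r := hR.trans hr
    exact (norm_rayPot_sub_leading_le P θ (by linarith)).trans (hlow r hr)
  have hlead : ∀ r, R ≤ r → ‖l * dir θ ^ (n + 2) * (r ^ n : ℝ)‖ = ‖l‖ * r ^ n := by
    intro r hr
    have hr1 : 1 ≤ r := hR.trans hr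
    rw [norm_mul, norm_mul, norm_pow, norm_dir, one_pow, mul_one,
      Complex.norm_of_nonneg (by positivity)]
  have hge : ∀ r, R ≤ r → ‖l‖ / 2 * r ^ n ≤ ‖rayPot P θ r‖ := by
    intro r hr
    have hr1 : 1 ≤ r := hR.trans hr
    have h1 := norm_sub_norm_le (l * dir θ ^ (n + 2) * (r ^ n : ℝ)) (rayPot P θ r)
    rw [norm_sub_rev, hlead r hr] at h1
    have h2 := hpot r hr
    have h3 : ε * ‖l‖ * r ^ n ≤ 1 / 2 * ‖l‖ * r ^ n := by gcongr
    linarith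
  refine ⟨⟨lt_min (by positivity) (by positivity), by positivity, hR,
    fun r hr => ?_, fun r hr => ?_, fun r hr => ?_, fun r hr => ?_⟩, hge⟩
  · have hr1 : 1 ≤ r := hR.trans hr
    refine le_trans ?_ (hge r hr)
    have : r ≤ r ^ n := le_self_pow₀ hr1 (by omega)
    gcongr
    exact min_le_right _ _
  · have hr1 : 1 ≤ r := hR.trans hr
    have h1 := norm_sub_norm_le (rayPot P θ r) (l * dir θ ^ (n + 2) * (r ^ n : ℝ))
    have h1' := norm_sub_norm_le (l * dir θ ^ (n + 2) * (r ^ n : ℝ)) (rayPot P θ r)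
    rw [norm_sub_rev] at h1'
    rw [hlead r hr] at h1 h1'
    have h2 := hpot r hr
    have h3 := Complex.abs_re_le_norm (rayPot P θ r - l * dir θ ^ (n + 2) * (r ^ n : ℝ))
    rw [Complex.sub_re, Complex.re_mul_ofReal] at h3
    have h4 := abs_le.mp h3
    have h5 : 0 < r ^ n := by positivity
    have h6 := mul_le_mul_of_nonneg_right hθ h5.le
    have h7 : ε * ‖l‖ * r ^ n ≤ c₀ / 2 * ‖l‖ * r ^ n := by gcongr
    have h8 : ε * ‖l‖ * r ^ n ≤ 1 / 2 * ‖l‖ * r ^ n := by gcongr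
    calc min (c₀ / 2) (‖l‖ / 2) * ‖rayPot P θ r‖ ≤ c₀ / 2 * ‖rayPot P θ r‖ := by
          gcongr; exact min_le_left _ _
      _ ≤ c₀ / 2 * (2 * (‖l‖ * r ^ n)) := by gcongr; linarith [mul_pos hlpos h5]
      _ = c₀ * ‖l‖ * r ^ n := by ring
      _ ≤ _ := by linarith [h4.1]
  all_goals
    have hr1 : 1 ≤ r := hR.trans hr
    have hnr : ‖ray θ r‖ = r := norm_ray (by linarith)
    have hb := derivative_bounds_of_majorant (P := P) (N := n) (z := ray θ r) (k := 3) le_rfl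
      (by norm_num) (by
        have h1 := hlow r hr
        have h2 := hge r hr
        have h3 : ε * ‖l‖ * r ^ n ≤ 1 / 2 * ‖l‖ * r ^ n := by gcongr
        rw [hnr, majorant, Finset.sum_range_succ, ← norm_rayPot]
        have : P.coeff n = l := rfl
        rw [this]
        linarith)
    rw [hnr] at hb
  · exact hb.1
  · exact hb.2

/-! ### Decay in a sector -/

lemma dir_add (α β : ℝ) : dir (α + β) = dir α * dir β := by
  rw [dir, dir, dir, ← Complex.exp_add]; congr 1; push_cast; ring

lemma dir_pow (α : ℝ) (k : ℕ) : dir α ^ k = dir (k * α) := by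
  rw [dir, dir, ← Complex.exp_nat_mul]; congr 1; push_cast; ring

/-- A function of order `ρ` that decays on a ray like `exp (-c₁ r ^ ρ)` decays on all rays that
form a sufficiently small angle with it. -/
lemma norm_le_of_decay_on_ray {g : ℂ → ℂ} (hg : Differentiable ℂ g) {K B c₁ ρ θ σ : ℝ}
    (hρ : 0 < ρ) (hσ : σ = 1 ∨ σ = -1) (hK : 0 ≤ K) (hB : 0 ≤ B) (hc₁ : 0 ≤ c₁)
    (hgrow : ∀ z, ‖g z‖ ≤ K * Real.exp (B * ‖z‖ ^ ρ))
    (hdec : ∀ r, 0 ≤ r → ‖g (ray θ r)‖ ≤ K * Real.exp (-(c₁ * r ^ ρ)))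
    {φ : ℝ} (hφ : 0 ≤ φ) (hφ' : φ ≤ Real.pi / (2 * ρ)) {r : ℝ} (hr : 0 < r) :
    ‖g (ray (θ + σ * φ) r)‖ ≤
      K * Real.exp (-((c₁ * Real.cos (ρ * φ) - B * Real.sin (ρ * φ)) * r ^ ρ)) := by
  have hσ2 : σ ^ 2 = 1 := by rcases hσ with rfl | rfl <;> norm_num
  have hσabs : |σ| = 1 := by rcases hσ with rfl | rfl <;> norm_num
  -- The logarithmic coordinate z = e^{iθ}e^{σξ} turns a sector of opening π/(2ρ) into a strip, σ
  -- selecting the side of the ray. The exponential of a multiple of z^ρ has modulus exp(c₁r^ρ) on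
  -- the given ray and exp(-Br^ρ) on the far edge, so it compensates the decay on one edge and the
  -- growth on the other, and |f| ≤ K on both.
  set H : ℂ := -(c₁ : ℂ) - Complex.I * σ * B with hH
  set f : ℂ → ℂ := fun ξ => g (dir θ * Complex.exp (σ * ξ)) *
    Complex.exp (-(H * Complex.exp (ρ * σ * ξ))) with hf
  have hray : ∀ ξ : ℂ, dir θ * Complex.exp (σ * ξ) =
      ray (θ + σ * ξ.im) (Real.exp (σ * ξ.re)) := by
    intro ξ
    rw [ray, dir_add, dir, dir, Complex.ofReal_exp, ← Complex.exp_add, ← Complex.exp_add,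
      ← Complex.exp_add]
    congr 1
    conv_lhs => rw [← Complex.re_add_im ξ]
    push_cast; ring
  have hpow : ∀ ξ : ℂ, Real.exp (σ * ξ.re) ^ ρ = Real.exp (ρ * σ * ξ.re) := by
    intro ξ
    rw [← Real.exp_mul]; congr 1; ring
  have hEre : ∀ ξ : ℂ, (-(H * Complex.exp (ρ * σ * ξ))).re =
      (c₁ * Real.cos (ρ * ξ.im) - B * Real.sin (ρ * ξ.im)) * Real.exp (σ * ξ.re) ^ ρ := by
    intro ξ
    have h1 : (ρ * σ * ξ : ℂ) = ((ρ * σ * ξ.re : ℝ) : ℂ) + ((σ * (ρ * ξ.im) : ℝ) : ℂ) * Complex.I := by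
      conv_lhs => rw [← Complex.re_add_im ξ]
      push_cast; ring
    have hcos : Real.cos (σ * (ρ * ξ.im)) = Real.cos (ρ * ξ.im) := by
      rcases hσ with rfl | rfl
      · rw [one_mul]
      · rw [neg_one_mul, Real.cos_neg]
    have hsin : Real.sin (σ * (ρ * ξ.im)) = σ * Real.sin (ρ * ξ.im) := by
      rcases hσ with rfl | rfl
      · rw [one_mul, one_mul]
      · rw [neg_one_mul, Real.sin_neg, neg_one_mul]
    have hHre : H.re = -c₁ := by simp [hH]
    have hHim : H.im = -(σ * B) := by simp [hH]
    rw [h1, Complex.exp_add, ← Complex.ofReal_exp, Complex.exp_mul_I, ← Complex.ofReal_cos,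
      ← Complex.ofReal_sin, hcos, hsin, hpow, Complex.neg_re, Complex.mul_re, hHre, hHim]
    simp only [Complex.mul_re, Complex.mul_im, Complex.add_re, Complex.add_im, Complex.ofReal_re,
      Complex.ofReal_im, Complex.I_re, Complex.I_im]
    linear_combination (-B * Real.sin (ρ * ξ.im) * Real.exp (ρ * σ * ξ.re)) * hσ2
  have hnorm : ∀ ξ : ℂ, ‖f ξ‖ = ‖g (ray (θ + σ * ξ.im) (Real.exp (σ * ξ.re)))‖ *
      Real.exp ((c₁ * Real.cos (ρ * ξ.im) - B * Real.sin (ρ * ξ.im)) *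
        Real.exp (σ * ξ.re) ^ ρ) := by
    intro ξ
    rw [hf]
    simp only
    rw [norm_mul, Complex.norm_exp, hEre, hray]
  have hgr : ∀ ξ : ℂ, ‖g (ray (θ + σ * ξ.im) (Real.exp (σ * ξ.re)))‖ ≤
      K * Real.exp (B * Real.exp (σ * ξ.re) ^ ρ) := by
    intro ξ
    have := hgrow (ray (θ + σ * ξ.im) (Real.exp (σ * ξ.re)))
    rwa [norm_ray (Real.exp_pos _).le] at this
  have hw : 0 < Real.pi / (2 * ρ) := by positivity
  have key : ∀ ξ : ℂ, 0 ≤ ξ.im → ξ.im ≤ Real.pi / (2 * ρ) → ‖f ξ‖ ≤ K := by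
    intro ξ h0 h1
    refine PhragmenLindelof.horizontal_strip (a := 0) (b := Real.pi / (2 * ρ)) ?_ ?_ ?_ ?_ h0 h1
    · refine Differentiable.diffContOnCl ?_
      have hg' : Differentiable ℂ fun ξ : ℂ => g (dir θ * Complex.exp (σ * ξ)) :=
        hg.comp (by fun_prop)
      exact hg'.mul (by fun_prop)
    -- A strip of width π/(2ρ) permits growth exp(C·exp(c|Re ξ|)) for every c < 2ρ; here c = ρ.
    · refine ⟨ρ, ?_, B + (c₁ + B), ?_⟩
      · rw [sub_zero, div_div_cancel₀ Real.pi_ne_zero]; linarith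
      · refine Asymptotics.IsBigO.of_bound K (Eventually.of_forall fun ξ => ?_)
        rw [hnorm, Real.norm_eq_abs, Real.abs_exp, add_mul, Real.exp_add, ← mul_assoc]
        have hle : Real.exp (σ * ξ.re) ^ ρ ≤ Real.exp (ρ * |ξ.re|) := by
          rw [hpow]
          refine Real.exp_le_exp.mpr ?_
          rw [mul_assoc]
          refine mul_le_mul_of_nonneg_left ((le_abs_self _).trans ?_) hρ.le
          rw [abs_mul, hσabs, one_mul]
        have hE := Real.exp_pos (σ * ξ.re)
        have hpos : 0 ≤ Real.exp (σ * ξ.re) ^ ρ := by positivity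
        have hco : c₁ * Real.cos (ρ * ξ.im) - B * Real.sin (ρ * ξ.im) ≤ c₁ + B := by
          nlinarith [Real.cos_le_one (ρ * ξ.im), Real.neg_one_le_sin (ρ * ξ.im)]
        refine mul_le_mul ((hgr ξ).trans ?_) (Real.exp_le_exp.mpr ?_) (Real.exp_pos _).le
          (by positivity)
        · gcongr
        · exact mul_le_mul hco hle hpos (by positivity)
    · intro ξ hξ
      rw [hnorm, hξ, mul_zero, mul_zero, add_zero, Real.cos_zero, Real.sin_zero, mul_one, mul_zero,
        sub_zero]
      calc _ ≤ K * Real.exp (-(c₁ * Real.exp (σ * ξ.re) ^ ρ)) *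
            Real.exp (c₁ * Real.exp (σ * ξ.re) ^ ρ) := by
            gcongr; exact hdec _ (Real.exp_pos _).le
        _ = K := by rw [mul_assoc, ← Real.exp_add, neg_add_cancel, Real.exp_zero, mul_one]
    · intro ξ hξ
      have h1 : ρ * (Real.pi / (2 * ρ)) = Real.pi / 2 := by field_simp
      have h2 := hgr ξ
      rw [hξ] at h2
      rw [hnorm, hξ, h1, Real.cos_pi_div_two, Real.sin_pi_div_two, mul_zero, mul_one, zero_sub]
      calc _ ≤ K * Real.exp (B * Real.exp (σ * ξ.re) ^ ρ) *
            Real.exp (-B * Real.exp (σ * ξ.re) ^ ρ) := by gcongr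
        _ = K := by rw [mul_assoc, ← Real.exp_add, ← add_mul, add_neg_cancel, zero_mul,
              Real.exp_zero, mul_one]
  have h1 := key ⟨σ * Real.log r, φ⟩ hφ hφ'
  rw [hnorm] at h1
  simp only at h1
  rw [← mul_assoc, ← sq, hσ2, one_mul, Real.exp_log hr] at h1
  rw [Real.exp_neg, ← div_eq_mul_inv, le_div_iff₀ (Real.exp_pos _)]
  exact h1

lemma IsSolution.exists_growth {P : ℂ[X]} {lam : ℂ} {n : ℕ} (hn : P.natDegree ≤ n) :
    ∃ B : ℝ, 0 ≤ B ∧ ∀ y, IsSolution P lam y → ∃ K : ℝ, 0 ≤ K ∧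
      ∀ z, ‖y z‖ ≤ K * Real.exp (B * ‖z‖ ^ ((n : ℝ) / 2 + 1)) := by
  obtain ⟨B₀, hB₀, hB⟩ := exists_eval_bound P lam hn
  set ρ : ℝ := (n : ℝ) / 2 + 1 with hρ
  have hρ0 : 0 ≤ ρ := by positivity
  set A := (B₀ + n + 1) * 2 ^ ρ / 2 with hA
  have hA0 : 0 ≤ A := by positivity
  refine ⟨A, hA0, fun y hy => ⟨√(‖y 0‖ ^ 2 + ‖deriv y 0‖ ^ 2) * Real.exp A, by positivity,
    fun z => ?_⟩⟩
  have h1 := norm_sq_solution_le hB₀ hB hy z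
  have h2 : (1 + ‖z‖) ^ ρ ≤ 2 ^ ρ * (1 + ‖z‖ ^ ρ) := by
    have hz := norm_nonneg z
    have hzρ : 0 ≤ ‖z‖ ^ ρ := by positivity
    rcases le_total ‖z‖ 1 with h | h
    · calc (1 + ‖z‖) ^ ρ ≤ 2 ^ ρ := Real.rpow_le_rpow (by positivity) (by linarith) hρ0
        _ ≤ 2 ^ ρ * (1 + ‖z‖ ^ ρ) := le_mul_of_one_le_right (by positivity) (by linarith)
    · calc (1 + ‖z‖) ^ ρ ≤ (2 * ‖z‖) ^ ρ := Real.rpow_le_rpow (by positivity) (by linarith) hρ0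
        _ = 2 ^ ρ * ‖z‖ ^ ρ := Real.mul_rpow (by norm_num) hz
        _ ≤ 2 ^ ρ * (1 + ‖z‖ ^ ρ) := by gcongr; linarith
  refine le_of_sq_le_sq (h1.trans ?_) (by positivity)
  rw [mul_pow, mul_pow, Real.sq_sqrt (by positivity), mul_assoc, ← Real.exp_nat_mul,
    ← Real.exp_nat_mul, ← Real.exp_add]
  refine mul_le_mul_of_nonneg_left (Real.exp_le_exp.mpr ?_) (by positivity)
  calc (B₀ + n + 1) * (1 + ‖z‖) ^ ρ ≤ (B₀ + n + 1) * (2 ^ ρ * (1 + ‖z‖ ^ ρ)) := by gcongr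
    _ = _ := by rw [hA]; push_cast; ring

/-- The admissible step length is the same everywhere on the segment, so finitely many steps join a
to b. -/
lemma of_small_steps {p : ℝ → Prop} {a b η : ℝ} (hη : 0 < η)
    (h : ∀ x ∈ Set.uIcc a b, ∀ x' ∈ Set.uIcc a b, |x' - x| ≤ η → p x → p x') (ha : p a) :
    p b := by
  obtain ⟨N, hN⟩ := exists_nat_gt (|b - a| / η)
  have hN0 : (0 : ℝ) < N := lt_of_le_of_lt (by positivity) hN
  have hmem : ∀ j : ℕ, j ≤ N → a + j / N * (b - a) ∈ Set.uIcc a b := by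
    intro j hj
    have h1 : (j : ℝ) / N ≤ 1 := (div_le_one hN0).mpr (by exact_mod_cast hj)
    have h2 : 0 ≤ (j : ℝ) / N := by positivity
    rw [← segment_eq_uIcc, segment_eq_image']
    exact ⟨_, ⟨h2, h1⟩, by simp⟩
  have hind : ∀ j : ℕ, j ≤ N → p (a + j / N * (b - a)) := by
    intro j
    induction j with
    | zero => intro _; simpa using ha
    | succ j ih =>
      intro hj
      refine h _ (hmem j (by omega)) _ (hmem (j + 1) hj) ?_ (ih (by omega))
      have : a + ((j + 1 : ℕ) : ℝ) / N * (b - a) - (a + j / N * (b - a)) = (b - a) / N := by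
        push_cast; field_simp; ring
      rw [this, abs_div, abs_of_pos hN0, div_le_iff₀ hN0]
      rw [div_lt_iff₀ hη] at hN
      linarith
  have := hind N le_rfl
  rw [div_self hN0.ne'] at this
  simpa using this

/-- Decay of a solution does not change when the ray is rotated without meeting the
separating directions. -/
theorem decaysOn_of_segment {P : ℂ[X]} (hn : 1 ≤ P.natDegree) {c₀ : ℝ} (hc₀ : 0 < c₀) {a b : ℝ}
    (hseg : ∀ x ∈ Set.uIcc a b, 2 * c₀ * ‖P.leadingCoeff‖ ≤
      ‖P.leadingCoeff‖ + (P.leadingCoeff * dir x ^ (P.natDegree + 2)).re)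
    {lam : ℂ} {y : ℂ → ℂ} (hy : IsSolution P lam y) (hdec : DecaysOn a y) : DecaysOn b y := by
  obtain ⟨c, C, R, hgood⟩ := exists_goodRay_of_leading hn hc₀
  obtain ⟨B, hB, hgrow⟩ := IsSolution.exists_growth (P := P) (lam := lam) le_rfl
  obtain ⟨K₀, hK₀, hK⟩ := hgrow y hy
  have hP : P ≠ 0 := by rintro rfl; simp at hn
  have hlpos : 0 < ‖P.leadingCoeff‖ := norm_pos_iff.mpr (leadingCoeff_ne_zero.mpr hP)
  have hc : 0 < c := (hgood a (hseg a Set.left_mem_uIcc)).1.hc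
  set ρ : ℝ := (P.natDegree : ℝ) / 2 + 1 with hρ
  have hρ0 : 0 < ρ := by positivity
  set c₁ := √(c / 2) / 2 * √(‖P.leadingCoeff‖ / 2) / ρ with hc₁
  have hc₁0 : 0 < c₁ := by
    have h1 : 0 < √(c / 2) := Real.sqrt_pos.mpr (by positivity)
    have h2 : 0 < √(‖P.leadingCoeff‖ / 2) := Real.sqrt_pos.mpr (by positivity)
    positivity
  -- The angle η depends only on c₁, B and ρ, which are common to all rays of the segment.
  obtain ⟨η, hη, hηlt⟩ : ∃ η > 0, ∀ φ, |φ| < η →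
      0 < c₁ * Real.cos (ρ * φ) - B * Real.sin (ρ * φ) := by
    have hcont : Continuous fun φ => c₁ * Real.cos (ρ * φ) - B * Real.sin (ρ * φ) := by fun_prop
    have h0 : 0 < c₁ * Real.cos (ρ * 0) - B * Real.sin (ρ * 0) := by simpa using hc₁0
    obtain ⟨η, hη, hball⟩ := Metric.eventually_nhds_iff.mp
      (hcont.continuousAt.eventually (lt_mem_nhds h0))
    exact ⟨η, hη, fun φ hφ => hball (by simpa using hφ)⟩
  refine of_small_steps (p := fun x => DecaysOn x y) (η := min (η / 2) (Real.pi / (2 * ρ)))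
    (lt_min (by positivity) (by positivity)) (fun x hx x' _ hxx' hdx => ?_) hdec
  obtain ⟨hgr, hlow⟩ := hgood x (hseg x hx)
  -- Mere decay at x already implies decay with the full rate c₁, so no rate is lost from one step
  -- to the next; only the constant changes.
  obtain ⟨K₁, hK₁, hrate⟩ := hgr.exists_rate hy hdx (by positivity) hlow
  obtain ⟨σ, hσ, hσx⟩ : ∃ σ : ℝ, (σ = 1 ∨ σ = -1) ∧ x' = x + σ * |x' - x| := by
    rcases le_total 0 (x' - x) with h | h
    · exact ⟨1, Or.inl rfl, by rw [abs_of_nonneg h]; ring⟩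
    · exact ⟨-1, Or.inr rfl, by rw [abs_of_nonpos h]; ring⟩
  set φ := |x' - x| with hφ
  have hφ1 : φ < η := by linarith [min_le_left (η / 2) (Real.pi / (2 * ρ))]
  have hkey : ∀ r : ℝ, 0 < r → ‖y (ray x' r)‖ ≤ max K₀ K₁ *
      Real.exp (-((c₁ * Real.cos (ρ * φ) - B * Real.sin (ρ * φ)) * r ^ ρ)) := fun r hr => by
    rw [hσx]
    refine norm_le_of_decay_on_ray hy.1 hρ0 hσ (le_max_of_le_left hK₀) hB hc₁0.le
      (fun z => (hK z).trans ?_) (fun r hr => (hrate r hr).trans ?_) (abs_nonneg _)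
      (hxx'.trans (min_le_right _ _)) hr
    · gcongr; exact le_max_left _ _
    · gcongr; exact le_max_right _ _
  have hpos := hηlt φ (by rwa [abs_of_nonneg (abs_nonneg _)])
  set q := c₁ * Real.cos (ρ * φ) - B * Real.sin (ρ * φ) with hq
  refine squeeze_zero_norm' ((eventually_gt_atTop 0).mono hkey) ?_
  have h1 : Tendsto (fun r : ℝ => q * r ^ ρ) atTop atTop :=
    (tendsto_rpow_atTop hρ0).const_mul_atTop hpos
  simpa using (Real.tendsto_exp_neg_atTop_nhds_zero.comp h1).const_mul (max K₀ K₁)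

/-! ### Centres of the Stokes sectors -/

/-- The direction of the bisector of the Stokes sector containing the direction `θ`. -/
def centre (P : ℂ[X]) (θ : ℝ) : ℝ :=
  θ - (P.leadingCoeff * dir θ ^ (P.natDegree + 2)).arg / (P.natDegree + 2 : ℕ)

/-- Rotating the ray by an s-fraction of the way to the bisector multiplies the argument of the
leading term by 1 - s; s = 1 is the bisector, where the leading term is positive. -/
lemma leading_mul_dir (P : ℂ[X]) (θ s : ℝ) :
    P.leadingCoeff *
      dir (θ - s * ((P.leadingCoeff * dir θ ^ (P.natDegree + 2)).arg / (P.natDegree + 2 : ℕ))) ^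
        (P.natDegree + 2) =
      ‖P.leadingCoeff‖ * dir ((1 - s) * (P.leadingCoeff * dir θ ^ (P.natDegree + 2)).arg) := by
  set w := P.leadingCoeff * dir θ ^ (P.natDegree + 2) with hw
  have hwn : ‖w‖ = ‖P.leadingCoeff‖ := by rw [hw, norm_mul, norm_pow, norm_dir]; simp
  have h1 : w = ‖P.leadingCoeff‖ * dir w.arg := by
    rw [← hwn]; exact (Complex.norm_mul_exp_arg_mul_I w).symm
  have hN : ((P.natDegree + 2 : ℕ) : ℝ) ≠ 0 := by positivity
  rw [sub_eq_add_neg, dir_add, mul_pow, ← mul_assoc, ← hw, dir_pow]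
  have h2 : ∀ β, w * dir β = ‖P.leadingCoeff‖ * (dir w.arg * dir β) := fun β => by
    rw [← mul_assoc, ← h1]
  rw [h2, ← dir_add]
  congr 2
  field_simp
  ring

lemma leading_mul_dir_centre (P : ℂ[X]) (θ : ℝ) :
    P.leadingCoeff * dir (centre P θ) ^ (P.natDegree + 2) = ‖P.leadingCoeff‖ := by
  have := leading_mul_dir P θ 1
  rw [one_mul, sub_self, zero_mul] at this
  rw [centre, this, dir]; simp

lemma mem_uIcc_centre {P : ℂ[X]} {θ x : ℝ} (hx : x ∈ Set.uIcc θ (centre P θ)) :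
    ∃ s : ℝ, 0 ≤ s ∧ s ≤ 1 ∧
      x = θ - s * ((P.leadingCoeff * dir θ ^ (P.natDegree + 2)).arg / (P.natDegree + 2 : ℕ)) := by
  rw [← segment_eq_uIcc, segment_eq_image'] at hx
  obtain ⟨s, ⟨h0, h1⟩, rfl⟩ := hx
  refine ⟨s, h0, h1, ?_⟩
  simp only [centre, smul_eq_mul]; ring

lemma mem_slitPlane_of_not_isSeparating {P : ℂ[X]} (hP : P ≠ 0) {θ : ℝ} (h : ¬ IsSeparating P θ) :
    P.leadingCoeff * dir θ ^ (P.natDegree + 2) ∈ Complex.slitPlane := by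
  rw [Complex.mem_slitPlane_iff]
  by_contra hcon
  push Not at hcon
  refine h ⟨lt_of_le_of_ne hcon.1 fun h0 => ?_, hcon.2⟩
  exact mul_ne_zero (leadingCoeff_ne_zero.mpr hP) (pow_ne_zero _ (dir_ne_zero θ))
    (Complex.ext h0 hcon.2)

/-- On the way to the bisector the argument of the leading term shrinks in absolute value from |α| <
π to 0, so its cosine never falls below cos α > -1. -/
lemma exists_segment_bound {P : ℂ[X]} (hP : P ≠ 0) {θ : ℝ} (h : ¬ IsSeparating P θ) :
    ∃ c₀ : ℝ, 0 < c₀ ∧ ∀ x ∈ Set.uIcc θ (centre P θ), 2 * c₀ * ‖P.leadingCoeff‖ ≤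
      ‖P.leadingCoeff‖ + (P.leadingCoeff * dir x ^ (P.natDegree + 2)).re := by
  have hlpos : 0 < ‖P.leadingCoeff‖ := norm_pos_iff.mpr (leadingCoeff_ne_zero.mpr hP)
  set α := (P.leadingCoeff * dir θ ^ (P.natDegree + 2)).arg with hα
  have hαpi : |α| < Real.pi := by
    refine lt_of_le_of_ne (Complex.abs_arg_le_pi _) fun heq => ?_
    have hne := (Complex.mem_slitPlane_iff_arg.mp (mem_slitPlane_of_not_isSeparating hP h)).1
    have hgt := Complex.neg_pi_lt_arg (P.leadingCoeff * dir θ ^ (P.natDegree + 2))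
    rcases abs_choice α with h' | h'
    · exact hne (by rw [← hα, ← h', heq])
    · rw [← hα] at hgt; linarith
  have hcos : -1 < Real.cos α := by
    rw [← Real.cos_abs, ← Real.cos_pi]
    exact Real.cos_lt_cos_of_nonneg_of_le_pi (abs_nonneg _) le_rfl hαpi
  refine ⟨(1 + Real.cos α) / 2, by linarith, fun x hx => ?_⟩
  obtain ⟨s, h0, h1, rfl⟩ := mem_uIcc_centre hx
  have hre : (dir ((1 - s) * α)).re = Real.cos ((1 - s) * α) := by
    rw [dir, Complex.exp_ofReal_mul_I_re]
  rw [leading_mul_dir, Complex.re_ofReal_mul, ← hα, hre]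
  have hle : Real.cos α ≤ Real.cos ((1 - s) * α) := by
    rw [← Real.cos_abs α, ← Real.cos_abs ((1 - s) * α)]
    refine Real.cos_le_cos_of_nonneg_of_le_pi (abs_nonneg _) hαpi.le ?_
    rw [abs_mul, abs_of_nonneg (by linarith : 0 ≤ 1 - s)]
    exact mul_le_of_le_one_left (abs_nonneg _) (by linarith)
  nlinarith

/-- A solution decays on a ray if and only if it decays on the bisector of its Stokes sector. -/
theorem decaysOn_centre_iff {P : ℂ[X]} (hn : 1 ≤ P.natDegree) {θ : ℝ} (h : ¬ IsSeparating P θ)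
    {lam : ℂ} {y : ℂ → ℂ} (hy : IsSolution P lam y) :
    DecaysOn (centre P θ) y ↔ DecaysOn θ y := by
  have hP : P ≠ 0 := by rintro rfl; simp at hn
  obtain ⟨c₀, hc₀, hseg⟩ := exists_segment_bound hP h
  exact ⟨decaysOn_of_segment hn hc₀ (by rwa [Set.uIcc_comm]) hy,
    decaysOn_of_segment hn hc₀ hseg hy⟩

/-- Directions with the same centre lie in the same Stokes sector. -/
theorem sameStokesSector_of_centre {P : ℂ[X]} (hP : P ≠ 0) {θ₁ θ₂ : ℝ}
    (h₁ : ¬ IsSeparating P θ₁) (h₂ : ¬ IsSeparating P θ₂)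
    (h : dir (centre P θ₁) = dir (centre P θ₂)) : SameStokesSector P θ₁ θ₂ := by
  set U := {z : ℂ | P.leadingCoeff * z ^ (P.natDegree + 2) ∈ Complex.slitPlane} with hU
  have hlpos : 0 < ‖P.leadingCoeff‖ := norm_pos_iff.mpr (leadingCoeff_ne_zero.mpr hP)
  have hdir : Continuous dir := by unfold dir; fun_prop
  have key : ∀ θ, ¬ IsSeparating P θ →
      dir (centre P θ) ∈ connectedComponentIn U (dir θ) := by
    intro θ hθ
    obtain ⟨c₀, hc₀, hseg⟩ := exists_segment_bound hP hθ
    have hpre : IsPreconnected (dir '' Set.uIcc θ (centre P θ)) :=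
      isPreconnected_uIcc.image _ hdir.continuousOn
    refine hpre.subset_connectedComponentIn ⟨θ, Set.left_mem_uIcc, rfl⟩ ?_
      ⟨_, Set.right_mem_uIcc, rfl⟩
    rintro _ ⟨x, hx, rfl⟩
    refine mem_slitPlane_of_sector (mul_ne_zero (leadingCoeff_ne_zero.mpr hP)
      (pow_ne_zero _ (dir_ne_zero x))) (mul_pos two_pos hc₀) ?_
    have hnorm : ‖P.leadingCoeff * dir x ^ (P.natDegree + 2)‖ = ‖P.leadingCoeff‖ := by
      rw [norm_mul, norm_pow, norm_dir]; simp
    rw [hnorm]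
    exact hseg x hx
  have k₁ := key θ₁ h₁
  have k₂ := key θ₂ h₂
  rw [← h] at k₂
  rw [SameStokesSector, ← hU, connectedComponentIn_eq k₁, ← connectedComponentIn_eq k₂]
  exact mem_connectedComponentIn (mem_slitPlane_of_not_isSeparating hP h₂)

/-! ### A number that is not an eigenvalue -/

/-- Monotonicity of the energy flux `Re (e y' ȳ)` along a ray. -/
lemma flux_nonpos {P : ℂ[X]} {lam e : ℂ} {θ : ℝ} {y : ℂ → ℂ} (hy : IsSolution P lam y)
    (hτ : 0 < (e * (starRingEnd ℂ) (dir θ)).re)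
    (hpot : ∀ r, 0 ≤ r → 0 < (e * dir θ * (P.eval (ray θ r) - lam)).re)
    (hlim : Tendsto (fun r => deriv y (ray θ r) * (starRingEnd ℂ) (y (ray θ r))) atTop (𝓝 0)) :
    (e * (deriv y 0 * (starRingEnd ℂ) (y 0))).re ≤ 0 ∧
      ((e * (deriv y 0 * (starRingEnd ℂ) (y 0))).re = 0 → y = 0) := by
  set F : ℝ → ℝ := fun r => (e * (deriv y (ray θ r) * (starRingEnd ℂ) (y (ray θ r)))).re with hF
  set F' : ℝ → ℝ := fun r => (e * dir θ * (P.eval (ray θ r) - lam)).re * ‖y (ray θ r)‖ ^ 2 +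
    (e * (starRingEnd ℂ) (dir θ)).re * ‖deriv y (ray θ r)‖ ^ 2 with hF'
  have hd : ∀ r, HasDerivAt F (F' r) r := by
    intro r
    have h1 : HasDerivAt (fun r => deriv y (ray θ r))
        (dir θ * ((P.eval (ray θ r) - lam) * y (ray θ r))) r := by
      have := (hy.hasDerivAt_deriv (ray θ r)).comp_of_eq r (hasDerivAt_ray θ r) rfl
      rw [mul_comm]; exact this
    have h2 : HasDerivAt (fun r => (starRingEnd ℂ) (y (ray θ r)))
        ((starRingEnd ℂ) (dir θ * deriv y (ray θ r))) r := (hy.hasDerivAt_ray θ r).star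
    have h3 := (h1.mul h2).const_mul e
    have h4 := Complex.reCLM.hasFDerivAt.comp_hasDerivAt r h3
    refine h4.congr_deriv ?_
    have n1 : y (ray θ r) * (starRingEnd ℂ) (y (ray θ r)) = ((‖y (ray θ r)‖ ^ 2 : ℝ) : ℂ) := by
      rw [Complex.mul_conj, Complex.normSq_eq_norm_sq]
    have n2 : deriv y (ray θ r) * (starRingEnd ℂ) (deriv y (ray θ r)) =
        ((‖deriv y (ray θ r)‖ ^ 2 : ℝ) : ℂ) := by
      rw [Complex.mul_conj, Complex.normSq_eq_norm_sq]
    have e1 : e * (dir θ * ((P.eval (ray θ r) - lam) * y (ray θ r)) *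
          (starRingEnd ℂ) (y (ray θ r)) +
        deriv y (ray θ r) * (starRingEnd ℂ) (dir θ * deriv y (ray θ r))) =
        e * dir θ * (P.eval (ray θ r) - lam) * ((‖y (ray θ r)‖ ^ 2 : ℝ) : ℂ) +
        e * (starRingEnd ℂ) (dir θ) * ((‖deriv y (ray θ r)‖ ^ 2 : ℝ) : ℂ) := by
      rw [← n1, ← n2, map_mul]; ring
    rw [Complex.reCLM_apply, e1, Complex.add_re, Complex.re_mul_ofReal, Complex.re_mul_ofReal]
  have hF'0 : ∀ r, 0 ≤ r → 0 ≤ F' r := fun r hr =>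
    add_nonneg (mul_nonneg (hpot r hr).le (by positivity)) (by positivity)
  have hmono : MonotoneOn F (Set.Ici 0) := by
    refine monotoneOn_of_hasDerivWithinAt_nonneg (convex_Ici 0)
      (fun r _ => (hd r).continuousAt.continuousWithinAt)
      (fun r _ => (hd r).hasDerivWithinAt) fun r hr => ?_
    rw [interior_Ici] at hr
    exact hF'0 r (le_of_lt hr)
  have hFlim : Tendsto F atTop (𝓝 0) := by
    have := (Complex.continuous_re.tendsto _).comp (hlim.const_mul e)
    rwa [mul_zero, Complex.zero_re] at this
  have hle : ∀ r, 0 ≤ r → F r ≤ 0 := fun r hr =>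
    ge_of_tendsto hFlim ((eventually_ge_atTop r).mono fun s hs =>
      hmono hr (Set.mem_Ici.mpr (hr.trans hs)) hs)
  have hray0 : ray θ 0 = 0 := by simp [ray]
  have hF0 : F 0 = (e * (deriv y 0 * (starRingEnd ℂ) (y 0))).re := by rw [hF]; simp only [hray0]
  rw [← hF0]
  refine ⟨hle 0 le_rfl, fun h0 => ?_⟩
  -- The flux is nondecreasing and at most zero; starting at zero it is constant, so both
  -- nonnegative terms of its derivative vanish at the origin and the Cauchy data there are zero.
  have hzero : ∀ r ∈ Set.Ici (0 : ℝ), F r = 0 := fun r hr =>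
    le_antisymm (hle r hr) (h0 ▸ hmono (Set.mem_Ici.mpr le_rfl) hr hr)
  have hF'eq : F' 0 = 0 := by
    have h1 : HasDerivWithinAt F (F' 0) (Set.Ici 0) 0 := (hd 0).hasDerivWithinAt
    have h2 : HasDerivWithinAt F 0 (Set.Ici 0) 0 :=
      (hasDerivWithinAt_const (0 : ℝ) (Set.Ici 0) (0 : ℝ)).congr hzero (hzero 0 (by simp))
    exact (uniqueDiffOn_Ici (0 : ℝ) 0 (by simp)).eq_deriv _ h1 h2
  have hp := hpot 0 le_rfl
  simp only [hF', hray0] at hF'eq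
  rw [hray0] at hp
  have a1 : 0 ≤ (e * dir θ * (P.eval 0 - lam)).re * ‖y 0‖ ^ 2 := by positivity
  have a2 : 0 ≤ (e * (starRingEnd ℂ) (dir θ)).re * ‖deriv y 0‖ ^ 2 := by positivity
  have z1 : (e * dir θ * (P.eval 0 - lam)).re * ‖y 0‖ ^ 2 = 0 := by linarith
  have z2 : (e * (starRingEnd ℂ) (dir θ)).re * ‖deriv y 0‖ ^ 2 = 0 := by linarith
  refine hy.eq_zero ?_ ?_
  · exact norm_eq_zero.mp (pow_eq_zero_iff two_ne_zero |>.mp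
      ((mul_eq_zero.mp z1).resolve_left hp.ne'))
  · exact norm_eq_zero.mp (pow_eq_zero_iff two_ne_zero |>.mp
      ((mul_eq_zero.mp z2).resolve_left hτ.ne'))

lemma conj_dir_mul_dir (θ : ℝ) : (starRingEnd ℂ) (dir θ) * dir θ = 1 := by
  rw [mul_comm, Complex.mul_conj, Complex.normSq_eq_norm_sq, norm_dir]; simp

/-- On a bisector the leading part of e·e^{iκ}P(re^{iκ}) is e·e^{-iκ}|l|r^n with positive real part
τ|l|r^n. Far out the other terms are at most this large, and near the origin compactness gives the
bound. -/
lemma exists_re_lower_bound {P : ℂ[X]} (hn : 1 ≤ P.natDegree) {κ : ℝ}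
    (hl : P.leadingCoeff * dir κ ^ (P.natDegree + 2) = ‖P.leadingCoeff‖) {e : ℂ}
    (hτ : 0 < (e * (starRingEnd ℂ) (dir κ)).re) :
    ∃ M : ℝ, ∀ r, 0 ≤ r → -M ≤ (e * dir κ * P.eval (ray κ r)).re := by
  set τ := (e * (starRingEnd ℂ) (dir κ)).re with hτdef
  have he : e ≠ 0 := by rintro rfl; simp [hτdef] at hτ
  have hepos : 0 < ‖e‖ := norm_pos_iff.mpr he
  have hcont : Continuous fun r => (e * dir κ * P.eval (ray κ r)).re :=
    Complex.continuous_re.comp (continuous_const.mul (P.continuous.comp (continuous_ray κ)))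
  obtain ⟨R, hR, hlow⟩ := exists_lower_terms_le hn (div_pos hτ hepos)
  obtain ⟨M, hM⟩ := (isCompact_Icc (a := (0 : ℝ)) (b := R)).exists_bound_of_continuousOn
    hcont.continuousOn
  have hM0 : 0 ≤ M := (norm_nonneg _).trans (hM 0 ⟨le_rfl, by linarith⟩)
  refine ⟨M, fun r hr => ?_⟩
  rcases le_total r R with h | h
  · have := hM r ⟨hr, h⟩
    rw [Real.norm_eq_abs] at this
    exact (abs_le.mp this).1
  · have h1 := (norm_rayPot_sub_leading_le P κ hr).trans (hlow r h)
    rw [hl] at h1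
    set E := rayPot P κ r - (‖P.leadingCoeff‖ : ℂ) * (r ^ P.natDegree : ℝ) with hE
    have e1 : e * dir κ * P.eval (ray κ r) = e * (starRingEnd ℂ) (dir κ) *
        ((‖P.leadingCoeff‖ * r ^ P.natDegree : ℝ) : ℂ) + e * (starRingEnd ℂ) (dir κ) * E := by
      rw [hE, rayPot]
      push_cast
      linear_combination (-e * dir κ * P.eval (ray κ r)) * conj_dir_mul_dir κ
    have h2 : ‖e * (starRingEnd ℂ) (dir κ) * E‖ ≤ τ * (‖P.leadingCoeff‖ * r ^ P.natDegree) := by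
      rw [norm_mul, norm_mul, RCLike.norm_conj, norm_dir, mul_one]
      calc ‖e‖ * ‖E‖ ≤ ‖e‖ * (τ / ‖e‖ * ‖P.leadingCoeff‖ * r ^ P.natDegree) := by gcongr
        _ = _ := by field_simp
    have h3 := (abs_le.mp (Complex.abs_re_le_norm (e * (starRingEnd ℂ) (dir κ) * E))).1
    rw [e1, Complex.add_re, Complex.re_mul_ofReal]
    linarith

/-- If two bisectors of Stokes sectors are different, then there is a number which is not an
eigenvalue of the corresponding boundary value problem. -/
theorem exists_not_eigenvalue {P : ℂ[X]} (hn : 1 ≤ P.natDegree) {κ₁ κ₂ : ℝ}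
    (hl₁ : P.leadingCoeff * dir κ₁ ^ (P.natDegree + 2) = ‖P.leadingCoeff‖)
    (hl₂ : P.leadingCoeff * dir κ₂ ^ (P.natDegree + 2) = ‖P.leadingCoeff‖)
    (hne : dir κ₁ ≠ dir κ₂) :
    ∃ lam : ℂ, ∀ y, IsSolution P lam y → DecaysOn κ₁ y → DecaysOn κ₂ y → y = 0 := by
  -- With this e both Re(e·e^{-iκ₁}) and Re(-e·e^{-iκ₂}) are positive. The fluxes with factors e and
  -- -e are then monotone on the two bisectors and have opposite values at the origin, and both must
  -- be at most zero.
  set e := dir κ₁ - dir κ₂ with he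
  have he0 : e ≠ 0 := sub_ne_zero.mpr hne
  have hepos : 0 < ‖e‖ ^ 2 := by positivity
  have hnsq : ∀ θ, (dir θ).re * (dir θ).re + (dir θ).im * (dir θ).im = 1 := fun θ => by
    rw [← Complex.normSq_apply, Complex.normSq_eq_norm_sq, norm_dir, one_pow]
  have hesq : ‖e‖ ^ 2 = ((dir κ₁).re - (dir κ₂).re) ^ 2 + ((dir κ₁).im - (dir κ₂).im) ^ 2 := by
    rw [← Complex.normSq_eq_norm_sq, Complex.normSq_apply, he, Complex.sub_re, Complex.sub_im]; ring
  have hτ₁ : 0 < (e * (starRingEnd ℂ) (dir κ₁)).re := by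
    simp only [Complex.mul_re, Complex.conj_re, Complex.conj_im, he, Complex.sub_re,
      Complex.sub_im]
    nlinarith [hnsq κ₁, hnsq κ₂]
  have hτ₂ : 0 < (-e * (starRingEnd ℂ) (dir κ₂)).re := by
    simp only [Complex.mul_re, Complex.conj_re, Complex.conj_im, he, Complex.sub_re,
      Complex.sub_im, Complex.neg_re, Complex.neg_im]
    nlinarith [hnsq κ₁, hnsq κ₂]
  obtain ⟨M₁, hM₁⟩ := exists_re_lower_bound hn hl₁ hτ₁
  obtain ⟨M₂, hM₂⟩ := exists_re_lower_bound hn hl₂ hτ₂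
  set Λ : ℝ := (|M₁| + 1) / (e * (starRingEnd ℂ) (dir κ₁)).re +
    (|M₂| + 1) / (-e * (starRingEnd ℂ) (dir κ₂)).re with hΛ
  -- The choice λ = -Λ·ē/e makes -e·e^{iκ}λ equal to Λ times the conjugate of e·e^{-iκ}, whose real
  -- part is positive and large. Replacing e by -e does not change λ, so one λ serves both rays.
  have hpos : ∀ (e' : ℂ) (κ M : ℝ), e' ≠ 0 → M < Λ * (e' * (starRingEnd ℂ) (dir κ)).re →
      (∀ r, 0 ≤ r → -M ≤ (e' * dir κ * P.eval (ray κ r)).re) →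
      ∀ r, 0 ≤ r → 0 < (e' * dir κ *
        (P.eval (ray κ r) - -((Λ : ℂ) * ((starRingEnd ℂ) e' / e')))).re := by
    intro e' κ M he' hM hb r hr
    have h1 : e' * dir κ * (P.eval (ray κ r) - -((Λ : ℂ) * ((starRingEnd ℂ) e' / e'))) =
        e' * dir κ * P.eval (ray κ r) + (Λ : ℂ) * (starRingEnd ℂ) (e' * (starRingEnd ℂ) (dir κ)) := by
      rw [map_mul, Complex.conj_conj]
      field_simp
      ring
    rw [h1, Complex.add_re, Complex.re_ofReal_mul, Complex.conj_re]
    linarith [hb r hr]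
  have hΛ₁ : M₁ < Λ * (e * (starRingEnd ℂ) (dir κ₁)).re := by
    rw [hΛ, add_mul, div_mul_cancel₀ _ hτ₁.ne']
    have : 0 ≤ (|M₂| + 1) / (-e * (starRingEnd ℂ) (dir κ₂)).re *
      (e * (starRingEnd ℂ) (dir κ₁)).re := by positivity
    linarith [le_abs_self M₁]
  have hΛ₂ : M₂ < Λ * (-e * (starRingEnd ℂ) (dir κ₂)).re := by
    rw [hΛ, add_mul, div_mul_cancel₀ _ hτ₂.ne']
    have : 0 ≤ (|M₁| + 1) / (e * (starRingEnd ℂ) (dir κ₁)).re *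
      (-e * (starRingEnd ℂ) (dir κ₂)).re := by positivity
    linarith [le_abs_self M₂]
  have hp₁ := hpos e κ₁ M₁ he0 hΛ₁ hM₁
  have hp₂ := hpos (-e) κ₂ M₂ (neg_ne_zero.mpr he0) hΛ₂ hM₂
  rw [map_neg, neg_div_neg_eq] at hp₂
  refine ⟨-((Λ : ℂ) * ((starRingEnd ℂ) e / e)), fun y hy hd₁ hd₂ => ?_⟩
  obtain ⟨c, C, R, hgood⟩ := exists_goodRay_of_leading hn (one_pos : (0 : ℝ) < 1)
  have hgr : ∀ κ, P.leadingCoeff * dir κ ^ (P.natDegree + 2) = ‖P.leadingCoeff‖ →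
      GoodRay P κ c C R := fun κ hκ =>
    (hgood κ (by rw [hκ, Complex.ofReal_re]; linarith)).1
  obtain ⟨f₁, g₁⟩ := flux_nonpos hy hτ₁ hp₁ ((hgr κ₁ hl₁).tendsto_mul_deriv hy hd₁)
  obtain ⟨f₂, -⟩ := flux_nonpos hy hτ₂ hp₂ ((hgr κ₂ hl₂).tendsto_mul_deriv hy hd₂)
  rw [neg_mul, Complex.neg_re] at f₂
  exact g₁ (le_antisymm f₁ (by linarith))

/-! ### The spectral determinant -/

/-- Joint continuity at (x, z) supplies a product neighbourhood on which f p w and f x w are both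
ε/2-close to f x z. -/
lemma continuousEntireFamily_of_continuousOn {Y : Type*} [TopologicalSpace Y] {f : Y → ℂ → ℂ}
    {S : Set Y} (hd : ∀ x ∈ S, Differentiable ℂ (f x))
    (hc : ContinuousOn (Function.uncurry f) (S ×ˢ Set.univ)) : ContinuousEntireFamily f S := by
  refine ⟨hd, fun x hx => Metric.tendstoLocallyUniformly_iff.mpr fun ε hε z => ?_⟩
  have h1 := hc (x, z) ⟨hx, Set.mem_univ z⟩
  rw [ContinuousWithinAt, nhdsWithin_prod_eq, nhdsWithin_univ, Metric.tendsto_nhds] at h1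
  obtain ⟨U, hU, V, hV, hUV⟩ := mem_prod_iff.mp (h1 (ε / 2) (half_pos hε))
  refine ⟨V, hV, ?_⟩
  filter_upwards [hU] with p hp w hw
  have a1 : dist (f p w) (f x z) < ε / 2 := hUV (Set.mk_mem_prod hp hw)
  have a2 : dist (f x w) (f x z) < ε / 2 :=
    hUV (Set.mk_mem_prod (mem_of_mem_nhdsWithin hx hU) hw)
  linarith [dist_triangle_right (f x w) (f p w) (f x z)]

/-- An eigenfunction is a nonzero multiple of both decaying solutions, which makes them
proportional; conversely, a vanishing Wronskian makes Y₂ a multiple of Y₁, so that Y₂ decays on both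
rays. -/
lemma mem_eigenvalues_iff {P : ℂ[X]} {θ₁ θ₂ c₁ C₁ R₁ c₂ C₂ R₂ : ℝ} {lam : ℂ} {Y₁ Y₂ : ℂ → ℂ}
    (g₁ : GoodRay P θ₁ c₁ C₁ R₁) (g₂ : GoodRay P θ₂ c₂ C₂ R₂) (h₁ : IsSolution P lam Y₁)
    (h₂ : IsSolution P lam Y₂) (l₁ : Tendsto (ratio P θ₁ R₁ lam Y₁) atTop (𝓝 1))
    (l₂ : Tendsto (ratio P θ₂ R₂ lam Y₂) atTop (𝓝 1)) :
    lam ∈ eigenvalues P θ₁ θ₂ ↔ deriv Y₁ 0 * Y₂ 0 - Y₁ 0 * deriv Y₂ 0 = 0 := by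
  constructor
  · rintro ⟨y, hne, hy, hd₁, hd₂⟩
    obtain ⟨k₁, hk₁⟩ := g₁.eq_const_mul h₁ l₁ hy hd₁
    obtain ⟨k₂, hk₂⟩ := g₂.eq_const_mul h₂ l₂ hy hd₂
    have hk₁0 : k₁ ≠ 0 := by
      rintro rfl
      exact hne (by rw [hk₁]; funext z; simp)
    have hk₂0 : k₂ ≠ 0 := by
      rintro rfl
      exact hne (by rw [hk₂]; funext z; simp)
    have a₁ : y 0 = k₁ * Y₁ 0 := congrFun hk₁ 0
    have a₂ : y 0 = k₂ * Y₂ 0 := congrFun hk₂ 0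
    have b₁ : deriv y 0 = k₁ * deriv Y₁ 0 := by
      rw [hk₁]; exact ((h₁.hasDerivAt 0).const_mul k₁).deriv
    have b₂ : deriv y 0 = k₂ * deriv Y₂ 0 := by
      rw [hk₂]; exact ((h₂.hasDerivAt 0).const_mul k₂).deriv
    refine (mul_eq_zero.mp (?_ : k₁ * k₂ * _ = 0)).resolve_left (mul_ne_zero hk₁0 hk₂0)
    linear_combination (-(k₂ * Y₂ 0)) * b₁ + (k₂ * deriv Y₂ 0) * a₁ + y 0 * b₂ - deriv y 0 * a₂
  · intro hw
    obtain ⟨k, hk⟩ := exists_eq_const_mul_of_wronskian h₁ h₂ (ne_zero_of_ratio l₁) hw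
    refine ⟨Y₂, ne_zero_of_ratio l₂, h₂, ?_, g₂.decaysOn_of_ratio l₂⟩
    rw [hk]
    exact (g₁.decaysOn_of_ratio l₁).const_mul k

lemma one_le_natDegree_potential {d m : ℕ} (hm : 1 ≤ m) (hmd : m < d)
    {p : ℝ × (Fin (m + 1) → ℂ)} (hp : p.2 (Fin.last m) ≠ 0) : 1 ≤ (potential d p).natDegree :=
  hm.trans (le_natDegree_of_ne_zero (by rwa [coeff_potential_of_lt hmd]))

/-- The normalized decaying solutions along an admissible ray. -/
lemma Admissible.exists_solutions {d m : ℕ} (hm : 1 ≤ m) (hmd : m < d)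
    {K : Set (Fin (m + 1) → ℂ)} (hK : IsCompact K) (ham : ∀ a ∈ K, a (Fin.last m) ≠ 0)
    {θ : ℝ} (h : Admissible d K θ) :
    ∃ (c C R : ℝ) (A B : ℝ × (Fin (m + 1) → ℂ) → ℂ → ℂ),
      (∀ p ∈ Set.Icc (0 : ℝ) 1 ×ˢ K, GoodRay (potential d p) θ c C R) ∧
      ContinuousOn (Function.uncurry A) ((Set.Icc (0 : ℝ) 1 ×ˢ K) ×ˢ Set.univ) ∧
      ContinuousOn (Function.uncurry B) ((Set.Icc (0 : ℝ) 1 ×ˢ K) ×ˢ Set.univ) ∧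
      (∀ p ∈ Set.Icc (0 : ℝ) 1 ×ˢ K, Differentiable ℂ (A p)) ∧
      (∀ p ∈ Set.Icc (0 : ℝ) 1 ×ˢ K, Differentiable ℂ (B p)) ∧
      ∀ p ∈ Set.Icc (0 : ℝ) 1 ×ˢ K, ∀ lam, Tendsto (ratio (potential d p) θ R lam
        (solOf (potential d p) lam (A p lam) (B p lam))) atTop (𝓝 1) := by
  obtain ⟨c, C, R, hc, hC, hg⟩ := h.exists_goodRay hm hmd hK ham
  obtain ⟨A, B, hA, hB, hA', hB', hlim⟩ := exists_decaying_family (isCompact_Icc.prod hK)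
    (polyFamily_potential hmd _) hc hC hg
  refine ⟨c, C, R, A, B, hg, hA, hB, hA', hB', fun p hp lam => ?_⟩
  obtain ⟨G, T, -, -, hG⟩ := hlim ‖lam‖
  rw [tendsto_iff_norm_sub_tendsto_zero]
  refine squeeze_zero' (Eventually.of_forall fun _ => norm_nonneg _)
    ((eventually_ge_atTop T).mono fun r hr => hG p hp lam le_rfl r hr) ?_
  simpa using (tendsto_rpow_neg_atTop (by norm_num : (0 : ℝ) < 1 / 4)).const_mul G

/-- The Wronskian of normalized decaying solutions is a spectral determinant; it vanishes
identically precisely when the two rays have the same Stokes centre. -/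
theorem exists_spectral_determinant {d m : ℕ} (hm : 1 ≤ m) (hmd : m < d)
    {K : Set (Fin (m + 1) → ℂ)} (hK : IsCompact K) (ham : ∀ a ∈ K, a (Fin.last m) ≠ 0)
    {θ₁ θ₂ : ℝ} (h₁ : Admissible d K θ₁) (h₂ : Admissible d K θ₂) :
    ∃ D : ℝ × (Fin (m + 1) → ℂ) → ℂ → ℂ,
      ContinuousOn (Function.uncurry D) ((Set.Icc (0 : ℝ) 1 ×ˢ K) ×ˢ Set.univ) ∧
      (∀ p ∈ Set.Icc (0 : ℝ) 1 ×ˢ K, Differentiable ℂ (D p)) ∧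
      (∀ p ∈ Set.Icc (0 : ℝ) 1 ×ˢ K,
        eigenvalues (potential d p) θ₁ θ₂ = {lam | D p lam = 0}) ∧
      IsSibuyaDeterminant d (Set.Icc (0 : ℝ) 1 ×ˢ K) θ₁ θ₂ D ∧
      (∀ p ∈ Set.Icc (0 : ℝ) 1 ×ˢ K,
        D p = 0 ↔ dir (centre (potential d p) θ₁) = dir (centre (potential d p) θ₂)) := by
  obtain ⟨c₁, C₁, R₁, A₁, B₁, g₁, cA₁, cB₁, dA₁, dB₁, l₁⟩ := h₁.exists_solutions hm hmd hK ham
  obtain ⟨c₂, C₂, R₂, A₂, B₂, g₂, cA₂, cB₂, dA₂, dB₂, l₂⟩ := h₂.exists_solutions hm hmd hK ham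
  have hsep : ∀ {θ}, Admissible d K θ → ∀ p ∈ Set.Icc (0 : ℝ) 1 ×ˢ K,
      ¬ IsSeparating (potential d p) θ := by
    rintro θ ⟨δ, -, R, -, h⟩ p hp
    exact (h p hp).2.2
  set S := Set.Icc (0 : ℝ) 1 ×ˢ K with hS
  have hScomp : IsCompact S := isCompact_Icc.prod hK
  set Y₁ : ℝ × (Fin (m + 1) → ℂ) → ℂ → ℂ → ℂ := fun p lam =>
    solOf (potential d p) lam (A₁ p lam) (B₁ p lam) with hY₁
  set Y₂ : ℝ × (Fin (m + 1) → ℂ) → ℂ → ℂ → ℂ := fun p lam =>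
    solOf (potential d p) lam (A₂ p lam) (B₂ p lam) with hY₂
  have s₁ : ∀ p lam, IsSolution (potential d p) lam (Y₁ p lam) := fun p lam =>
    isSolution_solOf _ _ _ _
  have s₂ : ∀ p lam, IsSolution (potential d p) lam (Y₂ p lam) := fun p lam =>
    isSolution_solOf _ _ _ _
  set D : ℝ × (Fin (m + 1) → ℂ) → ℂ → ℂ := fun p lam =>
    B₁ p lam * A₂ p lam - A₁ p lam * B₂ p lam with hD
  have hDW : ∀ p lam, D p lam =
      deriv (Y₁ p lam) 0 * Y₂ p lam 0 - Y₁ p lam 0 * deriv (Y₂ p lam) 0 := fun p lam => by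
    simp only [hD, hY₁, hY₂, solOf_zero, deriv_solOf_zero]
  have heig : ∀ p ∈ S, eigenvalues (potential d p) θ₁ θ₂ = {lam | D p lam = 0} := by
    intro p hp
    ext lam
    rw [mem_eigenvalues_iff (g₁ p hp) (g₂ p hp) (s₁ p lam) (s₂ p lam) (l₁ p hp lam)
      (l₂ p hp lam), Set.mem_ofPred_eq, hDW]
  refine ⟨D, (cB₁.mul cA₂).sub (cA₁.mul cB₂), fun p hp =>
    ((dB₁ p hp).mul (dA₂ p hp)).sub ((dA₁ p hp).mul (dB₂ p hp)), heig, ?_, fun p hp => ?_⟩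
  · intro M
    refine ⟨max 1 (max (max R₁ (8 * M / c₁ ^ 2)) (max R₂ (8 * M / c₂ ^ 2))),
      lt_max_of_lt_left one_pos, fun r₀ hr₀ => ?_⟩
    simp only [max_le_iff] at hr₀
    obtain ⟨-, ⟨hR₁, hM₁⟩, hR₂, hM₂⟩ := hr₀
    obtain ⟨L₁, cL₁, dL₁, tL₁⟩ := exists_sibuya_factor hScomp (polyFamily_potential hmd S) g₁
      hR₁ hM₁
    obtain ⟨L₂, cL₂, dL₂, tL₂⟩ := exists_sibuya_factor hScomp (polyFamily_potential hmd S) g₂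
      hR₂ hM₂
    have hne : ∀ p lam, dir (θ₁ / 2) * Complex.exp (L₁ p lam) *
        (dir (θ₂ / 2) * Complex.exp (L₂ p lam)) ≠ 0 := fun p lam =>
      mul_ne_zero (mul_ne_zero (dir_ne_zero _) (Complex.exp_ne_zero _))
        (mul_ne_zero (dir_ne_zero _) (Complex.exp_ne_zero _))
    refine ⟨fun p lam z => dir (θ₁ / 2) * Complex.exp (L₁ p lam) * Y₁ p lam z,
      fun p lam z => dir (θ₂ / 2) * Complex.exp (L₂ p lam) * Y₂ p lam z,
      fun p lam => (dir (θ₁ / 2) * Complex.exp (L₁ p lam) *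
        (dir (θ₂ / 2) * Complex.exp (L₂ p lam)))⁻¹, ?_, fun p hp => ?_, fun p hp lam hlam => ?_⟩
    · exact ((continuousOn_const.mul cL₁.cexp).mul (continuousOn_const.mul cL₂.cexp)).inv₀
        fun x _ => hne x.1 x.2
    · exact (((dL₁ p hp).cexp.const_mul _).mul ((dL₂ p hp).cexp.const_mul _)).inv
        fun lam _ => hne p lam
    · have hlam' : ‖lam‖ ≤ M := by simpa using hlam
      refine ⟨(g₁ p hp).isSibuyaSolution hR₁ hM₁ hlam' (tL₁ p hp lam hlam) (s₁ p lam)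
          (l₁ p hp lam), (g₂ p hp).isSibuyaSolution hR₂ hM₂ hlam' (tL₂ p hp lam hlam) (s₂ p lam)
          (l₂ p hp lam), inv_ne_zero (hne p lam), fun z => ?_⟩
      have e₁ := (((s₁ p lam).hasDerivAt z).const_mul
        (dir (θ₁ / 2) * Complex.exp (L₁ p lam))).deriv
      have e₂ := (((s₂ p lam).hasDerivAt z).const_mul
        (dir (θ₂ / 2) * Complex.exp (L₂ p lam))).deriv
      rw [e₁, e₂, eq_inv_mul_iff_mul_eq₀ (hne p lam), hDW,
        wronskian_const (s₁ p lam) (s₂ p lam) 0 z]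
      ring
  · have hp0 := ham p.2 hp.2
    have hn := one_le_natDegree_potential hm hmd hp0
    have hs₁ := hsep h₁ p hp
    have hs₂ := hsep h₂ p hp
    constructor
    -- If D vanishes identically, every λ is an eigenvalue; moving the decay condition to the
    -- bisectors contradicts `exists_not_eigenvalue` unless these coincide.
    · intro h0
      by_contra hcon
      obtain ⟨lam, hlam⟩ := exists_not_eigenvalue hn (leading_mul_dir_centre _ θ₁)
        (leading_mul_dir_centre _ θ₂) hcon
      have hmem : lam ∈ eigenvalues (potential d p) θ₁ θ₂ := by
        rw [heig p hp]; exact congrFun h0 lam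
      obtain ⟨y, hne, hy, hd₁, hd₂⟩ := hmem
      exact hne (hlam y hy ((decaysOn_centre_iff hn hs₁ hy).mpr hd₁)
        ((decaysOn_centre_iff hn hs₂ hy).mpr hd₂))
    · intro hdir
      funext lam
      have hmem : lam ∈ eigenvalues (potential d p) θ₁ θ₂ := by
        have hd := (g₁ p hp).decaysOn_of_ratio (l₁ p hp lam)
        refine ⟨Y₁ p lam, ne_zero_of_ratio (l₁ p hp lam), s₁ p lam, hd, ?_⟩
        have hd' := (decaysOn_centre_iff hn hs₁ (s₁ p lam)).mpr hd
        exact (decaysOn_centre_iff hn hs₂ (s₁ p lam)).mp ((decaysOn_congr hdir).mp hd')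
      rw [heig p hp] at hmem
      exact hmem

/-- For t > 0 the leading term is tz^d, and a positive factor does not change its argument. At t = 0
the degree changes, so the bisectors there are unrelated; that case is reached only through
continuity of D. -/
lemma centre_potential {d m : ℕ} (hmd : m < d) {s t : ℝ} (hs : 0 < s) (ht : 0 < t)
    (a : Fin (m + 1) → ℂ) (θ : ℝ) :
    centre (potential d (s, a)) θ = centre (potential d (t, a)) θ := by
  have hdeg : ∀ u : ℝ, 0 < u → (potential d (u, a)).natDegree = d := fun u hu =>
    le_antisymm (natDegree_potential_le hmd _) (le_natDegree_of_ne_zero (by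
      rw [coeff_potential_degree hmd]; exact_mod_cast hu.ne'))
  have hlead : ∀ u : ℝ, 0 < u → (potential d (u, a)).leadingCoeff = u := fun u hu => by
    rw [leadingCoeff, hdeg u hu, coeff_potential_degree hmd]
  rw [centre, centre, hdeg s hs, hdeg t ht, hlead s hs, hlead t ht, Complex.arg_real_mul _ hs,
    Complex.arg_real_mul _ ht]

end SchroedingerRays

end

/-! ### Nonvanishing of the determinant and continuity of the spectrum up to t = 0 -/

theorem theorem2p2 (d m : ℕ) (hm : 1 ≤ m) (hmd : m < d)
    (K : Set (Fin (m + 1) → ℂ)) (hK : IsCompact K) (ham : ∀ a ∈ K, a (Fin.last m) ≠ 0)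
    (θ₁ θ₂ : ℝ) (h₁ : Admissible d K θ₁) (h₂ : Admissible d K θ₂) :
    -- the spectral determinant
    (∃ D : ℝ × (Fin (m + 1) → ℂ) → ℂ → ℂ,
      ContinuousEntireFamily D (Set.Icc (0 : ℝ) 1 ×ˢ K) ∧
      (∀ p ∈ Set.Icc (0 : ℝ) 1 ×ˢ K,
        eigenvalues (potential d p) θ₁ θ₂ = {lam | D p lam = 0}) ∧
      IsSibuyaDeterminant d (Set.Icc (0 : ℝ) 1 ×ˢ K) θ₁ θ₂ D ∧
      (∀ p ∈ Set.Icc (0 : ℝ) 1 ×ˢ K,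
        ¬ SameStokesSector (potential d p) θ₁ θ₂ → D p ≠ 0)) ∧
    -- continuity of the spectrum
    ((∀ a ∈ K, ¬ SameStokesSector (potential d ((0 : ℝ), a)) θ₁ θ₂) →
      DependsContinuouslyOn (fun p => eigenvalues (potential d p) θ₁ θ₂)
        (Set.Icc (0 : ℝ) 1 ×ˢ K)) := by
  obtain ⟨D, hcont, hdiff, heig, hsib, hzero⟩ :=
    exists_spectral_determinant hm hmd hK ham h₁ h₂
  have hfam := continuousEntireFamily_of_continuousOn hdiff hcont
  have hstokes : ∀ p ∈ Set.Icc (0 : ℝ) 1 ×ˢ K,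
      ¬ SameStokesSector (potential d p) θ₁ θ₂ → D p ≠ 0 := by
    intro p hp hnot h0
    have hn := one_le_natDegree_potential hm hmd (ham p.2 hp.2)
    have hP : potential d p ≠ 0 := by
      intro h
      rw [h] at hn
      simp at hn
    obtain ⟨δ₁, -, S₁, -, had₁⟩ := h₁
    obtain ⟨δ₂, -, S₂, -, had₂⟩ := h₂
    exact hnot (sameStokesSector_of_centre hP (had₁ p hp).2.2 (had₂ p hp).2.2
      ((hzero p hp).mp h0))
  refine ⟨⟨D, hfam, heig, hsib, hstokes⟩, fun h0 => ⟨D, hfam, fun p hp => ⟨?_, heig p hp⟩⟩⟩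
  obtain ⟨t, a⟩ := p
  obtain ⟨⟨ht0, ht1⟩, ha⟩ := hp
  have hmem : ((0 : ℝ), a) ∈ Set.Icc (0 : ℝ) 1 ×ˢ K := ⟨⟨le_rfl, zero_le_one⟩, ha⟩
  rcases eq_or_lt_of_le ht0 with rfl | htpos
  · exact hstokes _ hmem (h0 a ha)
  intro hD
  have hcentre := (hzero (t, a) ⟨⟨ht0, ht1⟩, ha⟩).mp hD
  -- the Stokes sectors are the same for all positive values of the first parameter
  have hDs : ∀ s : ℝ, 0 < s → s ≤ 1 → D (s, a) = 0 := fun s hs hs1 => by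
    rw [hzero (s, a) ⟨⟨hs.le, hs1⟩, ha⟩, centre_potential hmd hs htpos,
      centre_potential hmd hs htpos]
    exact hcentre
  -- D(1/(n+1), a) ≡ 0 for all n, and D is continuous up to t = 0, so D(0, a) ≡ 0, which the
  -- hypothesis on the Stokes sectors at t = 0 excludes.
  refine hstokes _ hmem (h0 a ha) (funext fun lam => ?_)
  have hu : Tendsto (fun n : ℕ => (((1 / ((n : ℝ) + 1), a), lam) : (ℝ × (Fin (m + 1) → ℂ)) × ℂ))
      atTop (𝓝[(Set.Icc (0 : ℝ) 1 ×ˢ K) ×ˢ Set.univ] ((0, a), lam)) := by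
    refine tendsto_nhdsWithin_iff.mpr ⟨?_, Eventually.of_forall fun n => ?_⟩
    · exact (tendsto_one_div_add_atTop_nhds_zero_nat.prodMk_nhds
        tendsto_const_nhds).prodMk_nhds tendsto_const_nhds
    · refine ⟨⟨⟨by positivity, ?_⟩, ha⟩, Set.mem_univ _⟩
      exact (div_le_one (by positivity)).mpr (by linarith [n.cast_nonneg (α := ℝ)])
  have hlim := (hcont ((0, a), lam) ⟨hmem, Set.mem_univ _⟩).tendsto.comp hu
  refine tendsto_nhds_unique hlim (tendsto_const_nhds.congr fun n => ?_)
  have hpos : (0 : ℝ) < 1 / ((n : ℝ) + 1) := by positivity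
  have hle : 1 / ((n : ℝ) + 1) ≤ 1 :=
    (div_le_one (by positivity)).mpr (by linarith [n.cast_nonneg (α := ℝ)])
  exact (congrFun (hDs _ hpos hle) lam).symm
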